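/- **Model.** A finite simple unweighted undirected graph $G$ on vertex set $\{0,\dots,n-1\}$ is given both as an adjacency list (for every vertex, an array of its neighbours in arbitrary order, whose length and whose entries can be probed) and as an adjacency matrix. Running time is counted on a randomized random access machine with logarithmic cost (one plus the bit lengths of the numbers handled by each instruction), whose random instruction draws a uniform element of $\{0,\dots,m-1\}$. A *randomized adjacency-oracle algorithm* consists of a randomized preprocessing program, which receives $n$, an integer parameter $r\ge 1$ and access to $G$ and writes a data structure to memory, and a deterministic query program, which on a pair $(u,v)$ reads this data structure without modifying it, may probe the adjacency matrix (but not the adjacency list) of $G$, and outputs one bit. The data structure is an *adjacency oracle* for a graph $H$ on the same vertices if the bit is $1$ exactly when $uv\in E(H)$, for all pairs $(u,v)$. A *$5$-spanner* of $G$ is an edge-subgraph $H\subseteq G$ with $\mathrm{dist}_H(s,t)\le 5\,\mathrm{dist}_G(s,t)$ for all vertices $s,t$. Write $D$ for the average degree of $G$, $\delta(G)$ for its minimum degree, and $\delta=\max(\delta(G),n^{1/3})$. **Theorem.** For every constant $c>0$ there are a randomized adjacency-oracle algorithm and constants $C>0$ and $k\in\mathbb N$ such that for every $n\ge 2$, every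 $n$-vertex graph $G$ (with any ordering of its adjacency lists) and every integer $r\ge 1$, with probability at least $1-n^{-c}$ the preprocessing takes time at most $$C(\log n)^k\Bigl(n\min\bigl(D/\delta,\sqrt D\bigr)+nr\Bigr)$$ and produces an adjacency oracle, with query time at most $C(\log n)^k$, for a $5$-spanner $H$ of $G$ with $$|E(H)|\le C(\log n)^k\Bigl(\frac{n^2}{r\delta}+\frac{n^2}{\delta^2}+n\Bigr).$$ Moreover, with $r=\lceil n^{1/3}\rceil$, for every $n\ge2$ and every $n$-vertex graph $G$, the same algorithm with probability at least $1-n^{-c}$ takes preprocessing time at most $C(\log n)^k n^{3/2}$ and produces an adjacency oracle, with query time at most $C(\log n)^k$, for a $5$-spanner of $G$ with at most $C(\log n)^k n^{4/3}$ edges. -/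

import Mathlib

/-! A randomized random access machine with logarithmic cost and graph probes. -/

/-- An adjacency list representation of `G`: for every vertex an array of its neighbours,
each listed exactly once, in an arbitrary order. -/
structure AdjacencyList {n : ℕ} (G : SimpleGraph (Fin n)) where
  nbrs : Fin n → List (Fin n)
  nodup : ∀ v, (nbrs v).Nodup
  mem_iff : ∀ v w, w ∈ nbrs v ↔ G.Adj v w

namespace AdjacencyList

variable {n : ℕ} {G : SimpleGraph (Fin n)}

/-- Length of the list of `v` (`0` if `v` is not the number of a vertex). -/
def degAt (L : AdjacencyList G) (v : ℕ) : ℕ :=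
  if h : v < n then (L.nbrs ⟨v, h⟩).length else 0

/-- The entry of index `i` in the list of `v` (`0` if there is none). -/
def nbrAt (L : AdjacencyList G) (v i : ℕ) : ℕ :=
  if h : v < n then
    if h' : i < (L.nbrs ⟨v, h⟩).length then ((L.nbrs ⟨v, h⟩)[i] : Fin n) else 0
  else 0

end AdjacencyList

open Classical in
/-- The entry `(u, v)` of the adjacency matrix (`0` outside the matrix). -/
noncomputable def adjAt {n : ℕ} (G : SimpleGraph (Fin n)) (u v : ℕ) : ℕ :=
  if ∃ (hu : u < n) (hv : v < n), G.Adj ⟨u, hu⟩ ⟨v, hv⟩ then 1 else 0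

/-- Arithmetic operations on natural numbers; `sub` is truncated, division by `0` gives `0`. -/
inductive ArithOp
  | add | sub | mul | div | mod

def ArithOp.eval : ArithOp → ℕ → ℕ → ℕ
  | add, a, b => a + b
  | sub, a, b => a - b
  | mul, a, b => a * b
  | div, a, b => a / b
  | mod, a, b => a % b

/-- Programs. Registers are numbered by natural numbers; a program mentions finitely many of them.
* `const x a`: `x := a`; `copy x y`: `x := y`; `arith o x y z`: `x := y o z`;
* `load x a`: `x := mem[a]`; `store a x`: `mem[a] := x` (indirect addressing through `a`);
* `deg x v`, `nbr x v i`: probes of the adjacency list of the input graph;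
* `adj x u v`: probe of the adjacency matrix of the input graph;
* `rand x m`: `x :=` a fresh uniformly random element of `{0, …, m - 1}`;
* `ifz x p q`: run `p` if `x = 0`, else `q`;
* `loop x p`: run `p` as many times as the value of `x` at the entry of the loop. -/
inductive Cmd
  | skip
  | const (x a : ℕ)
  | copy (x y : ℕ)
  | arith (o : ArithOp) (x y z : ℕ)
  | load (x a : ℕ)
  | store (a x : ℕ)
  | deg (x v : ℕ)
  | nbr (x v i : ℕ)
  | adj (x u v : ℕ)
  | rand (x m : ℕ)
  | seq (p q : Cmd)
  | ifz (x : ℕ) (p q : Cmd)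
  | loop (x : ℕ) (p : Cmd)

/-- Registers, random access memory, and the time consumed so far. -/
structure MState where
  regs : ℕ → ℕ
  mem : ℕ → ℕ
  time : ℕ

namespace MState

def tick (s : MState) (t : ℕ) : MState := { s with time := s.time + t }

/-- Set register `x` to `a`, at cost `t`. -/
def setReg (s : MState) (x a t : ℕ) : MState :=
  { s with regs := Function.update s.regs x a, time := s.time + t }

/-- Set memory cell `i` to `a`, at cost `t`. -/
def setMem (s : MState) (i a t : ℕ) : MState :=
  { s with mem := Function.update s.mem i a, time := s.time + t }

end MState

/-- The uniform distribution on `{0, …, m - 1}` (concentrated at `0` if `m = 0`). -/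
noncomputable def uniformBelow : ℕ → PMF ℕ
  | 0 => PMF.pure 0
  | m + 1 => (PMF.uniformOfFintype (Fin (m + 1))).map (fun i => (i : ℕ))

/-- `k`-fold repetition of a randomized state transformation. -/
noncomputable def repeatCmd (f : MState → PMF MState) : ℕ → MState → PMF MState
  | 0, s => PMF.pure s
  | k + 1, s => (f s).bind (repeatCmd f k)

/-- The distribution of the final state. The cost of an instruction is logarithmic: one plus the
binary lengths (`Nat.size`) of all the numbers it reads or produces, addresses included. -/
noncomputable def Cmd.exec {n : ℕ} {G : SimpleGraph (Fin n)} (L : AdjacencyList G) :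
    Cmd → MState → PMF MState
  | skip, s => PMF.pure (s.tick 1)
  | const x a, s => PMF.pure (s.setReg x a (1 + a.size))
  | copy x y, s => PMF.pure (s.setReg x (s.regs y) (1 + (s.regs y).size))
  | arith o x y z, s =>
      PMF.pure (s.setReg x (o.eval (s.regs y) (s.regs z))
        (1 + (s.regs y).size + (s.regs z).size + (o.eval (s.regs y) (s.regs z)).size))
  | load x a, s =>
      PMF.pure (s.setReg x (s.mem (s.regs a)) (1 + (s.regs a).size + (s.mem (s.regs a)).size))
  | store a x, s =>
      PMF.pure (s.setMem (s.regs a) (s.regs x) (1 + (s.regs a).size + (s.regs x).size))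
  | deg x v, s =>
      PMF.pure (s.setReg x (L.degAt (s.regs v))
        (1 + (s.regs v).size + (L.degAt (s.regs v)).size))
  | nbr x v i, s =>
      PMF.pure (s.setReg x (L.nbrAt (s.regs v) (s.regs i))
        (1 + (s.regs v).size + (s.regs i).size + (L.nbrAt (s.regs v) (s.regs i)).size))
  | adj x u v, s =>
      PMF.pure (s.setReg x (adjAt G (s.regs u) (s.regs v))
        (1 + (s.regs u).size + (s.regs v).size + 1))
  | rand x m, s =>
      (uniformBelow (s.regs m)).map (fun a => s.setReg x a (1 + (s.regs m).size + a.size))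
  | seq p q, s => (exec L p s).bind (exec L q)
  | ifz x p q, s =>
      if s.regs x = 0 then exec L p (s.tick (1 + (s.regs x).size))
      else exec L q (s.tick (1 + (s.regs x).size))
  | loop x p, s =>
      repeatCmd (fun t => exec L p (t.tick (1 + (s.regs x).size))) (s.regs x)
        (s.tick (1 + (s.regs x).size))

/-- Query programs: deterministic, without write access to the memory, and with no access to the
input graph except through its adjacency matrix. -/
def Cmd.IsQuery : Cmd → Prop
  | store _ _ => False
  | deg _ _ => False
  | nbr _ _ _ => False
  | rand _ _ => False
  | seq p q => p.IsQuery ∧ q.IsQuery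
  | ifz _ p q => p.IsQuery ∧ q.IsQuery
  | loop _ p => p.IsQuery
  | _ => True

/-- A randomized preprocessing program together with a deterministic query program. -/
structure OracleAlgorithm where
  preprocess : Cmd
  query : Cmd
  query_isQuery : query.IsQuery

/-- Initial state of the preprocessing: `n` in register `0`, the parameter `r` in register `1`,
everything else zero. -/
def startState (n r : ℕ) : MState where
  regs := fun i => if i = 0 then n else if i = 1 then r else 0
  mem := fun _ => 0
  time := 0

/-- Initial state of the query `(u, v)` to the data structure stored in the memory `M`. -/
def queryState (M : ℕ → ℕ) (u v : ℕ) : MState where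
  regs := fun i => if i = 0 then u else if i = 1 then v else 0
  mem := M
  time := 0

open Classical in
/-- The memory contents `M`, with the query program `q`, is an adjacency oracle for `H`, with query
time at most `B`: every query `(u, v)` leaves the bit `[uv ∈ E(H)]` in register `0`. -/
def IsAdjacencyOracle {n : ℕ} {G : SimpleGraph (Fin n)} (L : AdjacencyList G) (q : Cmd)
    (M : ℕ → ℕ) (H : SimpleGraph (Fin n)) (B : ℝ) : Prop :=
  ∀ u v : Fin n, ∀ t ∈ (q.exec L (queryState M u v)).support,
    t.regs 0 = (if H.Adj u v then 1 else 0) ∧ (t.time : ℝ) ≤ B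

/-- `H` is a `k`-spanner of `G`: an edge-subgraph with `dist_H ≤ k * dist_G`
(distances are `⊤` between different components). -/
def IsSpanner {V : Type*} (k : ℕ) (H G : SimpleGraph V) : Prop :=
  H ≤ G ∧ ∀ s t : V, H.edist s t ≤ (k : ℕ∞) * G.edist s t

/-- The probability that the preprocessing of the given input takes time at most `T` and yields an
adjacency oracle, with query time at most `B`, for a `k`-spanner with at most `m` edges. -/
noncomputable def OracleAlgorithm.spannerProb (A : OracleAlgorithm) {n : ℕ}
    {G : SimpleGraph (Fin n)} (L : AdjacencyList G) (r k : ℕ) (T B m : ℝ) : ENNReal :=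
  (A.preprocess.exec L (startState n r)).toOuterMeasure
    {s | (s.time : ℝ) ≤ T ∧
      ∃ H : SimpleGraph (Fin n), IsSpanner k H G ∧ (H.edgeSet.ncard : ℝ) ≤ m ∧
        IsAdjacencyOracle L A.query s.mem H B}

open Classical in
/-- The average degree. -/
noncomputable def avgDegree {n : ℕ} (G : SimpleGraph (Fin n)) : ℝ :=
  (∑ v, (G.degree v : ℝ)) / n

open Classical in
/-- The maximum of the minimum degree and `n^{1/3}`. -/
noncomputable def degreeFloor {n : ℕ} (G : SimpleGraph (Fin n)) : ℝ :=
  max (G.minDegree : ℝ) ((n : ℝ) ^ (1 / 3 : ℝ))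

/-! Put l = K · `n.size`, a multiple of log n, and let M = nD be the sum of the degrees. A vertex is
heavy if its degree is at least n^{1/3}. Every vertex b draws a rank R(b) uniformly below n, and a
heavy vertex a may adopt a neighbour b as its center when R(b) · deg(a) ≤ n · l. The threshold
depends on the degree of a, so a neighbour qualifies with probability about l / deg(a). Hence every
heavy vertex has a candidate with high probability (`prob_no_center`), while only O(nl / y) vertices
can be centers of vertices of degree at least y (`prob_weight`).

Each vertex also samples r · l random incident edges. A sampled edge uv between vertices with
centers is written into a table cell indexed by the center of u, the center of v and the level of u,
that is, the bit length of its degree. An edge of G is kept if, in one of its orientations, the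
first end has no center, or the second end is the center of the first, or its cell is empty, or its
cell holds this very edge.

Stretch: an edge uv that is not kept has a cell holding some edge v'w' between the same two
clusters, and u, center, v', w', center, v is a path of length 5 in the spanner
(`Output.isSpanner`).

Size: edges at vertices without a center are edges at light vertices (`lightSum_mul_le`). A cell at
level k that represents more than 2^k / r edges is filled with high probability (`prob_no_sample`).
At the level of degrees in [2^j, 2^{j+1}) there are at most (5nl / 2^j)(5nl / δ) relevant cells; an
empty one accounts for at most 2^{j+1} / r edges and a filled one for a single edge. This gives n² /
(rδ) and n² / δ² up to powers of log n (`Output.card_sparse`, `Output.card_dense`).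

Time: centers must be found without reading all of G. Heavy vertices of degree below √D read their
own lists, at total cost at most n · min(D/δ, √D). For the remaining heavy vertices let d be their
least degree, so d ≥ max(δ, √D). Only vertices with R(b) · d ≤ n · l can serve them, and these offer
themselves to their neighbours; the total degree of such vertices is about lnD / d
(`complete_of_visited`, `sum_scanned_le`).

On the machine all stored numbers have O(log n) bits after the first instruction, so `Tr` and `Pr`
charge one `unitCost β` per structured command. Memory cell 8i + f is entry i of array f: 0 is a
table of bit lengths, 1 the ranks, 2 the sampled list positions, 3 the centers plus one (0 means
none), 4 the cells, 6 the levels; the single cell 5 keeps n for the queries. Independence is used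
only through the inequality `IsIndep`, which suffices for exponential moments and for the
probability that no event of a family occurs. -/

namespace SpannerOracle

/-! ### Binary lengths -/

lemma size_mul_le (a b : ℕ) : (a * b).size ≤ a.size + b.size := by
  rw [Nat.size_le, pow_add]
  exact Nat.mul_lt_mul'' (Nat.lt_size_self a) (Nat.lt_size_self b)

lemma size_add_le (a b : ℕ) : (a + b).size ≤ a.size + b.size := by
  rcases Nat.eq_zero_or_pos a with rfl | ha
  · simp
  rcases Nat.eq_zero_or_pos b with rfl | hb
  · simp
  rw [Nat.size_le, pow_add]
  have h1 := Nat.lt_size_self a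
  have h2 := Nat.lt_size_self b
  have h3 : 2 ^ 1 ≤ 2 ^ a.size := Nat.pow_le_pow_right (by norm_num) (Nat.size_pos.2 ha)
  have h4 : 2 ^ 1 ≤ 2 ^ b.size := Nat.pow_le_pow_right (by norm_num) (Nat.size_pos.2 hb)
  nlinarith

lemma size_eval_le (o : ArithOp) (a b : ℕ) : (o.eval a b).size ≤ a.size + b.size := by
  cases o
  · exact size_add_le a b
  · exact (Nat.size_le_size (Nat.sub_le a b)).trans (Nat.le_add_right _ _)
  · exact size_mul_le a b
  · exact (Nat.size_le_size (Nat.div_le_self a b)).trans (Nat.le_add_right _ _)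
  · exact (Nat.size_le_size (Nat.mod_le a b)).trans (Nat.le_add_right _ _)

/-- Halving removes one binary digit. This recursion lets the program tabulate all bit lengths at a
constant number of commands per entry. -/
lemma size_succ_eq (d : ℕ) : (d + 1).size = ((d + 1) / 2).size + 1 := by
  have h := Nat.size_bit (b := (d + 1).bodd) (n := (d + 1).div2)
    (by rw [Nat.bit_bodd_div2]; omega)
  rwa [Nat.bit_bodd_div2, Nat.div2_val] at h

lemma size_le_self (a : ℕ) : a.size ≤ a := by
  rw [Nat.size_le]; exact Nat.lt_two_pow_self

/-! ### Expressions -/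

/-- Arithmetic expressions over registers, memory cells and graph probes. -/
inductive Exp
  | var (x : ℕ)
  | lit (a : ℕ)
  | bin (o : ArithOp) (e f : Exp)
  | mem (e : Exp)
  | deg (e : Exp)
  | nbr (e f : Exp)
  | adj (e f : Exp)

namespace Exp

instance : Add Exp := ⟨bin .add⟩
instance : Sub Exp := ⟨bin .sub⟩
instance : Mul Exp := ⟨bin .mul⟩
instance : Div Exp := ⟨bin .div⟩
instance (a : ℕ) : OfNat Exp a := ⟨lit a⟩

variable {n : ℕ} {G : SimpleGraph (Fin n)} (L : AdjacencyList G)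

/-- The value of an expression, for register contents `ρ` and memory contents `m`. -/
noncomputable def eval (ρ m : ℕ → ℕ) : Exp → ℕ
  | var x => ρ x
  | lit a => a
  | bin o e f => o.eval (eval ρ m e) (eval ρ m f)
  | mem e => m (eval ρ m e)
  | deg e => L.degAt (eval ρ m e)
  | nbr e f => L.nbrAt (eval ρ m e) (eval ρ m f)
  | adj e f => adjAt G (eval ρ m e) (eval ρ m f)

section
variable (ρ m : ℕ → ℕ) (e f : Exp) (a : ℕ)
@[simp] lemma eval_var : (var a).eval L ρ m = ρ a := rfl
@[simp] lemma eval_ofNat : (ofNat(a) : Exp).eval L ρ m = a := rfl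
@[simp] lemma eval_add : (e + f).eval L ρ m = e.eval L ρ m + f.eval L ρ m := rfl
@[simp] lemma eval_sub : (e - f).eval L ρ m = e.eval L ρ m - f.eval L ρ m := rfl
@[simp] lemma eval_mul : (e * f).eval L ρ m = e.eval L ρ m * f.eval L ρ m := rfl
@[simp] lemma eval_div : (e / f).eval L ρ m = e.eval L ρ m / f.eval L ρ m := rfl
@[simp] lemma eval_mem : (mem e).eval L ρ m = m (e.eval L ρ m) := rfl
@[simp] lemma eval_deg : (deg e).eval L ρ m = L.degAt (e.eval L ρ m) := rfl
@[simp] lemma eval_nbr : (nbr e f).eval L ρ m = L.nbrAt (e.eval L ρ m) (f.eval L ρ m) := rfl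
@[simp] lemma eval_adj : (adj e f).eval L ρ m = adjAt G (e.eval L ρ m) (f.eval L ρ m) := rfl
end

/-- Compilation to a program that leaves the value in register `d` and uses only the registers
from `d` on as work space. -/
def comp : Exp → ℕ → Cmd
  | var x, d => .copy d x
  | lit a, d => .const d a
  | bin o e f, d => .seq (comp e d) (.seq (comp f (d + 1)) (.arith o d d (d + 1)))
  | mem e, d => .seq (comp e d) (.load d d)
  | deg e, d => .seq (comp e d) (.deg d d)
  | nbr e f, d => .seq (comp e d) (.seq (comp f (d + 1)) (.nbr d d (d + 1)))
  | adj e f, d => .seq (comp e d) (.seq (comp f (d + 1)) (.adj d d (d + 1)))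

/-- The binary length of the value is at most `wt` times that of the longest number read. -/
def wt : Exp → ℕ
  | bin _ e f => wt e + wt f
  | _ => 1

/-- The cost of the evaluation is at most `cost` times the length of the longest number read. -/
def cost : Exp → ℕ
  | var _ => 2
  | lit _ => 2
  | bin _ e f => cost e + cost f + (1 + 2 * (wt e + wt f))
  | mem e => cost e + (2 + wt e)
  | deg e => cost e + (2 + wt e)
  | nbr e f => cost e + cost f + (2 + wt e + wt f)
  | adj e f => cost e + cost f + (2 + wt e + wt f)

/-- Only registers below `32` are read, and all literals are small. -/
def ok : Exp → Bool
  | var x => x < 32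
  | lit a => a < 16
  | bin _ e f => ok e && ok f
  | mem e => ok e
  | deg e => ok e
  | nbr e f => ok e && ok f
  | adj e f => ok e && ok f

/-- `ok`, with a bound for the cost. -/
def chk (e : Exp) : Bool := e.ok && decide (e.cost + e.wt ≤ 4000)

end Exp

variable {n : ℕ} {G : SimpleGraph (Fin n)} (L : AdjacencyList G)

lemma degAt_le (v : ℕ) : L.degAt v ≤ n := by
  unfold AdjacencyList.degAt
  split_ifs with h
  · simpa using (L.nodup ⟨v, h⟩).length_le_card
  · exact Nat.zero_le _

lemma nbrAt_le (v i : ℕ) : L.nbrAt v i ≤ n := by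
  unfold AdjacencyList.nbrAt
  split_ifs with h h'
  · exact (Fin.is_lt _).le
  · exact Nat.zero_le _
  · exact Nat.zero_le _

lemma adjAt_le (u v : ℕ) : adjAt G u v ≤ 1 := by
  unfold adjAt; split_ifs <;> simp

/-- All numbers in the registers below `32` and in memory have length at most `β`, and so has
the number of vertices. -/
structure Bdd (n β : ℕ) (ρ m : ℕ → ℕ) : Prop where
  four : 4 ≤ β
  card : n.size ≤ β
  reg : ∀ x < 32, (ρ x).size ≤ β
  mem : ∀ a, (m a).size ≤ β

lemma Bdd.setReg {β : ℕ} {ρ m : ℕ → ℕ} (h : Bdd n β ρ m) (x : ℕ) {a : ℕ} (ha : a.size ≤ β) :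
    Bdd n β (Function.update ρ x a) m :=
  ⟨h.four, h.card, fun y hy => by
    by_cases hyx : y = x
    · subst hyx; simpa using ha
    · simpa [hyx] using h.reg y hy, h.mem⟩

lemma Bdd.setMem {β : ℕ} {ρ m : ℕ → ℕ} (h : Bdd n β ρ m) (i : ℕ) {a : ℕ} (ha : a.size ≤ β) :
    Bdd n β ρ (Function.update m i a) :=
  ⟨h.four, h.card, h.reg, fun y => by
    by_cases hyx : y = i
    · subst hyx; simpa using ha
    · simpa [hyx] using h.mem y⟩

namespace Exp

lemma size_eval {β : ℕ} {ρ m : ℕ → ℕ} (hB : Bdd n β ρ m) (e : Exp) (h : e.ok = true) :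
    (e.eval L ρ m).size ≤ e.wt * β := by
  have h4 := hB.four
  induction e with
  | var x => simpa [wt, eval] using hB.reg x (by simpa [ok] using h)
  | lit a =>
    have : a < 16 := by simpa [ok] using h
    have h5 : a.size ≤ 4 := Nat.size_le.2 (by omega)
    simp only [wt, eval]; omega
  | bin o e f he hf =>
    simp only [ok, Bool.and_eq_true] at h
    have := size_eval_le o (e.eval L ρ m) (f.eval L ρ m)
    have h1 := he h.1
    have h2 := hf h.2
    simp only [wt, eval, add_mul]; omega
  | mem e he => simpa [wt, eval] using hB.mem _
  | deg e he => simpa [wt, eval] using (Nat.size_le_size (degAt_le L _)).trans hB.card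
  | nbr e f he hf => simpa [wt, eval] using (Nat.size_le_size (nbrAt_le L _ _)).trans hB.card
  | adj e f he hf =>
    have h5 := Nat.size_le_size (adjAt_le (G := G) (e.eval L ρ m) (f.eval L ρ m))
    rw [Nat.size_one] at h5
    simp only [wt, eval]; omega

lemma eval_congr {ρ ρ' m : ℕ → ℕ} (hρ : ∀ x < 32, ρ x = ρ' x) (e : Exp) (h : e.ok = true) :
    e.eval L ρ m = e.eval L ρ' m := by
  induction e with
  | var x => exact hρ x (by simpa [ok] using h)
  | lit a => rfl
  | bin o e f he hf =>
    simp only [ok, Bool.and_eq_true] at h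
    simp only [eval, he h.1, hf h.2]
  | mem e he => simp only [eval, he h]
  | deg e he => simp only [eval, he h]
  | nbr e f he hf =>
    simp only [ok, Bool.and_eq_true] at h
    simp only [eval, he h.1, hf h.2]
  | adj e f he hf =>
    simp only [ok, Bool.and_eq_true] at h
    simp only [eval, he h.1, hf h.2]

/-- Second operands are compiled from register `d + 1` on, so the first value survives in `d`.
Expressions read only registers below 32 ≤ `d`, so scratch writes cannot change the value of what is
evaluated later. -/
lemma exec_comp {β : ℕ} (e : Exp) (h : e.ok = true) :
    ∀ (d : ℕ) (s : MState), 32 ≤ d → Bdd n β s.regs s.mem →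
    ∃ s', (e.comp d).exec L s = PMF.pure s' ∧ (∀ y < d, s'.regs y = s.regs y) ∧
      s'.regs d = e.eval L s.regs s.mem ∧ s'.mem = s.mem ∧
      s'.time ≤ s.time + e.cost * β := by
  have agree : ∀ {d : ℕ} {s s' : MState}, 32 ≤ d → Bdd n β s.regs s.mem →
      (∀ y < d, s'.regs y = s.regs y) → s'.mem = s.mem → Bdd n β s'.regs s'.mem := by
    intro d s s' hd hB hr hm
    exact ⟨hB.four, hB.card, fun x hx => by rw [hr x (by omega)]; exact hB.reg x hx,
      by rw [hm]; exact hB.mem⟩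
  induction e with
  | var x =>
    intro d s hd hB
    have hx : x < 32 := by simpa [ok] using h
    refine ⟨_, rfl, fun y hy => ?_, ?_, rfl, ?_⟩
    · simp [MState.setReg, hy.ne]
    · simp [MState.setReg]
    · have := hB.reg x hx
      have := hB.four
      simp only [MState.setReg, cost]; omega
  | lit a =>
    intro d s hd hB
    refine ⟨_, rfl, fun y hy => ?_, ?_, rfl, ?_⟩
    · simp [MState.setReg, hy.ne]
    · simp [MState.setReg, eval]
    · have : a < 16 := by simpa [ok] using h
      have h5 : a.size ≤ 4 := Nat.size_le.2 (by omega)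
      have := hB.four
      simp only [MState.setReg, cost]; omega
  | bin o e f he hf =>
    intro d s hd hB
    have h' := h
    simp only [ok, Bool.and_eq_true] at h'
    obtain ⟨s1, x1, r1, v1, m1, t1⟩ := he h'.1 d s hd hB
    obtain ⟨s2, x2, r2, v2, m2, t2⟩ := hf h'.2 (d + 1) s1 (by omega) (agree hd hB r1 m1)
    have hv : s2.regs (d + 1) = f.eval L s.regs s.mem := by
      rw [v2, m1]; exact eval_congr L (fun x hx => r1 x (by omega)) f h'.2
    have hv' : s2.regs d = e.eval L s.regs s.mem := by rw [r2 d (by omega), v1]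
    refine ⟨s2.setReg d (o.eval (s2.regs d) (s2.regs (d + 1))) (1 + (s2.regs d).size +
      (s2.regs (d + 1)).size + (o.eval (s2.regs d) (s2.regs (d + 1))).size), ?_, fun y hy => ?_, ?_, ?_, ?_⟩
    · simp only [comp, Cmd.exec, x1, x2, PMF.pure_bind]
    · simp [MState.setReg, hy.ne, r2 y (by omega), r1 y hy]
    · simp [MState.setReg, hv, hv', eval]
    · simp [MState.setReg, m1, m2]
    · have h1 := size_eval L hB e h'.1
      have h2 := size_eval L hB f h'.2
      have h3 := size_eval_le o (e.eval L s.regs s.mem) (f.eval L s.regs s.mem)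
      have := hB.four
      simp only [MState.setReg, cost, hv, hv', add_mul, mul_add, two_mul] at *
      omega
  | mem e he =>
    intro d s hd hB
    obtain ⟨s1, x1, r1, v1, m1, t1⟩ := he h d s hd hB
    refine ⟨s1.setReg d (s1.mem (s1.regs d)) (1 + (s1.regs d).size + (s1.mem (s1.regs d)).size), ?_,
      fun y hy => ?_, ?_, ?_, ?_⟩
    · simp only [comp, Cmd.exec, x1, PMF.pure_bind]
    · simp [MState.setReg, hy.ne, r1 y hy]
    · simp [MState.setReg, v1, m1, eval]
    · simp [MState.setReg, m1]
    · have h1 := size_eval L hB e h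
      have h2 := hB.mem (e.eval L s.regs s.mem)
      have := hB.four
      simp only [MState.setReg, cost, v1, m1, add_mul, two_mul] at *
      omega
  | deg e he =>
    intro d s hd hB
    obtain ⟨s1, x1, r1, v1, m1, t1⟩ := he h d s hd hB
    refine ⟨s1.setReg d (L.degAt (s1.regs d)) (1 + (s1.regs d).size +
      (L.degAt (s1.regs d)).size), ?_, fun y hy => ?_, ?_, ?_, ?_⟩
    · simp only [comp, Cmd.exec, x1, PMF.pure_bind]
    · simp [MState.setReg, hy.ne, r1 y hy]
    · simp [MState.setReg, v1, eval]
    · simp [MState.setReg, m1]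
    · have h1 := size_eval L hB e h
      have h2 := (Nat.size_le_size (degAt_le L (e.eval L s.regs s.mem))).trans hB.card
      have := hB.four
      simp only [MState.setReg, cost, v1, add_mul, two_mul] at *
      omega
  | nbr e f he hf =>
    intro d s hd hB
    have h' := h
    simp only [ok, Bool.and_eq_true] at h'
    obtain ⟨s1, x1, r1, v1, m1, t1⟩ := he h'.1 d s hd hB
    obtain ⟨s2, x2, r2, v2, m2, t2⟩ := hf h'.2 (d + 1) s1 (by omega) (agree hd hB r1 m1)
    have hv : s2.regs (d + 1) = f.eval L s.regs s.mem := by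
      rw [v2, m1]; exact eval_congr L (fun x hx => r1 x (by omega)) f h'.2
    have hv' : s2.regs d = e.eval L s.regs s.mem := by rw [r2 d (by omega), v1]
    refine ⟨s2.setReg d (L.nbrAt (s2.regs d) (s2.regs (d + 1))) (1 + (s2.regs d).size +
      (s2.regs (d + 1)).size + (L.nbrAt (s2.regs d) (s2.regs (d + 1))).size), ?_, fun y hy => ?_, ?_, ?_, ?_⟩
    · simp only [comp, Cmd.exec, x1, x2, PMF.pure_bind]
    · simp [MState.setReg, hy.ne, r2 y (by omega), r1 y hy]
    · simp [MState.setReg, hv, hv', eval]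
    · simp [MState.setReg, m1, m2]
    · have h1 := size_eval L hB e h'.1
      have h2 := size_eval L hB f h'.2
      have h3 := (Nat.size_le_size (nbrAt_le L (e.eval L s.regs s.mem)
        (f.eval L s.regs s.mem))).trans hB.card
      have := hB.four
      simp only [MState.setReg, cost, hv, hv', add_mul, two_mul] at *
      omega
  | adj e f he hf =>
    intro d s hd hB
    have h' := h
    simp only [ok, Bool.and_eq_true] at h'
    obtain ⟨s1, x1, r1, v1, m1, t1⟩ := he h'.1 d s hd hB
    obtain ⟨s2, x2, r2, v2, m2, t2⟩ := hf h'.2 (d + 1) s1 (by omega) (agree hd hB r1 m1)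
    have hv : s2.regs (d + 1) = f.eval L s.regs s.mem := by
      rw [v2, m1]; exact eval_congr L (fun x hx => r1 x (by omega)) f h'.2
    have hv' : s2.regs d = e.eval L s.regs s.mem := by rw [r2 d (by omega), v1]
    refine ⟨s2.setReg d (adjAt G (s2.regs d) (s2.regs (d + 1))) (1 + (s2.regs d).size +
      (s2.regs (d + 1)).size + 1), ?_, fun y hy => ?_, ?_, ?_, ?_⟩
    · simp only [comp, Cmd.exec, x1, x2, PMF.pure_bind]
    · simp [MState.setReg, hy.ne, r2 y (by omega), r1 y hy]
    · simp [MState.setReg, hv, hv', eval]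
    · simp [MState.setReg, m1, m2]
    · have h1 := size_eval L hB e h'.1
      have h2 := size_eval L hB f h'.2
      have := hB.four
      simp only [MState.setReg, cost, hv, hv', add_mul, two_mul] at *
      omega

end Exp

end SpannerOracle

namespace SpannerOracle

variable {n : ℕ} {G : SimpleGraph (Fin n)} (L : AdjacencyList G)

/-- A bound for the cost of a structured command when all numbers have length at most `β`. -/
@[irreducible] def unitCost (β : ℕ) : ℕ := 10000 * β

lemma unitCost_eq (β : ℕ) : unitCost β = 10000 * β := by unfold unitCost; rfl

/-! ### Structured commands -/

/-- Assign the value of an expression to a register. -/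
def asg (x : ℕ) (e : Exp) : Cmd := .seq (e.comp 32) (.copy x 32)

/-- Store the value of `e` in the memory cell whose address is the value of `a`. -/
def sto (a e : Exp) : Cmd := .seq (a.comp 32) (.seq (e.comp 33) (.store 32 33))

/-- Draw a random number below the value of `e`. -/
def rnd (x : ℕ) (e : Exp) : Cmd := .seq (e.comp 32) (.rand x 32)

/-- Run `p` if `e` is zero, and `q` otherwise. -/
def ite (e : Exp) (p q : Cmd) : Cmd := .seq (e.comp 32) (.ifz 32 p q)

/-- Run `p` for `i = 0, …, N - 1`, where `N` is the content of register `c`. -/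
def forLoop (i c : ℕ) (p : Cmd) : Cmd :=
  .seq (.const i 0) (.loop c (.seq p (asg i (.var i + 1))))

/-- The registers below `32` and the memory of `s` are given by `ρ` and `m`. -/
structure Agrees (s : MState) (ρ m : ℕ → ℕ) : Prop where
  reg : ∀ x < 32, s.regs x = ρ x
  mem : s.mem = m

lemma Agrees.bdd {s : MState} {ρ m : ℕ → ℕ} {β : ℕ} (h : Agrees s ρ m) (hB : Bdd n β ρ m) :
    Bdd n β s.regs s.mem :=
  ⟨hB.four, hB.card, fun x hx => by rw [h.reg x hx]; exact hB.reg x hx,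
    by rw [h.mem]; exact hB.mem⟩

lemma Agrees.eval {s : MState} {ρ m : ℕ → ℕ} (h : Agrees s ρ m) {e : Exp} (he : e.ok = true) :
    e.eval L s.regs s.mem = e.eval L ρ m := by
  rw [h.mem]; exact Exp.eval_congr L h.reg e he

lemma Exp.ok_of_chk {e : Exp} (h : e.chk = true) : e.ok = true := by
  simp only [Exp.chk, Bool.and_eq_true] at h; exact h.1

lemma Exp.cost_of_chk {e : Exp} (h : e.chk = true) : e.cost + e.wt ≤ 4000 := by
  simp only [Exp.chk, Bool.and_eq_true, decide_eq_true_eq] at h; exact h.2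

/-- The length of the value is included in the time bound, which leaves room for the instruction
that will consume the value. -/
lemma Exp.exec_chk {β : ℕ} {e : Exp} (h : e.chk = true) (d : ℕ) {s : MState} {ρ m : ℕ → ℕ}
    (hd : 32 ≤ d) (hs : Agrees s ρ m) (hB : Bdd n β ρ m) :
    ∃ s', (e.comp d).exec L s = PMF.pure s' ∧ (∀ y < d, s'.regs y = s.regs y) ∧
      s'.regs d = e.eval L ρ m ∧ Agrees s' ρ m ∧
      s'.time + (e.eval L ρ m).size ≤ s.time + 4000 * β := by
  obtain ⟨s', h1, h2, h3, h4, h5⟩ := e.exec_comp L (Exp.ok_of_chk h) d s hd (hs.bdd hB)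
  refine ⟨s', h1, h2, ?_, ⟨fun x hx => ?_, by rw [h4, hs.mem]⟩, ?_⟩
  · rw [h3, hs.eval L (Exp.ok_of_chk h)]
  · rw [h2 x (by omega), hs.reg x hx]
  · have h6 := e.size_eval L hB (Exp.ok_of_chk h)
    have h7 := Nat.mul_le_mul_right β (Exp.cost_of_chk h)
    rw [add_mul] at h7
    omega

lemma exec_asg {β : ℕ} {x : ℕ} {e : Exp} (hx : x < 32) (h : e.chk = true) {s : MState}
    {ρ m : ℕ → ℕ} (hs : Agrees s ρ m) (hB : Bdd n β ρ m) :
    ∃ s', (asg x e).exec L s = PMF.pure s' ∧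
      Agrees s' (Function.update ρ x (e.eval L ρ m)) m ∧ s'.time ≤ s.time + unitCost β := by
  obtain ⟨s1, h1, h2, h3, h4, h5⟩ := Exp.exec_chk L h 32 le_rfl hs hB
  refine ⟨s1.setReg x (s1.regs 32) (1 + (s1.regs 32).size), ?_, ⟨fun y hy => ?_, h4.mem⟩, ?_⟩
  · simp only [asg, Cmd.exec, h1, PMF.pure_bind]
  · by_cases hyx : y = x
    · subst hyx; simp [MState.setReg, h3]
    · simp [MState.setReg, hyx, h4.reg y hy]
  · have := hB.four
    have := unitCost_eq β
    simp only [MState.setReg, h3]; omega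

lemma exec_sto {β : ℕ} {a e : Exp} (ha : a.chk = true) (h : e.chk = true) {s : MState}
    {ρ m : ℕ → ℕ} (hs : Agrees s ρ m) (hB : Bdd n β ρ m) :
    ∃ s', (sto a e).exec L s = PMF.pure s' ∧
      Agrees s' ρ (Function.update m (a.eval L ρ m) (e.eval L ρ m)) ∧
      s'.time ≤ s.time + unitCost β := by
  obtain ⟨s1, h1, h2, h3, h4, h5⟩ := Exp.exec_chk L ha 32 le_rfl hs hB
  obtain ⟨s2, k1, k2, k3, k4, k5⟩ := Exp.exec_chk L h 33 (by norm_num) h4 hB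
  have h6 : s2.regs 32 = a.eval L ρ m := by rw [k2 32 (by norm_num), h3]
  refine ⟨s2.setMem (s2.regs 32) (s2.regs 33) (1 + (s2.regs 32).size + (s2.regs 33).size), ?_,
    ⟨k4.reg, ?_⟩, ?_⟩
  · simp only [sto, Cmd.exec, h1, k1, PMF.pure_bind]
  · simp only [MState.setMem, h6, k3, k4.mem]
  · have := hB.four
    have := unitCost_eq β
    simp only [MState.setMem, h6, k3]; omega

/-! ### Triples with a bound for the cost -/

/-- Assertions about registers, memory, and the cost of the computation so far. -/
abbrev Assertion := (ℕ → ℕ) → (ℕ → ℕ) → ℕ → Prop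

/-- A computation from `s` to `t` satisfies `Q`. -/
def Post (s : MState) (Q : Assertion) (t : MState) : Prop :=
  ∃ ρ k, (∀ x < 32, t.regs x = ρ x) ∧ t.time ≤ s.time + k ∧ Q ρ t.mem k

/-- Every possible outcome of the program satisfies `Q`. -/
def Tr (c : Cmd) (ρ m : ℕ → ℕ) (Q : Assertion) : Prop :=
  ∀ s, Agrees s ρ m → ∀ t ∈ (c.exec L s).support, Post s Q t

/-- The outcome of the program satisfies `Q` up to an event of probability at most `ε`. -/
def Pr (c : Cmd) (ρ m : ℕ → ℕ) (ε : ENNReal) (Q : Assertion) : Prop :=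
  ∀ s, Agrees s ρ m → (c.exec L s).toOuterMeasure {t | ¬ Post s Q t} ≤ ε

variable {L}

lemma Tr.mono {c : Cmd} {ρ m : ℕ → ℕ} {Q Q' : Assertion} (h : Tr L c ρ m Q)
    (hQ : ∀ ρ' m' k, Q ρ' m' k → Q' ρ' m' k) : Tr L c ρ m Q' := by
  intro s hs t ht
  obtain ⟨ρ', k, h1, h2, h3⟩ := h s hs t ht
  exact ⟨ρ', k, h1, h2, hQ _ _ _ h3⟩

lemma Tr.pr {c : Cmd} {ρ m : ℕ → ℕ} {Q : Assertion} (h : Tr L c ρ m Q) : Pr L c ρ m 0 Q := by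
  intro s hs
  rw [nonpos_iff_eq_zero, PMF.toOuterMeasure_apply_eq_zero_iff, Set.disjoint_left]
  exact fun t ht hn => hn (h s hs t ht)

lemma Tr.seq {p q : Cmd} {ρ m : ℕ → ℕ} {Q Q' : Assertion} (hp : Tr L p ρ m Q')
    (hq : ∀ ρ' m' k, Q' ρ' m' k → Tr L q ρ' m' (fun ρ'' m'' k' => Q ρ'' m'' (k + k'))) :
    Tr L (.seq p q) ρ m Q := by
  intro s hs t ht
  simp only [Cmd.exec, PMF.mem_support_bind_iff] at ht
  obtain ⟨u, hu, ht⟩ := ht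
  obtain ⟨ρ', k, h1, h2, h3⟩ := hp s hs u hu
  obtain ⟨ρ'', k', h4, h5, h6⟩ := hq _ _ _ h3 u ⟨h1, rfl⟩ t ht
  exact ⟨ρ'', k + k', h4, by omega, h6⟩

/-- A union bound: either the first program misses its postcondition, or it reaches it and the
second one fails from there. -/
lemma Pr.seq {p q : Cmd} {ρ m : ℕ → ℕ} {ε ε' : ENNReal} {Q Q' : Assertion}
    (hp : Pr L p ρ m ε Q')
    (hq : ∀ ρ' m' k, Q' ρ' m' k → Pr L q ρ' m' ε' (fun ρ'' m'' k' => Q ρ'' m'' (k + k'))) :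
    Pr L (.seq p q) ρ m (ε + ε') Q := by
  intro s hs
  simp only [Cmd.exec]
  rw [PMF.toOuterMeasure_bind_apply]
  -- A good intermediate state is charged to the second summand, a bad one to the indicator, with
  -- the trivial bound 1 for the failure of `q`.
  have hpt : ∀ u, (p.exec L s) u * ((q.exec L u).toOuterMeasure {t | ¬ Post s Q t}) ≤
      {t | ¬ Post s Q' t}.indicator (p.exec L s) u + (p.exec L s) u * ε' := by
    intro u
    by_cases hu : Post s Q' u
    · refine le_add_left ?_
      gcongr
      obtain ⟨ρ', k, h1, h2, h3⟩ := hu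
      refine le_trans (MeasureTheory.measure_mono ?_) (hq _ _ _ h3 u ⟨h1, rfl⟩)
      intro t ht hP
      obtain ⟨ρ'', k', h4, h5, h6⟩ := hP
      exact ht ⟨ρ'', k + k', h4, by omega, h6⟩
    · refine le_add_right ?_
      rw [Set.indicator_of_mem (show u ∈ {t | ¬ Post s Q' t} from hu)]
      refine mul_le_of_le_one_right zero_le ?_
      refine (MeasureTheory.measure_mono (Set.subset_univ _)).trans ?_
      exact ((PMF.toOuterMeasure_apply_eq_one_iff _ _).2 (Set.subset_univ _)).le
  refine (ENNReal.tsum_le_tsum hpt).trans ?_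
  rw [ENNReal.tsum_add, ENNReal.tsum_mul_right, PMF.tsum_coe, one_mul]
  gcongr
  have := hp s hs
  rwa [PMF.toOuterMeasure_apply] at this

lemma Tr.skip {ρ m : ℕ → ℕ} {Q : Assertion} (h : Q ρ m 1) : Tr L .skip ρ m Q := by
  intro s hs t ht
  simp only [Cmd.exec, PMF.mem_support_pure_iff] at ht
  subst ht
  exact ⟨ρ, 1, hs.reg, le_rfl, by rwa [← hs.mem] at h⟩

lemma Tr.const {β x a : ℕ} {ρ m : ℕ → ℕ} {Q : Assertion} (hB : Bdd n β ρ m) (ha : a.size ≤ β)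
    (h : Q (Function.update ρ x a) m (unitCost β)) : Tr L (.const x a) ρ m Q := by
  intro s hs t ht
  simp only [Cmd.exec, PMF.mem_support_pure_iff] at ht
  subst ht
  have := hB.four
  have := unitCost_eq β
  refine ⟨_, unitCost β, fun y hy => ?_, ?_, by simpa [MState.setReg, hs.mem] using h⟩
  · by_cases hyx : y = x
    · subst hyx; simp [MState.setReg]
    · simp [MState.setReg, hyx, hs.reg y hy]
  · simp only [MState.setReg]; omega

lemma Tr.asg {β x : ℕ} {e : Exp} {ρ m : ℕ → ℕ} {Q : Assertion} (hB : Bdd n β ρ m)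
    (hx : x < 32) (he : e.chk = true)
    (h : Q (Function.update ρ x (e.eval L ρ m)) m (unitCost β)) : Tr L (asg x e) ρ m Q := by
  intro s hs t ht
  obtain ⟨s', h1, h2, h3⟩ := exec_asg L hx he hs hB
  rw [h1, PMF.mem_support_pure_iff] at ht
  subst ht
  exact ⟨_, _, h2.reg, h3, by rwa [h2.mem]⟩

lemma Tr.sto {β : ℕ} {a e : Exp} {ρ m : ℕ → ℕ} {Q : Assertion} (hB : Bdd n β ρ m)
    (ha : a.chk = true) (he : e.chk = true)
    (h : Q ρ (Function.update m (a.eval L ρ m) (e.eval L ρ m)) (unitCost β)) :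
    Tr L (sto a e) ρ m Q := by
  intro s hs t ht
  obtain ⟨s', h1, h2, h3⟩ := exec_sto L ha he hs hB
  rw [h1, PMF.mem_support_pure_iff] at ht
  subst ht
  exact ⟨_, _, h2.reg, h3, by rwa [h2.mem]⟩

lemma uniformBelow_succ (k : ℕ) :
    uniformBelow (k + 1) = (PMF.uniformOfFintype (Fin (k + 1))).map Fin.val := by
  unfold uniformBelow
  exact PMF.map_id _

lemma uniformBelow_support {k a : ℕ} (h : a ∈ (uniformBelow k).support) : a < k ∨ a = 0 := by
  cases k with
  | zero =>
    right; simpa [uniformBelow] using h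
  | succ k =>
    left
    simp only [uniformBelow_succ, PMF.support_map, Set.mem_image] at h
    obtain ⟨i, -, rfl⟩ := h
    exact i.isLt

lemma Tr.rnd {β x : ℕ} {e : Exp} {ρ m : ℕ → ℕ} {Q : Assertion} (hB : Bdd n β ρ m)
    (hx : x < 32) (he : e.chk = true) (hv : (e.eval L ρ m).size ≤ β)
    (h : ∀ a, a < e.eval L ρ m ∨ a = 0 → Q (Function.update ρ x a) m (unitCost β)) :
    Tr L (rnd x e) ρ m Q := by
  intro s hs t ht
  obtain ⟨s1, h1, h2, h3, h4, h5⟩ := Exp.exec_chk L he 32 le_rfl hs hB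
  simp only [SpannerOracle.rnd, Cmd.exec, h1, PMF.pure_bind, PMF.support_map, Set.mem_image] at ht
  obtain ⟨a, ha, rfl⟩ := ht
  rw [h3] at ha
  have ha' := uniformBelow_support ha
  have hsz : a.size ≤ β := (Nat.size_le_size (by omega)).trans hv
  have := hB.four
  have := unitCost_eq β
  refine ⟨_, unitCost β, fun y hy => ?_, ?_, by simpa [MState.setReg, h4.mem] using h a ha'⟩
  · by_cases hyx : y = x
    · subst hyx; simp [MState.setReg]
    · simp [MState.setReg, hyx, h4.reg y hy]
  · simp only [MState.setReg, h3]; omega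

lemma Tr.ite {β : ℕ} {e : Exp} {p q : Cmd} {ρ m : ℕ → ℕ} {Q : Assertion} (hB : Bdd n β ρ m)
    (he : e.chk = true)
    (hp : e.eval L ρ m = 0 → Tr L p ρ m (fun ρ' m' k => Q ρ' m' (unitCost β + k)))
    (hq : e.eval L ρ m ≠ 0 → Tr L q ρ m (fun ρ' m' k => Q ρ' m' (unitCost β + k))) :
    Tr L (ite e p q) ρ m Q := by
  intro s hs t ht
  obtain ⟨s1, h1, h2, h3, h4, h5⟩ := Exp.exec_chk L he 32 le_rfl hs hB
  simp only [SpannerOracle.ite, Cmd.exec, h1, PMF.pure_bind, h3] at ht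
  have := hB.four
  have := unitCost_eq β
  split_ifs at ht with h0
  · obtain ⟨ρ', k, k1, k2, k3⟩ := hp h0 (s1.tick _) ⟨h4.reg, h4.mem⟩ t ht
    refine ⟨ρ', _, k1, ?_, k3⟩
    simp only [MState.tick] at k2; omega
  · obtain ⟨ρ', k, k1, k2, k3⟩ := hq h0 (s1.tick _) ⟨h4.reg, h4.mem⟩ t ht
    refine ⟨ρ', _, k1, ?_, k3⟩
    simp only [MState.tick] at k2; omega

lemma chk_succ : ∀ i < 32, (Exp.var i + 1).chk = true := by decide

lemma repeatCmd_support {f : MState → PMF MState} {J : ℕ → MState → Prop} {N : ℕ}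
    (h : ∀ k < N, ∀ s, J k s → ∀ t ∈ (f s).support, J (k + 1) t) :
    ∀ (j k : ℕ) (s : MState), k + j ≤ N → J k s → ∀ t ∈ (repeatCmd f j s).support, J (k + j) t := by
  intro j
  induction j with
  | zero =>
    intro k s _ hs t ht
    simp only [repeatCmd, PMF.mem_support_pure_iff] at ht
    subst ht; simpa using hs
  | succ j ih =>
    intro k s hk hs t ht
    simp only [repeatCmd, PMF.mem_support_bind_iff] at ht
    obtain ⟨u, hu, ht⟩ := ht
    have := ih (k + 1) u (by omega) (h k (by omega) s hs u hu) t ht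
    rwa [show k + 1 + j = k + (j + 1) by ring] at this

/-- The loop invariant of `Tr.forLoop`, as a property of machine states. -/
def LoopInv (n β i t₀ : ℕ) (Inv : ℕ → Assertion) (k : ℕ) (u : MState) : Prop :=
  ∃ ρ b, (∀ x < 32, u.regs x = ρ x) ∧ u.time ≤ t₀ + b ∧ ρ i = k ∧ Bdd n β ρ u.mem ∧
    Inv k ρ u.mem b

lemma LoopInv.step {β i t₀ k N : ℕ} {p : Cmd} {Inv : ℕ → Assertion} (hi : i < 32) (hk : k < N)
    (hN : N.size ≤ β)
    (hs : ∀ ρ m b, ρ i = k → Bdd n β ρ m → Inv k ρ m b →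
      Tr L p ρ m (fun ρ' m' b' => ρ' i = k ∧ Bdd n β ρ' m' ∧
        Inv (k + 1) (Function.update ρ' i (k + 1)) m' (b + b' + 2 * unitCost β)))
    {u v : MState} (hu : LoopInv n β i t₀ Inv k u)
    (hv : v ∈ ((p.exec L (u.tick (1 + N.size))).bind
      ((SpannerOracle.asg i (.var i + 1)).exec L)).support) :
    LoopInv n β i t₀ Inv (k + 1) v := by
  obtain ⟨ρ, b, h1, h2, h3, h5, h6⟩ := hu
  rw [PMF.mem_support_bind_iff] at hv
  obtain ⟨w, hw, hv⟩ := hv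
  obtain ⟨ρ', b', k1, k2, k3, k4, k5⟩ := hs ρ u.mem b h3 h5 h6 (u.tick _) ⟨h1, rfl⟩ w hw
  obtain ⟨v', l1, l2, l3⟩ := exec_asg L (e := .var i + 1) hi (chk_succ i hi)
    (⟨k1, rfl⟩ : Agrees w ρ' w.mem) k4
  rw [l1, PMF.mem_support_pure_iff] at hv
  subst hv
  simp only [Exp.eval_add, Exp.eval_var, Exp.eval_ofNat, k3] at l2
  have h4 := k4.four
  have := unitCost_eq β
  refine ⟨_, b + b' + 2 * unitCost β, l2.reg, ?_, by simp, ?_, by rw [l2.mem]; exact k5⟩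
  · simp only [MState.tick] at k2
    omega
  · rw [l2.mem]
    exact k4.setReg i ((Nat.size_le_size (by omega)).trans hN)

/-- The number of rounds is fixed at entry, so the body need only preserve the counter, not register
`c`. Of the two units added per round one pays for the increment and one for the charge of the loop
instruction. -/
lemma Tr.forLoop {β i c : ℕ} {p : Cmd} {ρ m : ℕ → ℕ} {Q : Assertion} (hB : Bdd n β ρ m)
    (hi : i < 32) (hc : c < 32) (hic : c ≠ i) (Inv : ℕ → Assertion)
    (h0 : Inv 0 (Function.update ρ i 0) m (unitCost β))
    (hs : ∀ k < ρ c, ∀ ρ' m' b, ρ' i = k → Bdd n β ρ' m' → Inv k ρ' m' b →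
      Tr L p ρ' m' (fun ρ'' m'' b' => ρ'' i = k ∧ Bdd n β ρ'' m'' ∧
        Inv (k + 1) (Function.update ρ'' i (k + 1)) m'' (b + b' + 2 * unitCost β)))
    (hf : ∀ ρ' m' b, Bdd n β ρ' m' → Inv (ρ c) ρ' m' b → Q ρ' m' b) :
    Tr L (forLoop i c p) ρ m Q := by
  have h4 := hB.four
  have := unitCost_eq β
  have hcsz := hB.reg c hc
  intro s hs0 t ht
  simp only [SpannerOracle.forLoop, Cmd.exec, PMF.pure_bind] at ht
  have hcs : (s.setReg i 0 (1 + Nat.size 0)).regs c = ρ c := by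
    simp [MState.setReg, hic, hs0.reg c hc]
  rw [hcs] at ht
  have hinit : LoopInv n β i s.time Inv 0
      ((s.setReg i 0 (1 + Nat.size 0)).tick (1 + (ρ c).size)) := by
    refine ⟨Function.update ρ i 0, unitCost β, fun y hy => ?_, ?_, by simp, ?_, ?_⟩
    · by_cases hyx : y = i
      · subst hyx; simp [MState.setReg, MState.tick]
      · simp [MState.setReg, MState.tick, hyx, hs0.reg y hy]
    · simp only [MState.setReg, MState.tick, Nat.size_zero]; omega
    · simp only [MState.setReg, MState.tick, hs0.mem]
      exact hB.setReg i (by simp)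
    · simpa only [MState.setReg, MState.tick, hs0.mem] using h0
  have hstep := repeatCmd_support (J := LoopInv n β i s.time Inv) (N := ρ c)
    (fun k hk u hu v hv => LoopInv.step hi hk hcsz (hs k hk) hu hv) (ρ c) 0 _
    (zero_add (ρ c)).le hinit t ht
  rw [zero_add] at hstep
  obtain ⟨ρ', b, h1, h2, h3, h5, h6⟩ := hstep
  exact ⟨ρ', b, h1, h2, hf _ _ _ h5 h6⟩

end SpannerOracle

namespace SpannerOracle

open scoped ENNReal

variable {n : ℕ} {G : SimpleGraph (Fin n)} {L : AdjacencyList G}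

/-! ### Expectations -/

/-- The expectation of a nonnegative function. -/
noncomputable def expect {α : Type*} (p : PMF α) (f : α → ℝ≥0∞) : ℝ≥0∞ := ∑' a, p a * f a

section expect

variable {α β : Type*}

lemma expect_pure (a : α) (f : α → ℝ≥0∞) : expect (PMF.pure a) f = f a := by
  unfold expect
  rw [tsum_eq_single a]
  · simp
  · intro b hb; simp [hb]

lemma expect_bind (p : PMF α) (q : α → PMF β) (f : β → ℝ≥0∞) :
    expect (p.bind q) f = expect p (fun a => expect (q a) f) := by
  unfold expect
  simp only [PMF.bind_apply, ← ENNReal.tsum_mul_right, ← ENNReal.tsum_mul_left]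
  rw [ENNReal.tsum_comm]
  simp only [mul_assoc]

lemma expect_map (p : PMF α) (g : α → β) (f : β → ℝ≥0∞) :
    expect (p.map g) f = expect p (f ∘ g) := by
  rw [← PMF.bind_pure_comp, expect_bind]
  simp only [Function.comp_apply, expect_pure]
  rfl

lemma expect_mono {p : PMF α} {f g : α → ℝ≥0∞} (h : ∀ a ∈ p.support, f a ≤ g a) :
    expect p f ≤ expect p g := by
  refine ENNReal.tsum_le_tsum fun a => ?_
  by_cases ha : a ∈ p.support
  · gcongr; exact h a ha
  · rw [PMF.mem_support_iff, not_not] at ha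
    simp [ha]

lemma expect_mul_left (p : PMF α) (c : ℝ≥0∞) (f : α → ℝ≥0∞) :
    expect p (fun a => c * f a) = c * expect p f := by
  unfold expect
  rw [← ENNReal.tsum_mul_left]
  refine tsum_congr fun a => ?_
  ring

lemma toOuterMeasure_le_expect {p : PMF α} {f : α → ℝ≥0∞} {A : Set α}
    (h : ∀ a ∈ A, 1 ≤ f a) : p.toOuterMeasure A ≤ expect p f := by
  rw [PMF.toOuterMeasure_apply]
  refine ENNReal.tsum_le_tsum fun a => ?_
  by_cases ha : a ∈ A
  · rw [Set.indicator_of_mem ha]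
    exact le_mul_of_one_le_right zero_le (h a ha)
  · simp [ha]

end expect

/-- The average of `w` over a uniform element of `{0, …, k - 1}`. -/
noncomputable def avg (k : ℕ) (w : ℕ → ℝ≥0∞) : ℝ≥0∞ := expect (uniformBelow k) w

lemma avg_eq {k : ℕ} (hk : 0 < k) (w : ℕ → ℝ≥0∞) :
    avg k w = (∑ x ∈ Finset.range k, w x) / k := by
  obtain ⟨k, rfl⟩ : ∃ j, k = j + 1 := ⟨k - 1, by omega⟩
  unfold avg
  rw [uniformBelow_succ, expect_map]
  unfold expect
  rw [tsum_fintype, Finset.sum_range, ENNReal.div_eq_inv_mul, Finset.mul_sum]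
  simp

/-! ### Replacing an array of bounds by random numbers -/

/-- The address of the cell of index `e` in the array number `f`. -/
def fld (f : ℕ) (e : Exp) : Exp := 8 * e + .lit f

@[simp] lemma eval_fld (ρ m : ℕ → ℕ) (f : ℕ) (e : Exp) :
    (fld f e).eval L ρ m = 8 * e.eval L ρ m + f := rfl

/-- Replace the entry of index `i` (register `16`) of the array number `f` by a random number
below it. -/
def randomizeEntry (f : ℕ) : Cmd :=
  .seq (rnd 20 (.mem (fld f (.var 16)))) (sto (fld f (.var 16)) (.var 20))

/-- Replace the entries of the array number `f` by random numbers below them; the length of the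
array is in register `c`. -/
def randomize (f c : ℕ) : Cmd := forLoop 16 c (randomizeEntry f)

lemma chk_fld : ∀ f < 8, (fld f (.var 16)).chk = true ∧
    (Exp.mem (fld f (.var 16))).chk = true := by decide

/-- One pass of the loop of `randomize`. -/
noncomputable def randomizePass (L : AdjacencyList G) (f N : ℕ) (t : MState) : PMF MState :=
  ((randomizeEntry f).exec L (t.tick (1 + N.size))).bind ((asg 16 (.var 16 + 1)).exec L)

lemma expect_randomizePass {β f N k : ℕ} (hf : f < 8) (hN : N.size ≤ β) (hk : k < N) {s : MState}
    {ρ m : ℕ → ℕ} (hs : Agrees s ρ m) (hB : Bdd n β ρ m) (h16 : ρ 16 = k) {F : MState → ℝ≥0∞}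
    {H : ℕ → ℝ≥0∞} (hF : ∀ a, ∀ t ρ',
      Agrees t ρ' (Function.update m (8 * k + f) a) →
      Bdd n β ρ' (Function.update m (8 * k + f) a) → ρ' 16 = k + 1 → F t ≤ H a) :
    expect (randomizePass L f N s) F ≤ avg (m (8 * k + f)) H := by
  obtain ⟨s1, x1, r1, v1, a1, -⟩ := Exp.exec_chk L (chk_fld f hf).2 32 le_rfl
    (⟨hs.reg, hs.mem⟩ : Agrees (s.tick (1 + N.size)) ρ m) hB
  simp only [randomizePass, randomizeEntry, rnd, Cmd.exec, x1, PMF.pure_bind, expect_bind,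
    expect_map]
  simp only [Exp.eval_mem, eval_fld, Exp.eval_var, h16] at v1
  rw [v1]
  refine expect_mono fun a ha => ?_
  have ha' := uniformBelow_support ha
  have hsz : a.size ≤ β := (Nat.size_le_size (by omega)).trans (hB.mem (8 * k + f))
  have hB1 := hB.setReg 20 hsz
  have a2 : Agrees (s1.setReg 20 a (1 + (m (8 * k + f)).size + a.size))
      (Function.update ρ 20 a) m := by
    refine ⟨fun y hy => ?_, a1.mem⟩
    by_cases hyx : y = 20
    · subst hyx; simp [MState.setReg]
    · simp [MState.setReg, hyx, a1.reg y hy]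
  obtain ⟨s3, x3, a3, -⟩ := exec_sto L (chk_fld f hf).1 (by decide : (Exp.var 20).chk = true)
    a2 hB1
  simp only [eval_fld, Exp.eval_var, Function.update_self, ne_eq,
    Nat.reduceEqDiff, not_false_eq_true, Function.update_of_ne, h16] at a3
  have hB3 := hB1.setMem (8 * k + f) hsz
  obtain ⟨s4, x4, a4, -⟩ := exec_asg L (x := 16) (by norm_num) (chk_succ 16 (by norm_num)) a3 hB3
  have hB4 := hB3.setReg 16 (a := k + 1) ((Nat.size_le_size (by omega)).trans hN)
  simp only [Exp.eval_add, Exp.eval_var, Exp.eval_ofNat, ne_eq, Nat.reduceEqDiff,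
    not_false_eq_true, Function.update_of_ne, h16] at a4
  simp only [Function.comp_apply, x3, x4, expect_pure]
  exact hF a s4 _ a4 hB4 (by simp)

/-- Induction on the remaining passes: entries below `k` are already drawn and appear with their
values, entries from `k` on still hold their bounds and appear as averages. A pass writes only its
own entry, so the later bounds are intact. -/
lemma expect_repeat_randomizePass {β f N : ℕ} (hf : f < 8) (hN : N.size ≤ β)
    (w : ℕ → ℕ → ℝ≥0∞) :
    ∀ (j k : ℕ) (s : MState) (ρ m : ℕ → ℕ), k + j = N → Agrees s ρ m → Bdd n β ρ m → ρ 16 = k →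
      expect (repeatCmd (randomizePass L f N) j s)
          (fun t => ∏ i ∈ Finset.range N, w i (t.mem (8 * i + f)))
        ≤ (∏ i ∈ Finset.range k, w i (m (8 * i + f))) *
          ∏ i ∈ Finset.Ico k N, avg (m (8 * i + f)) (w i) := by
  intro j
  induction j with
  | zero =>
    intro k s ρ m hk hs hB h16
    simp only [repeatCmd, expect_pure, hs.mem]
    rw [show k = N by omega]; simp
  | succ j ih =>
    intro k s ρ m hk hs hB h16
    simp only [repeatCmd, expect_bind]
    -- All factors except the current one are constants for the next draw and move inside its
    -- average.
    have hprod : (∏ i ∈ Finset.range k, w i (m (8 * i + f))) *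
          ∏ i ∈ Finset.Ico k N, avg (m (8 * i + f)) (w i) =
        avg (m (8 * k + f)) (fun a =>
          ((∏ i ∈ Finset.range k, w i (m (8 * i + f))) *
          ∏ i ∈ Finset.Ico (k + 1) N, avg (m (8 * i + f)) (w i)) * w k a) := by
      unfold avg
      rw [expect_mul_left, Finset.prod_eq_prod_Ico_succ_bot (show k < N by omega)]
      ring
    rw [hprod]
    refine expect_randomizePass hf hN (by omega) hs hB h16 fun a t ρ' ht hBt h16' => ?_
    refine (ih (k + 1) t ρ' _ (by omega) ht hBt h16').trans ?_
    rw [Finset.prod_range_succ]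
    have e1 : ∏ i ∈ Finset.range k, w i (Function.update m (8 * k + f) a (8 * i + f)) =
        ∏ i ∈ Finset.range k, w i (m (8 * i + f)) := by
      refine Finset.prod_congr rfl fun i hi => ?_
      have := Finset.mem_range.1 hi
      rw [Function.update_of_ne (by omega)]
    have e2 : ∏ i ∈ Finset.Ico (k + 1) N, avg (Function.update m (8 * k + f) a (8 * i + f)) (w i) =
        ∏ i ∈ Finset.Ico (k + 1) N, avg (m (8 * i + f)) (w i) := by
      refine Finset.prod_congr rfl fun i hi => ?_
      have := Finset.mem_Ico.1 hi
      rw [Function.update_of_ne (by omega)]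
    rw [e1, e2, Function.update_self]
    apply le_of_eq; ring

/-- The random entries are independent: the expectation of a product is bounded by the product
of the averages. -/
lemma expect_randomize {β f c : ℕ} (hf : f < 8) (hc : c < 16) {ρ m : ℕ → ℕ} {s : MState}
    (hs : Agrees s ρ m) (hB : Bdd n β ρ m) (w : ℕ → ℕ → ℝ≥0∞) :
    expect ((randomize f c).exec L s) (fun t => ∏ i ∈ Finset.range (ρ c), w i (t.mem (8 * i + f)))
      ≤ ∏ i ∈ Finset.range (ρ c), avg (m (8 * i + f)) (w i) := by
  have hcs : (s.setReg 16 0 (1 + Nat.size 0)).regs c = ρ c := by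
    simp [MState.setReg, hc.ne, hs.reg c (by omega)]
  simp only [randomize, forLoop, Cmd.exec, PMF.pure_bind, hcs]
  have h1 : Agrees ((s.setReg 16 0 (1 + Nat.size 0)).tick (1 + (ρ c).size))
      (Function.update ρ 16 0) m := by
    refine ⟨fun y hy => ?_, hs.mem⟩
    by_cases hyx : y = 16
    · subst hyx; simp [MState.setReg, MState.tick]
    · simp [MState.setReg, MState.tick, hyx, hs.reg y hy]
  have := expect_repeat_randomizePass (L := L) hf (hB.reg c (by omega)) w (ρ c) 0 _ _ m (zero_add _) h1
    (hB.setReg 16 (by simp)) (by simp)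
  simp only [Finset.range_zero, Finset.prod_empty, one_mul, ← Finset.range_eq_Ico] at this
  exact this

/-- Cost and frame of `randomize`. -/
lemma tr_randomize {β f c : ℕ} (hf : f < 8) (hc : c < 16) {ρ m : ℕ → ℕ}
    (hB : Bdd n β ρ m) :
    Tr L (randomize f c) ρ m (fun ρ' m' b => b ≤ 5 * unitCost β * (ρ c + 1) ∧ Bdd n β ρ' m' ∧
      (∀ x < 16, ρ' x = ρ x) ∧
      (∀ i < ρ c, m' (8 * i + f) < m (8 * i + f) ∨ m' (8 * i + f) = 0) ∧
      ∀ a, (∀ i < ρ c, a ≠ 8 * i + f) → m' a = m a) := by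
  unfold randomize
  refine Tr.forLoop hB (by norm_num) (by omega) (by omega)
    (Inv := fun k ρ' m' b => b ≤ unitCost β + 4 * unitCost β * k ∧ (∀ x < 16, ρ' x = ρ x) ∧
      (∀ i < k, m' (8 * i + f) < m (8 * i + f) ∨ m' (8 * i + f) = 0) ∧
      ∀ a, (∀ i < k, a ≠ 8 * i + f) → m' a = m a) ?_ ?_ ?_
  · refine ⟨by omega, fun x hx => ?_, by simp, by simp⟩
    rw [Function.update_of_ne (by omega)]
  · rintro k hk ρ' m' b h16 hB' ⟨hb, hρ, hm, hm'⟩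
    have hmk : m' (8 * k + f) = m (8 * k + f) := hm' _ (fun i hi => by omega)
    refine Tr.seq (Q' := fun ρ'' m'' b' => ∃ a, (a < m (8 * k + f) ∨ a = 0) ∧
      ρ'' = Function.update ρ' 20 a ∧ m'' = m' ∧ b' = unitCost β)
      (Tr.rnd hB' (by norm_num) (chk_fld f hf).2 ?_ ?_) ?_
    · simpa [h16] using hB'.mem (8 * k + f)
    · intro a ha
      simp only [Exp.eval_mem, eval_fld, Exp.eval_var, h16, hmk] at ha
      exact ⟨a, ha, rfl, rfl, rfl⟩
    · rintro ρ'' m'' b' ⟨a, ha, rfl, rfl, rfl⟩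
      have hsz : a.size ≤ β := (Nat.size_le_size (by omega)).trans (hB.mem (8 * k + f))
      have hB1 := hB'.setReg 20 hsz
      refine Tr.sto hB1 (chk_fld f hf).1 (by decide) ?_
      simp only [eval_fld, Exp.eval_var, Function.update_self, ne_eq,
        Nat.reduceEqDiff, not_false_eq_true, Function.update_of_ne, h16]
      refine ⟨trivial, hB1.setMem _ hsz, ?_, fun x hx => ?_, fun i hi => ?_, fun b hb => ?_⟩
      · rw [mul_add]; omega
      · rw [Function.update_of_ne (by omega), Function.update_of_ne (by omega), hρ x hx]
      · by_cases hik : i = k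
        · subst hik; simpa using ha
        · rw [Function.update_of_ne (by omega)]; exact hm i (by omega)
      · rw [Function.update_of_ne (hb k (by omega))]
        exact hm' b (fun i hi => hb i (by omega))
  · rintro ρ' m' b hB' ⟨hb, hρ, hm, hm'⟩
    refine ⟨?_, hB', hρ, hm, hm'⟩
    nlinarith

/-- The first `N` numbers are independent and uniform below `M 0, …, M (N - 1)`; it suffices to
know this for the upper bounds on the expectations of products. -/
def IsIndep (N : ℕ) (M : ℕ → ℕ) (p : PMF (ℕ → ℕ)) : Prop :=
  ∀ w : ℕ → ℕ → ℝ≥0∞, expect p (fun x => ∏ i ∈ Finset.range N, w i (x i)) ≤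
    ∏ i ∈ Finset.range N, avg (M i) (w i)

/-- Markov's inequality for a test function of product form; all tail bounds below come from a
choice of `a` and `w`. -/
lemma IsIndep.prob_le {N : ℕ} {M : ℕ → ℕ} {p : PMF (ℕ → ℕ)} (hp : IsIndep N M p)
    {A : Set (ℕ → ℕ)} (a : ℝ≥0∞) (w : ℕ → ℕ → ℝ≥0∞)
    (h : ∀ x ∈ A, 1 ≤ a * ∏ i ∈ Finset.range N, w i (x i)) :
    p.toOuterMeasure A ≤ a * ∏ i ∈ Finset.range N, avg (M i) (w i) := by
  refine (toOuterMeasure_le_expect h).trans ?_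
  rw [expect_mul_left]
  gcongr
  exact hp w

/-- `randomize` produces independent random numbers. -/
lemma pr_randomize {β f c : ℕ} (hf : f < 8) (hc : c < 16) {ρ m : ℕ → ℕ}
    (hB : Bdd n β ρ m) {ε : ℝ≥0∞} {P : (ℕ → ℕ) → Prop}
    (hP : ∀ p, IsIndep (ρ c) (fun i => m (8 * i + f)) p → p.toOuterMeasure {x | ¬ P x} ≤ ε) :
    Pr L (randomize f c) ρ m ε (fun ρ' m' b => b ≤ 5 * unitCost β * (ρ c + 1) ∧ Bdd n β ρ' m' ∧
      (∀ x < 16, ρ' x = ρ x) ∧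
      (∀ i < ρ c, m' (8 * i + f) < m (8 * i + f) ∨ m' (8 * i + f) = 0) ∧
      (∀ a, (∀ i < ρ c, a ≠ 8 * i + f) → m' a = m a) ∧ P (fun i => m' (8 * i + f))) := by
  intro s hs
  have h1 := hP (((randomize f c).exec L s).map (fun t i => t.mem (8 * i + f))) (fun w => by
    rw [expect_map]
    exact expect_randomize hf hc hs hB w)
  rw [PMF.toOuterMeasure_map_apply] at h1
  refine le_trans ?_ h1
  -- On the support the frame and cost statements always hold, so a failure can only be a failure of
  -- `P`.
  rw [← PMF.toOuterMeasure_apply_inter_support]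
  refine MeasureTheory.measure_mono ?_
  rintro t ⟨ht, hts⟩ hPt
  obtain ⟨ρ', b, k1, k2, k3, k4, k5, k6, k7⟩ := tr_randomize hf hc hB s hs t hts
  exact ht ⟨ρ', b, k1, k2, k3, k4, k5, k6, k7, hPt⟩

/-! ### Rules for the first command of a sequence -/

lemma Tr.asg_seq {β x : ℕ} {e : Exp} {q : Cmd} {ρ m : ℕ → ℕ} {Q : Assertion} (hB : Bdd n β ρ m)
    (hx : x < 32) (he : e.chk = true) (hv : (e.eval L ρ m).size ≤ β)
    (h : Bdd n β (Function.update ρ x (e.eval L ρ m)) m →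
      Tr L q (Function.update ρ x (e.eval L ρ m)) m (fun ρ' m' k => Q ρ' m' (unitCost β + k))) :
    Tr L (.seq (SpannerOracle.asg x e) q) ρ m Q :=
  Tr.seq (Q' := fun ρ' m' k => ρ' = Function.update ρ x (e.eval L ρ m) ∧ m' = m ∧ k = unitCost β)
    (Tr.asg hB hx he ⟨rfl, rfl, rfl⟩) (by
      rintro _ _ _ ⟨rfl, rfl, rfl⟩
      exact h (hB.setReg x hv))

lemma Tr.sto_seq {β : ℕ} {a e : Exp} {q : Cmd} {ρ m : ℕ → ℕ} {Q : Assertion} (hB : Bdd n β ρ m)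
    (ha : a.chk = true) (he : e.chk = true) (hv : (e.eval L ρ m).size ≤ β)
    (h : Bdd n β ρ (Function.update m (a.eval L ρ m) (e.eval L ρ m)) →
      Tr L q ρ (Function.update m (a.eval L ρ m) (e.eval L ρ m))
        (fun ρ' m' k => Q ρ' m' (unitCost β + k))) :
    Tr L (.seq (SpannerOracle.sto a e) q) ρ m Q :=
  Tr.seq (Q' := fun ρ' m' k => ρ' = ρ ∧
      m' = Function.update m (a.eval L ρ m) (e.eval L ρ m) ∧ k = unitCost β)
    (Tr.sto hB ha he ⟨rfl, rfl, rfl⟩) (by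
      rintro _ _ _ ⟨rfl, rfl, rfl⟩
      exact h (hB.setMem _ hv))

lemma Tr.const_seq {β x a : ℕ} {q : Cmd} {ρ m : ℕ → ℕ} {Q : Assertion} (hB : Bdd n β ρ m)
    (hv : a.size ≤ β)
    (h : Bdd n β (Function.update ρ x a) m →
      Tr L q (Function.update ρ x a) m (fun ρ' m' k => Q ρ' m' (unitCost β + k))) :
    Tr L (.seq (.const x a) q) ρ m Q :=
  Tr.seq (Q' := fun ρ' m' k => ρ' = Function.update ρ x a ∧ m' = m ∧ k = unitCost β)
    (Tr.const hB hv ⟨rfl, rfl, rfl⟩) (by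
      rintro _ _ _ ⟨rfl, rfl, rfl⟩
      exact h (hB.setReg x hv))

/-! ### The program -/

section program

open Exp

/-- Zero if and only if `n ≤ deg a ^ 3`. -/
def lightExp (a : Exp) : Exp := var 0 - deg a * deg a * deg a

/-- Zero if and only if `M ≤ deg a ^ 2 * n`. -/
def lowExp (a : Exp) : Exp := var 5 - deg a * deg a * var 0

/-- `levels d` has value `Nat.size d`. -/
def levelTable : Cmd :=
  forLoop 16 0 (sto (fld 0 (var 16 + 1)) (mem (fld 0 ((var 16 + 1) / 2)) + 1))

/-- Sum up the degrees, and initialize the arrays `1` and `6`. -/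
def degreeSum : Cmd :=
  forLoop 16 0 (.seq (asg 5 (var 5 + deg (var 16))) (.seq (sto (fld 1 (var 16)) (var 0))
    (sto (fld 6 (var 16)) (mem (fld 0 (deg (var 16)))))))

/-- The least degree `d` with `n ≤ d ^ 3` and `M ≤ d ^ 2 * n`. -/
def leastHigh : Cmd :=
  -- With truncated subtraction the sum is zero exactly for a heavy and high vertex whose degree is
  -- strictly below the current minimum.
  forLoop 16 0 (ite (lightExp (var 16) + lowExp (var 16) + (1 - (var 6 - deg (var 16))))
    (asg 6 (deg (var 16))) .skip)

/-- The first part of the preprocessing, without the first instruction. -/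
def setup (K : ℕ) : Cmd :=
  .seq (.const 9 K) <| .seq (asg 2 (var 0 + 1)) <| .seq (sto (fld 5 0) (var 0)) <|
  .seq levelTable <| .seq (asg 3 (mem (fld 0 (var 0)))) <|
  .seq (asg 4 (var 0 * (var 9 * var 3))) <| .seq degreeSum <| .seq (asg 6 (var 0)) <|
  .seq leastHigh <| .seq (asg 7 (var 1 * (var 9 * var 3))) (asg 8 (var 0 * var 7))

/-- Make `b` the center of its neighbour `a` if it qualifies. -/
def tryCenter (a b : ℕ) : Cmd :=
  ite (lightExp (var a) + (mem (fld 1 (var b)) * deg (var a) - var 4))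
    (sto (fld 3 (var a)) (var b + 1)) .skip

/-- Go through the neighbours of the vertex in register `16`. -/
def scanVertex : Cmd :=
  .seq (asg 18 (deg (var 16))) (forLoop 17 18 (.seq (asg 19 (nbr (var 16) (var 17)))
    (.seq (tryCenter 16 19) (tryCenter 19 16))))

/-- Find the centers. -/
def scan : Cmd :=
  -- A product of truncated expressions is zero as soon as one factor is, which encodes the
  -- disjunction in `Scanned`.
  forLoop 16 0 (ite ((lightExp (var 16) + (1 - lowExp (var 16))) *
    (mem (fld 1 (var 16)) * var 6 - var 4)) scanVertex .skip)

/-- Initialize the array `2`. -/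
def fillDegrees : Cmd := forLoop 16 8 (sto (fld 2 (var 16)) (deg (var 16 / var 7)))

/-- The index of the pair `(u, v)` in the table, given `n + 1`. -/
def tableIndex (N u v : Exp) : Exp :=
  (mem (fld 3 u) * N + mem (fld 3 v)) * N + mem (fld 6 u)

/-- The code of the pair `(u, v)`, given `n + 1`. -/
def codeExp (N u v : Exp) : Exp := u * N + v + 1

/-- Fill the table. -/
def fillTable : Cmd :=
  forLoop 16 8 (.seq (asg 17 (var 16 / var 7)) (.seq (asg 19 (nbr (var 17) (mem (fld 2 (var 16)))))
    (ite (1 - mem (fld 3 (var 17)) * mem (fld 3 (var 19)))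
      (sto (fld 4 (tableIndex (var 2) (var 17) (var 19))) (codeExp (var 2) (var 17) (var 19)))
      .skip)))

/-- The preprocessing program. -/
def preprocessCmd (K : ℕ) : Cmd :=
  .seq (asg 1 (var 1 - (var 1 - var 0))) <| .seq (setup K) <| .seq (randomize 1 0) <|
  .seq scan <| .seq fillDegrees <| .seq (randomize 2 8) fillTable

/-- Nonzero if and only if the values are equal. -/
def eqExp (a b : Exp) : Exp := 1 - ((a - b) + (b - a))

/-- Nonzero if and only if `(u, v)` qualifies as an edge. -/
def keepExp (u v : Exp) : Exp :=
  (1 - mem (fld 3 u)) + eqExp (mem (fld 3 u)) (v + 1) +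
    ((1 - mem (fld 4 (tableIndex (mem (fld 5 0) + 1) u v))) +
    eqExp (mem (fld 4 (tableIndex (mem (fld 5 0) + 1) u v))) (codeExp (mem (fld 5 0) + 1) u v))

/-- The query program. -/
def queryCmd : Cmd :=
  -- The outer double subtraction turns any positive number into 1.
  asg 0 (1 - (1 - adj (var 0) (var 1) * (keepExp (var 0) (var 1) + keepExp (var 1) (var 0))))

end program

/-! ### Adjacency of natural numbers -/

/-- Adjacency of the vertices with the given numbers. -/
def NAdj (G : SimpleGraph (Fin n)) (v w : ℕ) : Prop :=
  ∃ (hv : v < n) (hw : w < n), G.Adj ⟨v, hv⟩ ⟨w, hw⟩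

lemma NAdj.symm {v w : ℕ} (h : NAdj G v w) : NAdj G w v := by
  obtain ⟨hv, hw, h⟩ := h
  exact ⟨hw, hv, h.symm⟩

lemma adjAt_eq (G : SimpleGraph (Fin n)) (u v : ℕ) [Decidable (NAdj G u v)] :
    adjAt G u v = if NAdj G u v then 1 else 0 := by
  unfold adjAt
  simp only [NAdj]
  congr

lemma nAdj_nbrAt {v j : ℕ} (hj : j < L.degAt v) : NAdj G v (L.nbrAt v j) := by
  unfold AdjacencyList.degAt at hj
  split_ifs at hj with hv
  · have : L.nbrAt v j = ((L.nbrs ⟨v, hv⟩)[j] : Fin n) := by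
      simp [AdjacencyList.nbrAt, hv, hj]
    rw [this]
    exact ⟨hv, Fin.is_lt _, (L.mem_iff _ _).1 (List.getElem_mem _)⟩
  · omega

lemma NAdj.exists_index {v w : ℕ} (h : NAdj G v w) : ∃ j < L.degAt v, L.nbrAt v j = w := by
  obtain ⟨hv, hw, h⟩ := h
  obtain ⟨j, hj, hjw⟩ := List.getElem_of_mem ((L.mem_iff _ _).2 h)
  refine ⟨j, by simpa [AdjacencyList.degAt, hv] using hj, ?_⟩
  simp [AdjacencyList.nbrAt, hv, hj, hjw]

lemma nbrAt_inj {v i j : ℕ} (hi : i < L.degAt v) (hj : j < L.degAt v)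
    (h : L.nbrAt v i = L.nbrAt v j) : i = j := by
  unfold AdjacencyList.degAt at hi hj
  split_ifs at hi hj with hv
  · simp only [AdjacencyList.nbrAt, hv, hi, hj, dif_pos] at h
    exact (L.nodup ⟨v, hv⟩).getElem_inj_iff.1 (Fin.val_injective h)
  · omega

/-- The sum of the degrees. -/
def degSum (L : AdjacencyList G) : ℕ := ∑ v ∈ Finset.range n, L.degAt v

/-- The degree of `v` is at least `n ^ (1 / 3)`. -/
def Heavy (L : AdjacencyList G) (v : ℕ) : Prop := n ≤ L.degAt v * L.degAt v * L.degAt v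

/-- The degree of `v` is at least the square root of the average degree. -/
def High (L : AdjacencyList G) (v : ℕ) : Prop := degSum L ≤ L.degAt v * L.degAt v * n

/-- `d` is the least degree of a heavy and high vertex, or `n` if there is none. -/
def IsLeastHigh (L : AdjacencyList G) (d : ℕ) : Prop :=
  (∀ v < n, Heavy L v → High L v → d ≤ L.degAt v) ∧
    (d = n ∨ ∃ v < n, Heavy L v ∧ High L v ∧ d = L.degAt v)

/-- The registers after the first part of the preprocessing. -/
structure Env (L : AdjacencyList G) (K r d : ℕ) (ρ : ℕ → ℕ) : Prop where
  h0 : ρ 0 = n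
  h2 : ρ 2 = n + 1
  h4 : ρ 4 = n * (K * n.size)
  h5 : ρ 5 = degSum L
  h6 : ρ 6 = d
  h7 : ρ 7 = r * (K * n.size)
  h8 : ρ 8 = n * (r * (K * n.size))

lemma Env.congr {K r d : ℕ} {ρ ρ' : ℕ → ℕ} (h : Env L K r d ρ) (hρ : ∀ x < 16, ρ' x = ρ x) :
    Env L K r d ρ' := by
  constructor <;> rw [hρ _ (by norm_num)]
  exacts [h.h0, h.h2, h.h4, h.h5, h.h6, h.h7, h.h8]

/-- The memory after the first part of the preprocessing. -/
structure Mem1 (L : AdjacencyList G) (m : ℕ → ℕ) : Prop where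
  five : m 5 = n
  one : ∀ v < n, m (8 * v + 1) = n
  six : ∀ v < n, m (8 * v + 6) = (L.degAt v).size
  three : ∀ v, m (8 * v + 3) = 0
  four : ∀ v, m (8 * v + 4) = 0

/-! ### Correctness and cost of the setup. -/

lemma tr_levelTable {β : ℕ} {ρ m : ℕ → ℕ} (hB : Bdd n β ρ m) (h0 : ρ 0 = n) (hm0 : m 0 = 0) :
    Tr L levelTable ρ m (fun ρ' m' b => b ≤ 4 * unitCost β * (n + 1) ∧ Bdd n β ρ' m' ∧
      (∀ x < 16, ρ' x = ρ x) ∧ (∀ d ≤ n, m' (8 * d) = d.size) ∧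
      ∀ a, (∀ d, a ≠ 8 * d) → m' a = m a) := by
  unfold levelTable
  refine Tr.forLoop hB (by norm_num) (by norm_num) (by norm_num)
    (Inv := fun k ρ' m' b => b ≤ unitCost β + 3 * unitCost β * k ∧ (∀ x < 16, ρ' x = ρ x) ∧
      (∀ d ≤ k, m' (8 * d) = d.size) ∧ ∀ a, (∀ d, a ≠ 8 * d) → m' a = m a) ?_ ?_ ?_
  · refine ⟨by omega, fun x hx => ?_, ?_, by simp⟩
    · rw [Function.update_of_ne (by omega)]
    · intro d hd
      obtain rfl : d = 0 := by omega
      simpa using hm0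
  · rintro k hk ρ' m' b h16 hB' ⟨hb, hρ, hm, hm'⟩
    refine Tr.sto hB' (by decide) (by decide) ?_
    have hsz : m' (8 * ((k + 1) / 2)) + 1 = (k + 1).size := by
      rw [hm _ (by omega), ← size_succ_eq]
    simp only [eval_fld, Exp.eval_var, Exp.eval_add, Exp.eval_mem, Exp.eval_div, Exp.eval_ofNat,
      h16, add_zero, hsz]
    refine ⟨trivial, hB'.setMem _ ?_, by rw [mul_add]; omega, fun x hx => ?_, fun d hd => ?_,
      fun a ha => ?_⟩
    · refine (size_le_self _).trans ((Nat.size_le_size (m := k + 1) (n := n) (by omega)).trans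
        hB.card)
    · rw [Function.update_of_ne (by omega), hρ x hx]
    · by_cases hdk : d = k + 1
      · subst hdk; simp
      · rw [Function.update_of_ne (by omega)]; exact hm d (by omega)
    · rw [Function.update_of_ne (ha _)]; exact hm' a ha
  · rintro ρ' m' b hB' ⟨hb, hρ, hm, hm'⟩
    rw [h0] at hb hm
    exact ⟨by nlinarith, hB', hρ, hm, hm'⟩

lemma degAt_sum_le (k : ℕ) : ∑ v ∈ Finset.range k, L.degAt v ≤ k * n := by
  simpa using Finset.sum_le_card_nsmul (Finset.range k) L.degAt n (fun v _ => degAt_le L v)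

lemma tr_degreeSum {β : ℕ} {ρ m : ℕ → ℕ} (hB : Bdd n β ρ m) (hβ : 2 * n.size ≤ β)
    (h0 : ρ 0 = n) (h5 : ρ 5 = 0)
    (hm : ∀ d ≤ n, m (8 * d) = d.size) (hm' : ∀ a, (∀ d, a ≠ 8 * d) → a ≠ 5 → m a = 0)
    (hm5 : m 5 = n) :
    Tr L degreeSum ρ m (fun ρ' m' b => b ≤ 6 * unitCost β * (n + 1) ∧ Bdd n β ρ' m' ∧
      (∀ x < 16, x ≠ 5 → ρ' x = ρ x) ∧ ρ' 5 = degSum L ∧ Mem1 L m') := by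
  unfold degreeSum
  refine Tr.forLoop hB (by norm_num) (by norm_num) (by norm_num)
    (Inv := fun k ρ' m' b => b ≤ unitCost β + 5 * unitCost β * k ∧
      (∀ x < 16, x ≠ 5 → ρ' x = ρ x) ∧ ρ' 5 = ∑ v ∈ Finset.range k, L.degAt v ∧
      (∀ d ≤ n, m' (8 * d) = d.size) ∧ m' 5 = n ∧ (∀ v < k, m' (8 * v + 1) = n) ∧
      (∀ v < k, m' (8 * v + 6) = (L.degAt v).size) ∧ (∀ v, m' (8 * v + 3) = 0) ∧
      (∀ v, m' (8 * v + 4) = 0)) ?_ ?_ ?_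
  · refine ⟨by omega, fun x hx _ => ?_, by simpa using h5, hm, hm5, by simp, by simp, ?_, ?_⟩
    · rw [Function.update_of_ne (by omega)]
    · intro v; exact hm' _ (by omega) (by omega)
    · intro v; exact hm' _ (by omega) (by omega)
  · rintro k hk ρ' m' b h16 hB' ⟨hb, hρ, hs, h8, hm5, h1, h6, h3, h4⟩
    rw [h0] at hk
    -- Partial degree sums are at most n², hence the requirement of two lengths of n.
    have hsz : ((∑ v ∈ Finset.range k, L.degAt v) + L.degAt k).size ≤ β := by
      rw [← Finset.sum_range_succ]
      refine (Nat.size_le_size (degAt_sum_le (k + 1))).trans ((size_mul_le _ _).trans ?_)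
      have := Nat.size_le_size (show k + 1 ≤ n by omega)
      omega
    refine Tr.asg_seq hB' (by norm_num) (by decide) ?_ fun hB1 => ?_
    · simpa [h16, hs] using hsz
    simp only [Exp.eval_var, Exp.eval_add, Exp.eval_deg, h16, hs] at hB1 ⊢
    refine Tr.sto_seq hB1 (by decide) (by decide) ?_ fun hB2 => ?_
    · simpa [hρ, h0] using hB.card
    simp only [eval_fld, Exp.eval_var, ne_eq, Nat.reduceEqDiff, not_false_eq_true,
      Function.update_of_ne, h16, OfNat.zero_ne_ofNat, hρ 0 (by norm_num) (by norm_num), h0]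
      at hB2 ⊢
    refine Tr.sto hB2 (by decide) (by decide) ?_
    simp only [eval_fld, Exp.eval_var, Exp.eval_mem, Exp.eval_deg, ne_eq, Nat.reduceEqDiff,
      not_false_eq_true, Function.update_of_ne, h16, add_zero]
    rw [Function.update_of_ne (show 8 * L.degAt k ≠ 8 * k + 1 by omega), h8 _ (degAt_le L k)]
    refine ⟨by simp, hB2.setMem _ ?_, by rw [mul_add]; omega, fun x hx hx5 => ?_, ?_,
      fun d hd => ?_, ?_, fun v hv => ?_, fun v hv => ?_, fun v => ?_, fun v => ?_⟩
    · exact (size_le_self _).trans ((Nat.size_le_size (degAt_le L k)).trans hB.card)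
    · rw [Function.update_of_ne (by omega), Function.update_of_ne (by omega), hρ x hx hx5]
    · simp [Finset.sum_range_succ]
    · rw [Function.update_of_ne (by omega), Function.update_of_ne (by omega), h8 d hd]
    · rw [Function.update_of_ne (show 5 ≠ 8 * k + 1 by omega), hm5]
    · rw [Function.update_of_ne (by omega)]
      by_cases hvk : v = k
      · subst hvk; simp
      · rw [Function.update_of_ne (by omega), h1 v (by omega)]
    · by_cases hvk : v = k
      · subst hvk; simp
      · rw [Function.update_of_ne (by omega), Function.update_of_ne (by omega), h6 v (by omega)]
    · rw [Function.update_of_ne (by omega), Function.update_of_ne (by omega), h3 v]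
    · rw [Function.update_of_ne (by omega), Function.update_of_ne (by omega), h4 v]
  · rintro ρ' m' b hB' ⟨hb, hρ, hs, h8, hm5, h1, h6, h3, h4⟩
    rw [h0] at hb hs h1 h6
    exact ⟨by nlinarith, hB', hρ, hs, hm5, h1, h6, h3, h4⟩

lemma tr_leastHigh {β : ℕ} {ρ m : ℕ → ℕ} (hB : Bdd n β ρ m)
    (h0 : ρ 0 = n) (h5 : ρ 5 = degSum L) (h6 : ρ 6 = n) :
    Tr L leastHigh ρ m (fun ρ' m' b => b ≤ 5 * unitCost β * (n + 1) ∧ Bdd n β ρ' m' ∧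
      (∀ x < 16, x ≠ 6 → ρ' x = ρ x) ∧ IsLeastHigh L (ρ' 6) ∧ m' = m) := by
  unfold leastHigh
  have h41 := hB.four
  have hU := unitCost_eq β
  refine Tr.forLoop hB (by norm_num) (by norm_num) (by norm_num)
    (Inv := fun k ρ' m' b => b ≤ unitCost β + 4 * unitCost β * k ∧
      (∀ x < 16, x ≠ 6 → ρ' x = ρ x) ∧ (∀ v < k, Heavy L v → High L v → ρ' 6 ≤ L.degAt v) ∧
      (ρ' 6 = n ∨ ∃ v < n, Heavy L v ∧ High L v ∧ ρ' 6 = L.degAt v) ∧ m' = m) ?_ ?_ ?_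
  · refine ⟨by omega, fun x hx _ => ?_, by simp, ?_, rfl⟩
    · rw [Function.update_of_ne (by omega)]
    · simp [h6]
  · rintro k hk ρ' m' b h16 hB' ⟨hb, hρ, hs, h8, rfl⟩
    rw [h0] at hk
    refine Tr.ite hB' (by decide) ?_ ?_ <;>
      simp only [lightExp, lowExp, Exp.eval_var, Exp.eval_add, Exp.eval_sub, Exp.eval_mul,
        Exp.eval_deg, Exp.eval_ofNat, h16, hρ 0 (by norm_num) (by norm_num), h0,
        hρ 5 (by norm_num) (by norm_num), h5] <;> intro he
    · have he1 : Heavy L k := by unfold Heavy; omega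
      have he2 : High L k := by unfold High; omega
      refine Tr.asg hB' (by norm_num) (by decide) ?_
      simp only [Exp.eval_deg, Exp.eval_var, h16]
      refine ⟨by simp [h16], hB'.setReg _ ?_, by rw [mul_add]; omega, fun x hx hx6 => ?_,
        fun v hv hv1 hv2 => ?_, Or.inr ⟨k, hk, he1, he2, by simp⟩, trivial⟩
      · exact (Nat.size_le_size (degAt_le L k)).trans hB.card
      · rw [Function.update_of_ne (by omega), Function.update_of_ne (by omega), hρ x hx hx6]
      · rw [Function.update_of_ne (by omega), Function.update_self]
        by_cases hvk : v = k
        · rw [hvk]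
        · have := hs v (by omega) hv1 hv2
          omega
    · refine Tr.skip ⟨h16, hB', by rw [mul_add]; omega, fun x hx hx6 => ?_, fun v hv hv1 hv2 => ?_,
        ?_, rfl⟩
      · rw [Function.update_of_ne (by omega), hρ x hx hx6]
      · rw [Function.update_of_ne (by omega)]
        by_cases hvk : v = k
        · subst hvk; unfold Heavy at hv1; unfold High at hv2; omega
        · exact hs v (by omega) hv1 hv2
      · rwa [Function.update_of_ne (by omega)]
  · rintro ρ' m' b hB' ⟨hb, hρ, hs, h8, hm⟩
    rw [h0] at hb hs
    exact ⟨by nlinarith, hB', hρ, ⟨hs, h8⟩, hm⟩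

lemma tr_setup {β K r : ℕ} {ρ m : ℕ → ℕ} (hB : Bdd n β ρ m) (hβ : K.size + 6 * n.size + 2 ≤ β)
    (h0 : ρ 0 = n) (h1 : ρ 1 = r) (hr : r ≤ n) (h5 : ρ 5 = 0) (hm : ∀ a, m a = 0) :
    Tr L (setup K) ρ m (fun ρ' m' b => b ≤ 30 * unitCost β * (n + 1) ∧ Bdd n β ρ' m' ∧
      ∃ d, IsLeastHigh L d ∧ Env L K r d ρ' ∧ Mem1 L m') := by
  unfold setup
  have hU := unitCost_eq β
  have hnn : n.size.size ≤ n.size := size_le_self _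
  have hrr : r.size ≤ n.size := Nat.size_le_size hr
  have hKn : (K * n.size).size ≤ K.size + n.size := (size_mul_le _ _).trans (by omega)
  refine Tr.const_seq hB (by omega) fun hB => ?_
  refine Tr.asg_seq hB (by norm_num) (by decide) ?_ fun hB => ?_
  · simp only [Exp.eval_add, Exp.eval_var, Exp.eval_ofNat, ne_eq, OfNat.zero_ne_ofNat,
      not_false_eq_true, Function.update_of_ne, h0]
    refine (size_add_le _ _).trans ?_
    rw [Nat.size_one]; omega
  simp only [Exp.eval_add, Exp.eval_var, Exp.eval_ofNat, ne_eq, OfNat.zero_ne_ofNat,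
      not_false_eq_true, Function.update_of_ne, h0] at hB ⊢
  refine Tr.sto_seq hB (by decide) (by decide) ?_ fun hB => ?_
  · simpa [h0] using hB.card
  simp only [eval_fld, Exp.eval_var, Exp.eval_ofNat, ne_eq, OfNat.zero_ne_ofNat,
      not_false_eq_true, Function.update_of_ne, h0, mul_zero, zero_add] at hB ⊢
  refine Tr.seq (tr_levelTable hB (by simp [h0]) (by simp [hm])) ?_
  rintro ρ1 m1 b1 ⟨hb1, hB, hρ1, hm1, hm1'⟩
  have e0 : ρ1 0 = n := by rw [hρ1 0 (by norm_num)]; simp [h0]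
  have e1 : ρ1 1 = r := by rw [hρ1 1 (by norm_num)]; simp [h1]
  have e2 : ρ1 2 = n + 1 := by rw [hρ1 2 (by norm_num)]; simp
  have e5 : ρ1 5 = 0 := by rw [hρ1 5 (by norm_num)]; simp [h5]
  have e9 : ρ1 9 = K := by rw [hρ1 9 (by norm_num)]; simp
  have e3 : (Exp.mem (fld 0 (Exp.var 0))).eval L ρ1 m1 = n.size := by
    simp [e0, hm1 n le_rfl]
  refine Tr.asg_seq hB (by norm_num) (by decide) (by rw [e3]; omega) fun hB => ?_
  rw [e3] at hB ⊢
  have e4 : (Exp.var 0 * (Exp.var 9 * Exp.var 3)).eval L (Function.update ρ1 3 n.size) m1 =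
      n * (K * n.size) := by simp [e0, e9]
  refine Tr.asg_seq hB (by norm_num) (by decide) ?_ fun hB => ?_
  · rw [e4]; exact (size_mul_le _ _).trans (by omega)
  rw [e4] at hB ⊢
  refine Tr.seq (tr_degreeSum hB (by omega) (by simp [e0]) (by simp [e5]) hm1 ?_ ?_) ?_
  · intro a ha ha5
    rw [hm1' a ha, Function.update_of_ne ha5, hm]
  · rw [hm1' 5 (by omega), Function.update_self]
  rintro ρ2 m2 b2 ⟨hb2, hB, hρ2, h25, hm2⟩
  refine Tr.asg_seq hB (by norm_num) (by decide) ?_ fun hB => ?_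
  · simpa using hB.reg 0 (by norm_num)
  have f0 : ρ2 0 = n := by rw [hρ2 0 (by norm_num) (by norm_num)]; simp [e0]
  simp only [Exp.eval_var, f0] at hB ⊢
  refine Tr.seq (tr_leastHigh hB (by simp [f0]) (by simp [h25]) (by simp)) ?_
  rintro ρ3 m3 b3 ⟨hb3, hB3, hρ3, h36, rfl⟩
  have g0 : ρ3 0 = n := by rw [hρ3 0 (by norm_num) (by norm_num)]; simp [f0]
  have g : ∀ x < 16, x ≠ 5 → x ≠ 6 →
      ρ3 x = Function.update (Function.update ρ1 3 n.size) 4 (n * (K * n.size)) x := by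
    intro x hx hx5 hx6
    rw [hρ3 x hx hx6, Function.update_of_ne hx6, hρ2 x hx hx5]
  have g1 : ρ3 1 = r := by rw [g 1 (by norm_num) (by norm_num) (by norm_num)]; simp [e1]
  have g2 : ρ3 2 = n + 1 := by rw [g 2 (by norm_num) (by norm_num) (by norm_num)]; simp [e2]
  have g3 : ρ3 3 = n.size := by rw [g 3 (by norm_num) (by norm_num) (by norm_num)]; simp
  have g4 : ρ3 4 = n * (K * n.size) := by
    rw [g 4 (by norm_num) (by norm_num) (by norm_num)]; simp
  have g9 : ρ3 9 = K := by rw [g 9 (by norm_num) (by norm_num) (by norm_num)]; simp [e9]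
  have g5 : ρ3 5 = degSum L := by rw [hρ3 5 (by norm_num) (by norm_num)]; simp [h25]
  have hT : (r * (K * n.size)).size ≤ K.size + 2 * n.size := (size_mul_le _ _).trans (by omega)
  have e7 : (Exp.var 1 * (Exp.var 9 * Exp.var 3)).eval L ρ3 m3 = r * (K * n.size) := by
    simp [g1, g9, g3]
  refine Tr.asg_seq hB3 (by norm_num) (by decide) (by rw [e7]; omega) fun hB => ?_
  rw [e7] at hB ⊢
  have e8 : (Exp.var 0 * Exp.var 7).eval L (Function.update ρ3 7 (r * (K * n.size))) m3 =
      n * (r * (K * n.size)) := by simp [g0]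
  refine Tr.asg hB (by norm_num) (by decide) ?_
  rw [e8]
  refine ⟨?_, hB.setReg 8 ((size_mul_le _ _).trans (by omega)), ρ3 6, h36, ?_, hm2⟩
  · have hP : unitCost β ≤ unitCost β * (n + 1) := Nat.le_mul_of_pos_right _ (by omega)
    rw [mul_assoc] at hb1 hb2 hb3 ⊢
    clear hU
    omega
  · constructor <;> simp [g0, g2, g4, g5]

/-! ### The search for centers. -/

/-- `b` may be the center of `a`. -/
def Qualifies (L : AdjacencyList G) (Lc : ℕ) (R : ℕ → ℕ) (a b : ℕ) : Prop :=
  Heavy L a ∧ R b * L.degAt a ≤ Lc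

/-- The vertices whose neighbours are visited. -/
def Scanned (L : AdjacencyList G) (Lc d : ℕ) (R : ℕ → ℕ) (v : ℕ) : Prop :=
  (Heavy L v ∧ ¬ High L v) ∨ R v * d ≤ Lc

lemma tr_tryCenter {β a b K r d : ℕ} {ρ m : ℕ → ℕ} (hB : Bdd n β ρ m)
    (hab : (a, b) = (16, 19) ∨ (a, b) = (19, 16)) (hρ : Env L K r d ρ) (hb : ρ b ≤ n)
    (hn : 2 * n.size ≤ β) (hn2 : 2 ≤ n) :
    Tr L (tryCenter a b) ρ m (fun ρ' m' c => c ≤ 2 * unitCost β ∧ Bdd n β ρ' m' ∧ ρ' = ρ ∧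
      ((Qualifies L (n * (K * n.size)) (fun i => m (8 * i + 1)) (ρ a) (ρ b) ∧
        m' = Function.update m (8 * ρ a + 3) (ρ b + 1)) ∨
      (¬ Qualifies L (n * (K * n.size)) (fun i => m (8 * i + 1)) (ρ a) (ρ b) ∧ m' = m))) := by
  unfold tryCenter Qualifies Heavy
  have hU := unitCost_eq β
  have h4 := hB.four
  have c1 : (lightExp (.var a) + (.mem (fld 1 (.var b)) * .deg (.var a) - .var 4)).chk = true := by
    rcases hab with h | h <;> (injection h with h1 h2; subst h1 h2; decide)
  have c2 : (fld 3 (.var a)).chk = true ∧ (Exp.var b + 1).chk = true := by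
    rcases hab with h | h <;> (injection h with h1 h2; subst h1 h2; decide)
  have hs : (ρ b + 1).size ≤ β := by
    refine (Nat.size_le_size (show ρ b + 1 ≤ n * n by nlinarith)).trans ?_
    exact (size_mul_le _ _).trans (by omega)
  refine Tr.ite hB c1 ?_ ?_ <;>
    simp only [lightExp, Exp.eval_var, Exp.eval_add, Exp.eval_sub, Exp.eval_mul,
      Exp.eval_deg, Exp.eval_mem, eval_fld, hρ.h0, hρ.h4] <;> intro he
  · refine Tr.sto hB c2.1 c2.2 ?_
    simp only [eval_fld, Exp.eval_var, Exp.eval_add, Exp.eval_ofNat]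
    exact ⟨by omega, hB.setMem _ hs, trivial, Or.inl ⟨by omega, trivial⟩⟩
  · exact Tr.skip ⟨by omega, hB, rfl, Or.inr ⟨by omega, rfl⟩⟩

/-- The array of centers is sound. -/
def CenSound (L : AdjacencyList G) (Lc : ℕ) (R cen : ℕ → ℕ) : Prop :=
  ∀ v, cen v = 0 ∨ ∃ w, cen v = w + 1 ∧ NAdj G v w ∧ Qualifies L Lc R v w

/-- The effect of visiting the pair `v, w`. -/
def Visited (L : AdjacencyList G) (Lc : ℕ) (R cen : ℕ → ℕ) (v w : ℕ) : Prop :=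
  (Qualifies L Lc R v w → cen v ≠ 0) ∧ (Qualifies L Lc R w v → cen w ≠ 0)

/-- The frame of the search for centers: only the array of centers is modified; it stays sound,
and entries that are set remain set. -/
structure ScanFrame (L : AdjacencyList G) (Lc : ℕ) (m m' : ℕ → ℕ) : Prop where
  frame : ∀ a, (∀ i, a ≠ 8 * i + 3) → m' a = m a
  sound : CenSound L Lc (fun i => m (8 * i + 1)) (fun i => m (8 * i + 3)) →
    CenSound L Lc (fun i => m (8 * i + 1)) (fun i => m' (8 * i + 3))
  keep : ∀ i, m (8 * i + 3) ≠ 0 → m' (8 * i + 3) ≠ 0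

lemma ScanFrame.refl (Lc : ℕ) (m : ℕ → ℕ) : ScanFrame L Lc m m :=
  ⟨fun _ _ => rfl, id, fun _ => id⟩

lemma ScanFrame.one {Lc : ℕ} {m m' : ℕ → ℕ} (h : ScanFrame L Lc m m') :
    (fun i => m' (8 * i + 1)) = fun i => m (8 * i + 1) := by
  funext i; exact h.frame _ (by omega)

lemma ScanFrame.trans {Lc : ℕ} {m m' m'' : ℕ → ℕ} (h : ScanFrame L Lc m m')
    (h' : ScanFrame L Lc m' m'') : ScanFrame L Lc m m'' := by
  refine ⟨fun a ha => (h'.frame a ha).trans (h.frame a ha), fun hs => ?_,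
    fun i hi => h'.keep i (h.keep i hi)⟩
  have := h'.sound
  rw [h.one] at this
  exact this (h.sound hs)

lemma ScanFrame.update {Lc a b : ℕ} {m : ℕ → ℕ} (hab : NAdj G a b)
    (hq : Qualifies L Lc (fun i => m (8 * i + 1)) a b) :
    ScanFrame L Lc m (Function.update m (8 * a + 3) (b + 1)) := by
  refine ⟨fun i hi => Function.update_of_ne (hi a) _ _, fun hs v => ?_, fun i hi => ?_⟩
  · by_cases hva : v = a
    · subst hva; exact Or.inr ⟨b, by simp, hab, hq⟩
    · simp only [Function.update_of_ne (show 8 * v + 3 ≠ 8 * a + 3 by omega)]; exact hs v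
  · by_cases hva : i = a
    · subst hva; simp
    · rwa [Function.update_of_ne (by omega)]

/-- Each neighbour is tried in both roles, so the same scan serves a vertex that looks for a center
and a vertex of small rank that offers itself. A later visit may replace a center, but never erases
one; this is all that `Visited` needs. -/
lemma tr_scanVertex {β K r d v : ℕ} {ρ m : ℕ → ℕ} (hB : Bdd n β ρ m) (hρ : Env L K r d ρ)
    (h16 : ρ 16 = v) (hv : v < n) (hn : 2 * n.size ≤ β) (hn2 : 2 ≤ n) :
    Tr L scanVertex ρ m (fun ρ' m' b => b ≤ 2 * unitCost β + 7 * unitCost β * L.degAt v ∧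
      Bdd n β ρ' m' ∧ (∀ x < 17, ρ' x = ρ x) ∧ ScanFrame L (n * (K * n.size)) m m' ∧
      ∀ w, NAdj G v w →
        Visited L (n * (K * n.size)) (fun i => m (8 * i + 1)) (fun i => m' (8 * i + 3)) v w) := by
  set Lc := n * (K * n.size) with hLc
  unfold scanVertex
  have hdv : (L.degAt v).size ≤ β := (Nat.size_le_size (degAt_le L v)).trans hB.card
  refine Tr.asg_seq hB (by norm_num) (by decide) ?_ fun hB => ?_
  · simpa [h16] using hdv
  simp only [Exp.eval_deg, Exp.eval_var, h16] at hB ⊢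
  refine Tr.forLoop hB (by norm_num) (by norm_num) (by norm_num)
    (Inv := fun k ρ' m' b => b ≤ unitCost β + 7 * unitCost β * k ∧ (∀ x < 17, ρ' x = ρ x) ∧
      ScanFrame L Lc m m' ∧ ∀ j < k, Visited L Lc (fun i => m (8 * i + 1))
        (fun i => m' (8 * i + 3)) v (L.nbrAt v j)) ?_ ?_ ?_
  · refine ⟨by omega, fun x hx => ?_, ScanFrame.refl _ _, by simp⟩
    rw [Function.update_of_ne (by omega), Function.update_of_ne (by omega)]
  · rintro k hk ρ' m1 b h17 hB1 ⟨hb, hρ', hF, hV⟩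
    rw [Function.update_self] at hk
    have hadj := nAdj_nbrAt hk
    have hw : L.nbrAt v k ≤ n := nbrAt_le L v k
    refine Tr.asg_seq hB1 (by norm_num) (by decide) ?_ fun hB2 => ?_
    · simpa [hρ', h16, h17] using (Nat.size_le_size hw).trans hB.card
    simp only [Exp.eval_nbr, Exp.eval_var, h17, hρ' 16 (by norm_num), h16] at hB2 ⊢
    set w := L.nbrAt v k with hwdef
    set ρ2 := Function.update ρ' 19 w with hρ2
    have a16 : ρ2 16 = v := by simp [hρ2, hρ', h16]
    have a19 : ρ2 19 = w := by simp [hρ2]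
    have hE : Env L K r d ρ2 := hρ.congr fun x hx => by
      rw [hρ2, Function.update_of_ne (by omega), hρ' x (by omega)]
    refine Tr.seq (tr_tryCenter hB2 (Or.inl rfl) hE (by omega) hn hn2) ?_
    rintro _ m2 b2 ⟨hb2, hB3, rfl, hm2⟩
    refine (tr_tryCenter hB3 (Or.inr rfl) hE (by omega) hn hn2).mono ?_
    rintro _ m3 b3 ⟨hb3, hB4, rfl, hm3⟩
    rw [a16, a19] at hm2 hm3
    have hF2 : ScanFrame L Lc m1 m2 := by
      rcases hm2 with ⟨hq, rfl⟩ | ⟨-, rfl⟩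
      · exact ScanFrame.update hadj hq
      · exact ScanFrame.refl _ _
    have hF3 : ScanFrame L Lc m2 m3 := by
      rcases hm3 with ⟨hq, rfl⟩ | ⟨-, rfl⟩
      · exact ScanFrame.update hadj.symm hq
      · exact ScanFrame.refl _ _
    rw [hF2.one, hF.one] at hm3
    rw [hF.one] at hm2
    refine ⟨by rw [hρ2, Function.update_of_ne (by norm_num), h17], hB4, by rw [mul_add]; omega,
      fun x hx => ?_, hF.trans (hF2.trans hF3), fun j hj => ?_⟩
    · rw [Function.update_of_ne (by omega), hρ2, Function.update_of_ne (by omega), hρ' x hx]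
    · by_cases hjk : j = k
      · subst hjk
        rw [← hwdef]
        constructor
        · intro hq
          refine hF3.keep v ?_
          rcases hm2 with ⟨-, rfl⟩ | ⟨hnq, rfl⟩
          · simp
          · exact absurd hq hnq
        · intro hq
          rcases hm3 with ⟨-, rfl⟩ | ⟨hnq, rfl⟩
          · simp
          · exact absurd hq hnq
      · obtain ⟨hV1, hV2⟩ := hV j (by omega)
        exact ⟨fun hq => hF3.keep _ (hF2.keep _ (hV1 hq)),
          fun hq => hF3.keep _ (hF2.keep _ (hV2 hq))⟩
  · rintro ρ' m' b hB' ⟨hb, hρ', hF, hV⟩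
    rw [Function.update_self] at hb hV
    refine ⟨by omega, hB', hρ', hF, fun w hw => ?_⟩
    obtain ⟨j, hj, rfl⟩ := hw.exists_index (L := L)
    exact hV j hj

-- List lengths are charged only for scanned vertices. The ranks are not modified, so the set of
-- scanned vertices can be read off the initial memory.
open Classical in
lemma tr_scan {β K r d : ℕ} {ρ m : ℕ → ℕ} (hB : Bdd n β ρ m) (hρ : Env L K r d ρ)
    (hn : 2 * n.size ≤ β) (hn2 : 2 ≤ n) :
    Tr L scan ρ m (fun ρ' m' b => b ≤ 8 * unitCost β * (n + 1) + 7 * unitCost β *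
        ∑ v ∈ Finset.range n with Scanned L (n * (K * n.size)) d (fun i => m (8 * i + 1)) v,
          L.degAt v ∧
      Bdd n β ρ' m' ∧ Env L K r d ρ' ∧ ScanFrame L (n * (K * n.size)) m m' ∧
      ∀ v < n, Scanned L (n * (K * n.size)) d (fun i => m (8 * i + 1)) v → ∀ w, NAdj G v w →
        Visited L (n * (K * n.size)) (fun i => m (8 * i + 1)) (fun i => m' (8 * i + 3)) v w) := by
  set Lc := n * (K * n.size) with hLc
  set R := fun i => m (8 * i + 1) with hR
  unfold scan
  have hU := unitCost_eq β
  have h4 := hB.four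
  refine Tr.forLoop hB (by norm_num) (by norm_num) (by norm_num)
    (Inv := fun k ρ' m' b => b ≤ unitCost β + 6 * unitCost β * k + 7 * unitCost β *
        ∑ v ∈ Finset.range k with Scanned L Lc d R v, L.degAt v ∧
      (∀ x < 16, ρ' x = ρ x) ∧ ScanFrame L Lc m m' ∧
      ∀ v < k, Scanned L Lc d R v → ∀ w, NAdj G v w →
        Visited L Lc R (fun i => m' (8 * i + 3)) v w) ?_ ?_ ?_
  · refine ⟨by simp, fun x hx => ?_, ScanFrame.refl _ _, by simp⟩
    rw [Function.update_of_ne (by omega)]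
  · rintro k hk ρ' m1 b h16 hB1 ⟨hb, hρ', hF, hV⟩
    rw [hρ.h0] at hk
    have hE : Env L K r d ρ' := hρ.congr hρ'
    have hRk : m1 (8 * k + 1) = R k := congrFun hF.one k
    rw [Finset.range_add_one, Finset.filter_insert]
    refine Tr.ite hB1 (by decide) ?_ ?_ <;>
    simp only [lightExp, lowExp, Exp.eval_var, Exp.eval_add, Exp.eval_sub, Exp.eval_mul,
      Exp.eval_deg, Exp.eval_mem, Exp.eval_ofNat, eval_fld, hE.h0, hE.h4, hE.h5, hE.h6, h16, hRk,
      ← hLc] <;> intro he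
    · have hS : Scanned L Lc d R k := by
        unfold Scanned Heavy High
        rcases mul_eq_zero.1 he with he | he
        · left; omega
        · right; omega
      rw [if_pos hS, Finset.sum_insert (by simp)]
      refine (tr_scanVertex hB1 hE h16 hk hn hn2).mono ?_
      rintro ρ2 m2 b2 ⟨hb2, hB2, hρ2, hF2, hV2⟩
      rw [hF.one] at hV2
      refine ⟨by rw [hρ2 16 (by norm_num), h16], hB2, ?_, fun x hx => ?_, hF.trans hF2,
        fun v hv hvS w hw => ?_⟩
      · rw [mul_add, mul_add]; omega
      · rw [Function.update_of_ne (by omega), hρ2 x (by omega), hρ' x hx]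
      · by_cases hvk : v = k
        · subst hvk; exact hV2 w hw
        · obtain ⟨hV1, hV3⟩ := hV v (by omega) hvS w hw
          exact ⟨fun hq => hF2.keep _ (hV1 hq), fun hq => hF2.keep _ (hV3 hq)⟩
    · have hS : ¬ Scanned L Lc d R k := by
        unfold Scanned Heavy High
        have := (mul_ne_zero_iff.1 he)
        omega
      rw [if_neg hS]
      refine Tr.skip ⟨h16, hB1, by rw [mul_add]; omega, fun x hx => ?_, hF,
        fun v hv hvS w hw => ?_⟩
      · rw [Function.update_of_ne (by omega), hρ' x hx]
      · by_cases hvk : v = k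
        · subst hvk; exact absurd hvS hS
        · exact hV v (by omega) hvS w hw
  · rintro ρ' m' b hB' ⟨hb, hρ', hF, hV⟩
    rw [hρ.h0] at hb hV
    refine ⟨?_, hB', hρ.congr hρ', hF, hV⟩
    have : 8 * unitCost β * (n + 1) = 8 * unitCost β * n + 8 * unitCost β := by ring
    have : 8 * unitCost β * n = 6 * unitCost β * n + 2 * unitCost β * n := by ring
    omega

/-! ### The table of sampled edges. -/

lemma tr_fillDegrees {β K r d : ℕ} {ρ m : ℕ → ℕ} (hB : Bdd n β ρ m) (hρ : Env L K r d ρ) :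
    Tr L fillDegrees ρ m (fun ρ' m' b => b ≤ 4 * unitCost β * (ρ 8 + 1) ∧
      Bdd n β ρ' m' ∧ (∀ x < 16, ρ' x = ρ x) ∧
      (∀ i < ρ 8, m' (8 * i + 2) = L.degAt (i / (r * (K * n.size)))) ∧
      ∀ a, (∀ i, a ≠ 8 * i + 2) → m' a = m a) := by
  unfold fillDegrees
  refine Tr.forLoop hB (by norm_num) (by norm_num) (by norm_num)
    (Inv := fun k ρ' m' b => b ≤ unitCost β + 3 * unitCost β * k ∧ (∀ x < 16, ρ' x = ρ x) ∧
      (∀ i < k, m' (8 * i + 2) = L.degAt (i / (r * (K * n.size)))) ∧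
      ∀ a, (∀ i, a ≠ 8 * i + 2) → m' a = m a) ?_ ?_ ?_
  · refine ⟨by omega, fun x hx => ?_, by simp, by simp⟩
    rw [Function.update_of_ne (by omega)]
  · rintro k hk ρ' m' b h16 hB' ⟨hb, hρ', hm, hm'⟩
    refine Tr.sto hB' (by decide) (by decide) ?_
    simp only [eval_fld, Exp.eval_var, Exp.eval_deg, Exp.eval_div, h16, hρ' 7 (by norm_num), hρ.h7]
    refine ⟨trivial, hB'.setMem _ ((Nat.size_le_size (degAt_le L _)).trans hB.card),
      by rw [mul_add]; omega, fun x hx => ?_, fun i hi => ?_, fun a ha => ?_⟩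
    · rw [Function.update_of_ne (by omega), hρ' x hx]
    · by_cases hik : i = k
      · subst hik; simp
      · rw [Function.update_of_ne (by omega)]; exact hm i (by omega)
    · rw [Function.update_of_ne (ha _)]; exact hm' a ha
  · rintro ρ' m' b hB' ⟨hb, hρ', hm, hm'⟩
    exact ⟨by nlinarith, hB', hρ', hm, hm'⟩

/-- The index of the pair `(u, v)` in the table. -/
def pairIndex (n : ℕ) (m : ℕ → ℕ) (u v : ℕ) : ℕ :=
  (m (8 * u + 3) * (n + 1) + m (8 * v + 3)) * (n + 1) + m (8 * u + 6)

/-- The code of the pair `(u, v)`. -/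
def pairCode (n u v : ℕ) : ℕ := u * (n + 1) + v + 1

/-- Nonzero entries of the table are codes of edges between the given clusters. -/
def TableSound (G : SimpleGraph (Fin n)) (m : ℕ → ℕ) : Prop :=
  ∀ x, m (8 * x + 4) = 0 ∨ ∃ v w, NAdj G v w ∧ m (8 * v + 3) ≠ 0 ∧ m (8 * w + 3) ≠ 0 ∧
    x = pairIndex n m v w ∧ m (8 * x + 4) = pairCode n v w

lemma pairIndex_congr {m m' : ℕ → ℕ} (h : ∀ a, (∀ i, a ≠ 8 * i + 4) → m' a = m a) (u v : ℕ) :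
    pairIndex n m' u v = pairIndex n m u v := by
  unfold pairIndex
  rw [h _ (by omega), h _ (by omega), h _ (by omega)]

/-- Sample `i` belongs to vertex `i / T`. Samples of the same cell overwrite each other, so a cell
is only claimed to be nonzero and to hold some edge that belongs to it. The hypothesis `hS` excludes
list probes past the end, whose default value 0 need not be a neighbour. -/
lemma tr_fillTable {β K r d : ℕ} {ρ m : ℕ → ℕ} (hB : Bdd n β ρ m) (hρ : Env L K r d ρ)
    (hβ : 2 * n.size + 2 ≤ β) (h4 : ∀ x, m (8 * x + 4) = 0)
    (hS : ∀ i < ρ 8, m (8 * (i / (r * (K * n.size))) + 3) ≠ 0 →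
      m (8 * i + 2) < L.degAt (i / (r * (K * n.size)))) :
    Tr L fillTable ρ m (fun ρ' m' b => b ≤ 8 * unitCost β * (ρ 8 + 1) ∧ Bdd n β ρ' m' ∧
      (∀ a, (∀ i, a ≠ 8 * i + 4) → m' a = m a) ∧ TableSound G m' ∧
      ∀ i < ρ 8, m (8 * (i / (r * (K * n.size))) + 3) ≠ 0 →
        m (8 * (L.nbrAt (i / (r * (K * n.size))) (m (8 * i + 2))) + 3) ≠ 0 →
        m' (8 * pairIndex n m (i / (r * (K * n.size)))
          (L.nbrAt (i / (r * (K * n.size))) (m (8 * i + 2))) + 4) ≠ 0) := by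
  set T := r * (K * n.size) with hT
  have hU := unitCost_eq β
  have hβ4 := hB.four
  unfold fillTable
  refine Tr.forLoop hB (by norm_num) (by norm_num) (by norm_num)
    (Inv := fun k ρ' m' b => b ≤ unitCost β + 7 * unitCost β * k ∧ (∀ x < 16, ρ' x = ρ x) ∧
      (∀ a, (∀ i, a ≠ 8 * i + 4) → m' a = m a) ∧ TableSound G m' ∧
      ∀ i < k, m (8 * (i / T) + 3) ≠ 0 → m (8 * (L.nbrAt (i / T) (m (8 * i + 2))) + 3) ≠ 0 →
        m' (8 * pairIndex n m (i / T) (L.nbrAt (i / T) (m (8 * i + 2))) + 4) ≠ 0) ?_ ?_ ?_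
  · refine ⟨by omega, fun x hx => ?_, fun _ _ => rfl, fun x => Or.inl (h4 x), by simp⟩
    rw [Function.update_of_ne (by omega)]
  · rintro k hk ρ' m1 b h16 hB1 ⟨hb, hρ', hF, hs, hc⟩
    have hv : (k / T).size ≤ β :=
      (Nat.size_le_size ((Nat.div_le_self k T).trans hk.le)).trans (hB.reg 8 (by norm_num))
    refine Tr.asg_seq hB1 (by norm_num) (by decide) ?_ fun hB2 => ?_
    · simpa [h16, hρ' 7, hρ.h7] using hv
    simp only [Exp.eval_var, Exp.eval_div, h16, hρ' 7 (by norm_num), hρ.h7, ← hT] at hB2 ⊢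
    have hw := (Nat.size_le_size (nbrAt_le L (k / T) (m (8 * k + 2)))).trans hB.card
    have ew : (Exp.nbr (.var 17) (.mem (fld 2 (.var 16)))).eval L
        (Function.update ρ' 17 (k / T)) m1 = L.nbrAt (k / T) (m (8 * k + 2)) := by
      simp [h16, hF (8 * k + 2) (by omega)]
    refine Tr.asg_seq hB2 (by norm_num) (by decide) (by rw [ew]; exact hw) fun hB3 => ?_
    rw [ew] at hB3 ⊢
    set v := k / T with hvd
    set w := L.nbrAt v (m (8 * k + 2)) with hwd
    set ρ2 := Function.update (Function.update ρ' 17 v) 19 w with hρ2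
    have a2 : ρ2 2 = n + 1 := by simp [hρ2, hρ' 2, hρ.h2]
    have a17 : ρ2 17 = v := by simp [hρ2]
    have a19 : ρ2 19 = w := by simp [hρ2]
    have aρ : ∀ x < 16, Function.update ρ2 16 (k + 1) x = ρ x := fun x hx => by
      rw [hρ2, Function.update_of_ne (by omega), Function.update_of_ne (by omega),
        Function.update_of_ne (by omega), hρ' x hx]
    have c3 : ∀ i, m1 (8 * i + 3) = m (8 * i + 3) := fun i => hF _ (by omega)
    refine Tr.ite hB3 (by decide) ?_ ?_ <;>
    simp only [Exp.eval_var, Exp.eval_sub, Exp.eval_mul, Exp.eval_mem, Exp.eval_ofNat, eval_fld,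
      a17, a19, c3] <;> intro he
    · have hvw : m (8 * v + 3) * m (8 * w + 3) ≠ 0 := by omega
      obtain ⟨hv0, hw0⟩ := mul_ne_zero_iff.1 hvw
      have hadj : NAdj G v w := nAdj_nbrAt (hS k hk hv0)
      refine Tr.sto hB3 (by decide) (by decide) ?_
      have ei : (fld 4 (tableIndex (.var 2) (.var 17) (.var 19))).eval L ρ2 m1 =
          8 * pairIndex n m v w + 4 := by
        rw [← pairIndex_congr hF v w]
        simp [tableIndex, pairIndex, a2, a17, a19]
      have ec : (codeExp (.var 2) (.var 17) (.var 19)).eval L ρ2 m1 = pairCode n v w := by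
        simp [codeExp, pairCode, a2, a17, a19]
      rw [ei, ec]
      have hF' : ∀ a, (∀ i, a ≠ 8 * i + 4) →
          Function.update m1 (8 * pairIndex n m v w + 4) (pairCode n v w) a = m a := fun a ha => by
        rw [Function.update_of_ne (ha _), hF a ha]
      refine ⟨by simp [hρ2, h16], hB3.setMem _ ?_, by rw [mul_add]; omega, aρ, hF',
        fun x => ?_, fun i hi hi1 hi2 => ?_⟩
      · have hvn := hadj.1
        have hwn := hadj.2.1
        refine (Nat.size_le_size (show pairCode n v w ≤ (n + 1) * (n + 1) by
          unfold pairCode; nlinarith)).trans ((size_mul_le _ _).trans ?_)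
        have := size_add_le n 1
        rw [Nat.size_one] at this
        omega
      · by_cases hx : x = pairIndex n m v w
        · refine Or.inr ⟨v, w, hadj, ?_, ?_, ?_, ?_⟩
          · rw [hF' _ (by omega)]; exact hv0
          · rw [hF' _ (by omega)]; exact hw0
          · rw [pairIndex_congr hF', hx]
          · rw [hx, Function.update_self]
        · rw [Function.update_of_ne (by omega)]
          refine (hs x).imp id ?_
          rintro ⟨v', w', h1, h2, h3, h5, h6⟩
          refine ⟨v', w', h1, ?_, ?_, ?_, h6⟩
          · rwa [hF' _ (by omega), ← c3]
          · rwa [hF' _ (by omega), ← c3]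
          · rw [pairIndex_congr hF', ← pairIndex_congr hF, h5]
      · by_cases hik : i = k
        · subst hik
          rw [← hvd, ← hwd, Function.update_self]
          unfold pairCode; omega
        · have := hc i (by omega) hi1 hi2
          by_cases hx : pairIndex n m (i / T) (L.nbrAt (i / T) (m (8 * i + 2))) =
              pairIndex n m v w
          · rw [hx, Function.update_self]
            unfold pairCode; omega
          · rwa [Function.update_of_ne (by omega)]
    · refine Tr.skip ⟨by simp [hρ2, h16], hB3, by rw [mul_add]; omega, aρ, hF, hs,
        fun i hi hi1 hi2 => ?_⟩
      by_cases hik : i = k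
      · subst hik
        exact absurd (mul_ne_zero hi1 hi2) (by rw [← hvd, ← hwd]; omega)
      · exact hc i (by omega) hi1 hi2
  · rintro ρ' m' b hB' ⟨hb, hρ', hm, hm'⟩
    exact ⟨by nlinarith, hB', hm, hm'⟩

/-! ### Probability estimates -/

lemma avg_ofReal {k : ℕ} (hk : 0 < k) {w : ℕ → ℝ} (hw : ∀ x, 0 ≤ w x) :
    avg k (fun x => ENNReal.ofReal (w x)) =
      ENNReal.ofReal ((∑ x ∈ Finset.range k, w x) / k) := by
  rw [avg_eq hk, ENNReal.ofReal_div_of_pos (by exact_mod_cast hk),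
    ENNReal.ofReal_sum_of_nonneg (fun x _ => hw x), ENNReal.ofReal_natCast]

lemma exp_le_one_add_two_mul {h : ℝ} (h0 : 0 ≤ h) (h1 : h ≤ 1) : Real.exp h ≤ 1 + 2 * h := by
  have := Real.abs_exp_sub_one_sub_id_le (x := h) (by rw [abs_of_nonneg h0]; exact h1)
  have h2 := (abs_le.1 this).2
  nlinarith

lemma card_mul_le {k y N : ℕ} (hy : 0 < y) :
    (((Finset.range k).filter (fun x => x * y ≤ N)).card : ℝ) ≤ N / y + 1 := by
  have h1 : (Finset.range k).filter (fun x => x * y ≤ N) ⊆ Finset.range (N / y + 1) := by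
    intro x hx
    rw [Finset.mem_filter] at hx
    rw [Finset.mem_range, Nat.lt_succ_iff, Nat.le_div_iff_mul_le hy]
    exact hx.2
  have h2 := Finset.card_le_card h1
  rw [Finset.card_range] at h2
  calc (((Finset.range k).filter (fun x => x * y ≤ N)).card : ℝ) ≤ ((N / y + 1 : ℕ) : ℝ) := by
        exact_mod_cast h2
    _ ≤ N / y + 1 := by
        push_cast
        gcongr
        exact Nat.cast_div_le

/-- Upper tail of the weight of the indices with a small random number. -/
lemma prob_weight {p : PMF (ℕ → ℕ)} (hn : 0 < n) (hp : IsIndep n (fun _ => n) p) {y l : ℕ}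
    (hy : 0 < y) {h : ℕ → ℝ} (h0 : ∀ i, 0 ≤ h i) (h1 : ∀ i, h i ≤ 1) :
    p.toOuterMeasure {R | ¬ ∑ i ∈ Finset.range n with R i * y ≤ n * l, h i <
      2 * ((l : ℝ) / y + 1 / n) * ∑ i ∈ Finset.range n, h i + l} ≤
      ENNReal.ofReal (Real.exp (-l)) := by
  have hnR : (0 : ℝ) < n := by exact_mod_cast hn
  have hyR : (0 : ℝ) < y := by exact_mod_cast hy
  set q : ℝ := (l : ℝ) / y + 1 / n with hq
  have hq0 : 0 ≤ q := by positivity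
  set Tt : ℝ := 2 * q * ∑ i ∈ Finset.range n, h i + l with hTt
  -- Exponential moments: the product of these weights is exp of the selected weight. An index is
  -- selected with probability at most `q`, so its factor averages at most 1 + 2q·h(i) ≤
  -- exp(2q·h(i)), and `Tt` exceeds the sum of these exponents by `l`.
  set w : ℕ → ℕ → ℝ := fun i x => if x * y ≤ n * l then Real.exp (h i) else 1 with hw
  have hw0 : ∀ i x, 0 ≤ w i x := by
    intro i x; simp only [hw]; split_ifs <;> positivity
  refine (hp.prob_le (ENNReal.ofReal (Real.exp (-Tt))) (fun i x => ENNReal.ofReal (w i x))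
    ?_).trans ?_
  · intro R hR
    rw [Set.mem_ofPred_eq, not_lt] at hR
    rw [← ENNReal.ofReal_prod_of_nonneg (fun i _ => hw0 _ _),
      ← ENNReal.ofReal_mul (Real.exp_pos _).le, ENNReal.one_le_ofReal]
    have : ∏ i ∈ Finset.range n, w i (R i) =
        Real.exp (∑ i ∈ Finset.range n with R i * y ≤ n * l, h i) := by
      rw [Real.exp_sum, Finset.prod_filter]
    rw [this, ← Real.exp_add]
    apply Real.one_le_exp
    linarith
  · have havg : ∀ i, avg n (fun x => ENNReal.ofReal (w i x)) ≤
        ENNReal.ofReal (Real.exp (2 * q * h i)) := by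
      intro i
      rw [avg_ofReal hn (hw0 i)]
      apply ENNReal.ofReal_le_ofReal
      have hsum : ∑ x ∈ Finset.range n, w i x ≤ n + n * q * (2 * h i) := by
        have e1 : ∀ x, w i x = 1 + if x * y ≤ n * l then (Real.exp (h i) - 1) else 0 := by
          intro x; simp only [hw]; split_ifs <;> ring
        rw [Finset.sum_congr rfl (fun x _ => e1 x), Finset.sum_add_distrib, ← Finset.sum_filter,
          Finset.sum_const, Finset.sum_const, Finset.card_range]
        simp only [nsmul_eq_mul, mul_one]
        have e2 := card_mul_le (k := n) (N := n * l) hy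
        have e3 : ((n * l : ℕ) : ℝ) / y + 1 = n * q := by
          rw [hq]; push_cast; field_simp
        rw [e3] at e2
        have e4 := exp_le_one_add_two_mul (h0 i) (h1 i)
        have e5 := Real.one_le_exp (h0 i)
        gcongr
        linarith
      rw [div_le_iff₀ hnR]
      calc _ ≤ n + n * q * (2 * h i) := hsum
        _ = (2 * q * h i + 1) * n := by ring
        _ ≤ _ := by gcongr; exact Real.add_one_le_exp _
    calc _ ≤ ENNReal.ofReal (Real.exp (-Tt)) *
          ∏ i ∈ Finset.range n, ENNReal.ofReal (Real.exp (2 * q * h i)) := by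
          gcongr with i; exact havg i
      _ = ENNReal.ofReal (Real.exp (-l)) := by
          rw [← ENNReal.ofReal_prod_of_nonneg (fun i _ => (Real.exp_pos _).le),
            ← ENNReal.ofReal_mul (Real.exp_pos _).le, ← Real.exp_sum, ← Real.exp_add,
            ← Finset.mul_sum]
          congr 2
          rw [hTt]; ring

-- The list enumerates the neighbours without repetition, so a uniform list position is a uniform
-- neighbour.
open Classical in
lemma card_nAdj {v : ℕ} (f : ℕ → Prop) :
    ((Finset.range n).filter (fun w => NAdj G v w ∧ f w)).card =
      ((Finset.range (L.degAt v)).filter (fun j => f (L.nbrAt v j))).card := by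
  symm
  refine Finset.card_bij (fun j _ => L.nbrAt v j) ?_ ?_ ?_
  · intro j hj
    rw [Finset.mem_filter, Finset.mem_range] at hj ⊢
    exact ⟨(nAdj_nbrAt hj.1).2.1, nAdj_nbrAt hj.1, hj.2⟩
  · intro i hi j hj hij
    rw [Finset.mem_filter, Finset.mem_range] at hi hj
    exact nbrAt_inj hi.1 hj.1 hij
  · intro w hw
    rw [Finset.mem_filter] at hw
    obtain ⟨j, hj, rfl⟩ := hw.2.1.exists_index (L := L)
    exact ⟨j, by simpa using ⟨hj, hw.2.2⟩, rfl⟩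

open Classical in
lemma card_nAdj' (L : AdjacencyList G) (v : ℕ) :
    ((Finset.range n).filter (fun w => NAdj G v w)).card = L.degAt v := by
  have := card_nAdj (L := L) (v := v) (fun _ => True)
  simpa using this

/-- This is the chance that one neighbour fails to qualify: the values counted lie strictly above
⌊nl / d⌋, which leaves at most n(1 − l/d) of them, or none at all. -/
lemma card_lt_mul_le {d l : ℕ} (hd : 0 < d) (hn : 0 < n) :
    (((Finset.range n).filter (fun x => n * l < x * d)).card : ℝ) ≤
      n * Real.exp (-((l : ℝ) / d)) := by
  obtain ⟨N, hN⟩ : ∃ N, N = n * l := ⟨_, rfl⟩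
  rw [← hN]
  have hnR : (0 : ℝ) < n := by exact_mod_cast hn
  have hdR : (0 : ℝ) < d := by exact_mod_cast hd
  have h1 : (Finset.range n).filter (fun x => N < x * d) ⊆ Finset.Ico (N / d + 1) n := by
    intro x hx
    rw [Finset.mem_filter, Finset.mem_range] at hx
    rw [Finset.mem_Ico]
    exact ⟨Nat.succ_le_of_lt ((Nat.div_lt_iff_lt_mul hd).2 hx.2), hx.1⟩
  have h2 := Finset.card_le_card h1
  rw [Nat.card_Ico] at h2
  rcases Nat.lt_or_ge (N / d + 1) n with h3 | h3
  · have h4 : (((Finset.range n).filter (fun x => N < x * d)).card : ℝ) + (N / d + 1 : ℕ) ≤ n := by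
      exact_mod_cast (by omega)
    have h5 : (N : ℝ) / d ≤ (N / d + 1 : ℕ) := by
      rw [div_le_iff₀ hdR]
      have := Nat.lt_mul_div_succ N hd
      have h6 : N ≤ (N / d + 1) * d := by rw [mul_comm]; exact this.le
      exact_mod_cast h6
    have h6 : (n : ℝ) * l / d ≤ N / d := by
      gcongr; exact_mod_cast hN.ge
    have h7 := Real.add_one_le_exp (-((l : ℝ) / d))
    calc (((Finset.range n).filter (fun x => N < x * d)).card : ℝ) ≤ n - n * l / d := by linarith
      _ = n * (-((l : ℝ) / d) + 1) := by ring
      _ ≤ _ := by gcongr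
  · have h4 : ((Finset.range n).filter (fun x => N < x * d)).card = 0 := by omega
    rw [h4]; push_cast; positivity

open Classical in
/-- With high probability some neighbour of `a` has a small random number. -/
lemma prob_no_center {p : PMF (ℕ → ℕ)} (hn : 0 < n) (hp : IsIndep n (fun _ => n) p) {a l : ℕ}
    (ha : 0 < L.degAt a) :
    p.toOuterMeasure {R | ¬ ∃ b, NAdj G a b ∧ R b * L.degAt a ≤ n * l} ≤
      ENNReal.ofReal (Real.exp (-l)) := by
  have hnR : (0 : ℝ) < n := by exact_mod_cast hn
  set d := L.degAt a with hd
  have hdR : (0 : ℝ) < d := by exact_mod_cast ha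
  -- On the bad event every factor is 1; each of the `d` neighbours contributes an average of at
  -- most exp(−l/d), and together they give exp(−l).
  set w : ℕ → ℕ → ℝ := fun b x => if NAdj G a b then (if n * l < x * d then 1 else 0) else 1
    with hw
  have hw0 : ∀ i x, 0 ≤ w i x := by
    intro i x; simp only [hw]; split_ifs <;> positivity
  refine (hp.prob_le 1 (fun i x => ENNReal.ofReal (w i x)) ?_).trans ?_
  · intro R hR
    rw [Set.mem_ofPred_eq] at hR
    push Not at hR
    rw [one_mul, Finset.prod_eq_one]
    intro b _
    by_cases hab : NAdj G a b
    · simp [hw, hab, hR b hab]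
    · simp [hw, hab]
  · rw [one_mul]
    have havg : ∀ b, avg n (fun x => ENNReal.ofReal (w b x)) ≤
        ENNReal.ofReal (if NAdj G a b then Real.exp (-((l : ℝ) / d)) else 1) := by
      intro b
      rw [avg_ofReal hn (hw0 b)]
      apply ENNReal.ofReal_le_ofReal
      rw [div_le_iff₀ hnR]
      by_cases hab : NAdj G a b
      · simp only [hw, hab, if_true]
        rw [← Finset.sum_filter, Finset.sum_const, nsmul_eq_mul, mul_one,
          mul_comm (Real.exp _)]
        exact card_lt_mul_le ha hn
      · simp [hw, hab]
    calc _ ≤ ∏ b ∈ Finset.range n,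
          ENNReal.ofReal (if NAdj G a b then Real.exp (-((l : ℝ) / d)) else 1) := by
          gcongr with b; exact havg b
      _ = ENNReal.ofReal (Real.exp (-l)) := by
          rw [← ENNReal.ofReal_prod_of_nonneg (fun i _ => by split_ifs <;> positivity),
            ← Finset.prod_filter, Finset.prod_const, card_nAdj' L a, ← Real.exp_nat_mul, ← hd]
          congr 2
          field_simp

open Classical in
/-- The number of edges from the vertices of center `c` and degree of length `k` to the vertices
of center `c'`. -/
noncomputable def edgeCount (L : AdjacencyList G) (cen : ℕ → ℕ) (c k c' : ℕ) : ℕ :=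
  ∑ u ∈ Finset.range n, if cen u = c ∧ (L.degAt u).size = k then
    ((Finset.range (L.degAt u)).filter (fun j => cen (L.nbrAt u j) = c')).card else 0

/-- The samples of one vertex form a block of `T` consecutive indices. -/
lemma prod_range_mul_div (f : ℕ → ℝ) (N T : ℕ) :
    ∏ i ∈ Finset.range (N * T), f (i / T) = (∏ u ∈ Finset.range N, f u) ^ T := by
  rcases Nat.eq_zero_or_pos T with rfl | hT
  · simp
  induction N with
  | zero => simp
  | succ N ih =>
    rw [add_mul, one_mul, Finset.prod_range_add, ih, Finset.prod_range_succ, mul_pow]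
    congr 1
    rw [Finset.prod_congr rfl (g := fun _ => f N), Finset.prod_const, Finset.card_range]
    intro t ht
    rw [Finset.mem_range] at ht
    congr 1
    rw [add_comm, Nat.add_mul_div_right _ _ hT, Nat.div_eq_of_lt ht, zero_add]

open Classical in
/-- With high probability one of many edges between two clusters is sampled. -/
lemma prob_no_sample {p : PMF (ℕ → ℕ)} {r l : ℕ}
    (hp : IsIndep (n * (r * l)) (fun i => L.degAt (i / (r * l))) p) (cen : ℕ → ℕ) {c k c' : ℕ}
    (he : 2 ^ k < edgeCount L cen c k c' * r) :
    p.toOuterMeasure {S | ¬ ∃ i < n * (r * l), cen (i / (r * l)) = c ∧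
      (L.degAt (i / (r * l))).size = k ∧ cen (L.nbrAt (i / (r * l)) (S i)) = c'} ≤
      ENNReal.ofReal (Real.exp (-l)) := by
  set T := r * l with hT
  -- One sample of a vertex of level k hits the cell with probability e(u) / deg(u) ≥ e(u) / 2^k.
  -- Over all rl rounds the exponents add up to l · (edge count · r / 2^k), which is at least l by
  -- the hypothesis `he`.
  set w : ℕ → ℕ → ℝ := fun i x => if cen (i / T) = c ∧ (L.degAt (i / T)).size = k ∧
    cen (L.nbrAt (i / T) x) = c' then 0 else 1 with hw
  have hw0 : ∀ i x, 0 ≤ w i x := by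
    intro i x; simp only [hw]; split_ifs <;> positivity
  set e : ℕ → ℕ := fun u => if cen u = c ∧ (L.degAt u).size = k then
    ((Finset.range (L.degAt u)).filter (fun j => cen (L.nbrAt u j) = c')).card else 0 with hedef
  refine (hp.prob_le 1 (fun i x => ENNReal.ofReal (w i x)) ?_).trans ?_
  · intro S hS
    rw [Set.mem_ofPred_eq] at hS
    push Not at hS
    rw [one_mul, Finset.prod_eq_one]
    intro i hi
    have := hS i (Finset.mem_range.1 hi)
    simp only [hw]
    rw [if_neg (by rintro ⟨h1, h2, h3⟩; exact this h1 h2 h3), ENNReal.ofReal_one]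
  · rw [one_mul]
    have havg : ∀ i, avg (L.degAt (i / T)) (fun x => ENNReal.ofReal (w i x)) ≤
        ENNReal.ofReal (Real.exp (-((e (i / T) : ℝ) / 2 ^ k))) := by
      intro i
      set u := i / T with hu
      by_cases hcu : cen u = c ∧ (L.degAt u).size = k
      -- For an isolated vertex the draw below 0 is the constant 0; its factor is at most 1, which
      -- suffices because no edge is counted at this vertex.
      · rcases Nat.eq_zero_or_pos (L.degAt u) with hd | hd
        · have he0 : e u = 0 := by simp [hedef, hd]
          rw [he0, hd]
          simp only [avg, uniformBelow, expect_pure, Nat.cast_zero, zero_div, neg_zero,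
            Real.exp_zero]
          apply ENNReal.ofReal_le_ofReal
          simp only [hw]; split_ifs <;> norm_num
        · rw [avg_ofReal hd (hw0 i)]
          apply ENNReal.ofReal_le_ofReal
          have hdR : (0 : ℝ) < L.degAt u := by exact_mod_cast hd
          have hsum : ∑ x ∈ Finset.range (L.degAt u), w i x = L.degAt u - e u := by
            have e1 : ∀ x, w i x = 1 - if cen (L.nbrAt u x) = c' then 1 else 0 := by
              intro x; simp only [hw, ← hu, hcu.1, hcu.2, true_and]; split_ifs <;> ring
            rw [Finset.sum_congr rfl (fun x _ => e1 x), Finset.sum_sub_distrib,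
              ← Finset.sum_filter, Finset.sum_const, Finset.sum_const, Finset.card_range]
            simp [hedef, hcu]
          rw [hsum, div_le_iff₀ hdR]
          have h2k : (L.degAt u : ℝ) ≤ 2 ^ k := by
            have := Nat.lt_size_self (L.degAt u)
            rw [hcu.2] at this
            exact_mod_cast this.le
          have h3 := Real.add_one_le_exp (-((e u : ℝ) / 2 ^ k))
          have h4 : (e u : ℝ) / 2 ^ k ≤ e u / L.degAt u := by gcongr
          calc (L.degAt u : ℝ) - e u = (-((e u : ℝ) / L.degAt u) + 1) * L.degAt u := by
                field_simp; ring
            _ ≤ (-((e u : ℝ) / 2 ^ k) + 1) * L.degAt u := by gcongr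
            _ ≤ _ := by gcongr
      · have he0 : e u = 0 := by simp only [hedef]; rw [if_neg hcu]
        have hw1 : ∀ x, w i x = 1 := fun x => by
          simp only [hw, ← hu]
          rw [if_neg (fun h => hcu ⟨h.1, h.2.1⟩)]
        simp only [hw1, he0, Nat.cast_zero, zero_div, neg_zero, Real.exp_zero, ENNReal.ofReal_one]
        simp [avg, expect, PMF.tsum_coe]
    calc _ ≤ ∏ i ∈ Finset.range (n * T),
          ENNReal.ofReal (Real.exp (-((e (i / T) : ℝ) / 2 ^ k))) := by
          gcongr with i; exact havg i
      _ = ENNReal.ofReal (Real.exp (-((edgeCount L cen c k c' : ℝ) / 2 ^ k)) ^ T) := by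
          rw [← ENNReal.ofReal_prod_of_nonneg (fun i _ => (Real.exp_pos _).le),
            prod_range_mul_div (fun u => Real.exp (-((e u : ℝ) / 2 ^ k)))]
          congr 2
          rw [← Real.exp_sum]
          congr 1
          rw [Finset.sum_neg_distrib, ← Finset.sum_div]
          simp only [edgeCount, Nat.cast_sum, hedef]
      _ ≤ _ := by
          apply ENNReal.ofReal_le_ofReal
          rw [← Real.exp_nat_mul, Real.exp_le_exp, hT, Nat.cast_mul]
          have h1 : (2 : ℝ) ^ k ≤ edgeCount L cen c k c' * r := by exact_mod_cast he.le
          have h2 : (1 : ℝ) ≤ edgeCount L cen c k c' * r / 2 ^ k := by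
            rwa [le_div_iff₀ (by positivity), one_mul]
          calc (r : ℝ) * l * -((edgeCount L cen c k c' : ℝ) / 2 ^ k) =
              -(l * (edgeCount L cen c k c' * r / 2 ^ k)) := by ring
            _ ≤ -(l * 1) := by gcongr
            _ = -l := by ring

lemma IsIndep.congr {N : ℕ} {M M' : ℕ → ℕ} {p : PMF (ℕ → ℕ)} (h : IsIndep N M p)
    (hM : ∀ i < N, M i = M' i) : IsIndep N M' p := by
  intro w
  refine (h w).trans (Finset.prod_congr rfl fun i hi => ?_).le
  rw [hM i (Finset.mem_range.1 hi)]

lemma Heavy.pos {v : ℕ} (hn : 0 < n) (h : Heavy L v) : 0 < L.degAt v := by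
  unfold Heavy at h
  by_contra h0
  rw [not_lt, Nat.le_zero] at h0
  rw [h0] at h
  omega

lemma degSum_le (L : AdjacencyList G) : degSum L ≤ n * n := degAt_sum_le n

/-! ### The events of high probability and their union bounds. -/

open Classical in
/-- The properties of the random numbers of the first kind that hold with high probability. -/
structure GoodRanks (L : AdjacencyList G) (l d : ℕ) (R : ℕ → ℕ) : Prop where
  center : ∀ a < n, Heavy L a → ∃ b, NAdj G a b ∧ R b * L.degAt a ≤ n * l
  few : ∀ y, 1 ≤ y → y ≤ n → ((Finset.range n).filter (fun b => R b * y ≤ n * l)).card * y ≤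
    5 * (n * l)
  work : (∑ b ∈ Finset.range n with R b * d ≤ n * l, L.degAt b) * d ≤
    2 * l * degSum L + 3 * (n * l * d)

-- There are 2n + 1 bad events: one for each vertex without a candidate center, one for each y from
-- 1 to n with too many small ranks, and one for the work of scanning. The last uses the weights deg
-- / n, normalized to lie in [0, 1].
open Classical in
lemma prob_goodRanks {p : PMF (ℕ → ℕ)} (hn : 0 < n) (hp : IsIndep n (fun _ => n) p) {l d : ℕ}
    (hl : 0 < l) (hd : 0 < d) :
    p.toOuterMeasure {R | ¬ GoodRanks L l d R} ≤
      (2 * n + 1 : ℕ) * ENNReal.ofReal (Real.exp (-l)) := by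
  have hnR : (0 : ℝ) < n := by exact_mod_cast hn
  have hlR : (1 : ℝ) ≤ l := by exact_mod_cast hl
  have hdR : (0 : ℝ) < d := by exact_mod_cast hd
  have hMR : (degSum L : ℝ) ≤ n * n := by exact_mod_cast degSum_le L
  set A : ℕ → Set (ℕ → ℕ) := fun a =>
    {R | Heavy L a ∧ ¬ ∃ b, NAdj G a b ∧ R b * L.degAt a ≤ n * l} with hA
  set B : ℕ → Set (ℕ → ℕ) := fun y =>
    {R | ¬ ∑ i ∈ Finset.range n with R i * (y + 1) ≤ n * l, (1 : ℝ) <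
      2 * ((l : ℝ) / (y + 1 : ℕ) + 1 / n) * ∑ i ∈ Finset.range n, (1 : ℝ) + l} with hBd
  set C : Set (ℕ → ℕ) := {R | ¬ ∑ i ∈ Finset.range n with R i * d ≤ n * l, (L.degAt i : ℝ) / n <
      2 * ((l : ℝ) / d + 1 / n) * ∑ i ∈ Finset.range n, (L.degAt i : ℝ) / n + l} with hC
  have hA' : ∀ a, p.toOuterMeasure (A a) ≤ ENNReal.ofReal (Real.exp (-l)) := by
    intro a
    by_cases ha : Heavy L a
    · refine le_trans (MeasureTheory.measure_mono ?_) (prob_no_center hn hp (ha.pos hn))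
      intro R hR
      exact hR.2
    · have : A a = ∅ := by
        ext R; simp [hA, ha]
      rw [this]; simp
  have hB' : ∀ y, p.toOuterMeasure (B y) ≤ ENNReal.ofReal (Real.exp (-l)) := fun y =>
    prob_weight hn hp (Nat.succ_pos y) (fun _ => zero_le_one) (fun _ => le_rfl)
  have hC' : p.toOuterMeasure C ≤ ENNReal.ofReal (Real.exp (-l)) := by
    refine prob_weight hn hp hd (fun _ => by positivity) (fun i => ?_)
    rw [div_le_one hnR]
    exact_mod_cast degAt_le L i
  have hsub : {R | ¬ GoodRanks L l d R} ⊆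
      ((⋃ a ∈ Finset.range n, A a) ∪ ⋃ y ∈ Finset.range n, B y) ∪ C := by
    intro R hR
    by_contra hcon
    simp only [Set.mem_union, Set.mem_iUnion, not_or, not_exists] at hcon
    obtain ⟨⟨h1, h2⟩, h3⟩ := hcon
    refine hR ⟨fun a ha haH => ?_, fun y hy hyn => ?_, ?_⟩
    · by_contra hno
      exact h1 a (Finset.mem_range.2 ha) ⟨haH, hno⟩
    · obtain ⟨y, rfl⟩ : ∃ z, y = z + 1 := ⟨y - 1, by omega⟩
      have h := h2 y (Finset.mem_range.2 (by omega))
      simp only [hBd, Set.mem_ofPred_eq, not_not, Finset.sum_const, nsmul_eq_mul, mul_one,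
        Finset.card_range] at h
      have hyR : (0 : ℝ) < (y + 1 : ℕ) := by positivity
      have hynR : ((y + 1 : ℕ) : ℝ) ≤ n := by exact_mod_cast hyn
      have h5 := mul_lt_mul_of_pos_right h hyR
      -- The three terms are at most 2nl, 2nl and nl, since the threshold is at most n and l ≥ 1;
      -- this is the constant 5.
      have h6 : (2 * ((l : ℝ) / (y + 1 : ℕ) + 1 / n) * n + l) * (y + 1 : ℕ) =
          2 * (n * l) + 2 * (y + 1 : ℕ) + l * (y + 1 : ℕ) := by
        field_simp
      rw [h6] at h5
      have h7 : (l : ℝ) * (y + 1 : ℕ) ≤ l * n := by gcongr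
      have h8 : (n : ℝ) ≤ n * l := le_mul_of_one_le_right hnR.le hlR
      have h9 : (((Finset.range n).filter (fun b => R b * (y + 1) ≤ n * l)).card : ℝ) *
          (y + 1 : ℕ) ≤ 5 * (n * l) := by linarith
      exact_mod_cast h9
    · simp only [hC, Set.mem_ofPred_eq, not_not, ← Finset.sum_div] at h3
      rw [← Nat.cast_sum, ← Nat.cast_sum] at h3
      change _ < 2 * ((l : ℝ) / d + 1 / n) * ((degSum L : ℝ) / n) + l at h3
      have h5 := mul_lt_mul_of_pos_right h3 (mul_pos hnR hdR)
      set W := ∑ b ∈ Finset.range n with R b * d ≤ n * l, L.degAt b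
      have h6 : (W : ℝ) / n * (n * d) = W * d := by field_simp
      have h7 : (2 * ((l : ℝ) / d + 1 / n) * ((degSum L : ℝ) / n) + l) * (n * d) =
          2 * l * degSum L + 2 * d * (degSum L / n) + n * l * d := by field_simp
      rw [h6, h7] at h5
      have h8 : (degSum L : ℝ) / n ≤ n := by rw [div_le_iff₀ hnR]; exact hMR
      have h9 : 2 * (d : ℝ) * (degSum L / n) ≤ 2 * (n * l * d) := by
        have : (n : ℝ) ≤ n * l := le_mul_of_one_le_right hnR.le hlR
        nlinarith
      have h10 : (W : ℝ) * d ≤ 2 * l * degSum L + 3 * (n * l * d) := by linarith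
      exact_mod_cast h10
  refine (MeasureTheory.measure_mono hsub).trans ?_
  refine (MeasureTheory.measure_union_le _ _).trans ?_
  refine (add_le_add (MeasureTheory.measure_union_le _ _) hC').trans ?_
  refine (add_le_add (add_le_add
    ((MeasureTheory.measure_biUnion_finset_le _ _).trans (Finset.sum_le_sum fun a _ => hA' a))
    ((MeasureTheory.measure_biUnion_finset_le _ _).trans (Finset.sum_le_sum fun a _ => hB' a)))
    le_rfl).trans ?_
  simp only [Finset.sum_const, Finset.card_range, nsmul_eq_mul]
  push_cast
  apply le_of_eq; ring

/-- The property of the random numbers of the second kind that holds with high probability. -/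
def GoodSamples (L : AdjacencyList G) (r l : ℕ) (cen S : ℕ → ℕ) : Prop :=
  ∀ c ≤ n, ∀ c' ≤ n, ∀ k ≤ n, 2 ^ k < edgeCount L cen c k c' * r →
    ∃ i < n * (r * l), cen (i / (r * l)) = c ∧ (L.degAt (i / (r * l))).size = k ∧
      cen (L.nbrAt (i / (r * l)) (S i)) = c'

/-- A union bound over all triples of two centers and a level. The centers are fixed before the
samples are drawn, so `cen` is a constant here. -/
lemma prob_goodSamples {p : PMF (ℕ → ℕ)} {r l : ℕ}
    (hp : IsIndep (n * (r * l)) (fun i => L.degAt (i / (r * l))) p) (cen : ℕ → ℕ) :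
    p.toOuterMeasure {S | ¬ GoodSamples L r l cen S} ≤
      ((n + 1) ^ 3 : ℕ) * ENNReal.ofReal (Real.exp (-l)) := by
  classical
  set A : ℕ × ℕ × ℕ → Set (ℕ → ℕ) := fun q =>
    {S | 2 ^ q.2.2 < edgeCount L cen q.1 q.2.2 q.2.1 * r ∧
      ¬ ∃ i < n * (r * l), cen (i / (r * l)) = q.1 ∧ (L.degAt (i / (r * l))).size = q.2.2 ∧
      cen (L.nbrAt (i / (r * l)) (S i)) = q.2.1} with hA
  have hA' : ∀ q, p.toOuterMeasure (A q) ≤ ENNReal.ofReal (Real.exp (-l)) := by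
    intro q
    by_cases ha : 2 ^ q.2.2 < edgeCount L cen q.1 q.2.2 q.2.1 * r
    · refine le_trans (MeasureTheory.measure_mono ?_) (prob_no_sample hp cen ha)
      intro R hR
      exact hR.2
    · have : A q = ∅ := by
        ext R; simp only [hA, ha, false_and, Set.mem_ofPred_eq, Set.mem_empty_iff_false]
      rw [this]; simp
  have hsub : {S | ¬ GoodSamples L r l cen S} ⊆
      ⋃ q ∈ Finset.range (n + 1) ×ˢ Finset.range (n + 1) ×ˢ Finset.range (n + 1), A q := by
    intro S hS
    by_contra hcon
    simp only [Set.mem_iUnion, not_exists, Finset.mem_product, Finset.mem_range] at hcon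
    refine hS fun c hc c' hc' k hk h => ?_
    by_contra hno
    exact hcon (c, c', k) ⟨Nat.lt_succ_of_le hc, Nat.lt_succ_of_le hc', Nat.lt_succ_of_le hk⟩
      ⟨h, hno⟩
  refine (MeasureTheory.measure_mono hsub).trans
    ((MeasureTheory.measure_biUnion_finset_le _ _).trans
    ((Finset.sum_le_sum fun a _ => hA' a).trans ?_))
  simp only [Finset.sum_const, Finset.card_product, Finset.card_range, nsmul_eq_mul]
  apply le_of_eq
  push_cast; ring

/-! ### The preprocessing -/

/-- The properties of the memory contents after the preprocessing. -/
structure Output (L : AdjacencyList G) (K r d : ℕ) (m : ℕ → ℕ) : Prop where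
  five : m 5 = n
  six : ∀ v < n, m (8 * v + 6) = (L.degAt v).size
  ranks : GoodRanks L (K * n.size) d (fun i => m (8 * i + 1))
  sound : CenSound L (n * (K * n.size)) (fun i => m (8 * i + 1)) (fun i => m (8 * i + 3))
  complete : ∀ v < n, Heavy L v → m (8 * v + 3) ≠ 0
  table : TableSound G m
  dense : ∀ c c' k, c ≠ 0 → c ≤ n → c' ≠ 0 → c' ≤ n → k ≤ n →
    m (8 * ((c * (n + 1) + c') * (n + 1) + k) + 4) = 0 →
    edgeCount L (fun v => m (8 * v + 3)) c k c' * r ≤ 2 ^ k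

lemma IsLeastHigh.pos {d : ℕ} (hn : 0 < n) (h : IsLeastHigh L d) : 0 < d := by
  rcases h.2 with rfl | ⟨v, _, hv, _, rfl⟩
  · exact hn
  · exact hv.pos hn

/-- Take a candidate b of the heavy vertex a. If a is high, then d ≤ deg(a), so R(b) · d ≤ R(b) ·
deg(a) and b is scanned and reaches a. Otherwise a itself is scanned and reaches b. -/
lemma complete_of_visited {d l : ℕ} {R cen : ℕ → ℕ} (hd : IsLeastHigh L d)
    (hR : GoodRanks L l d R)
    (hV : ∀ v < n, Scanned L (n * l) d R v → ∀ w, NAdj G v w → Visited L (n * l) R cen v w)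
    {a : ℕ} (ha : a < n) (haH : Heavy L a) : cen a ≠ 0 := by
  obtain ⟨b, hab, hb⟩ := hR.center a ha haH
  by_cases hhigh : High L a
  · have h1 := hd.1 a ha haH hhigh
    have h2 : Scanned L (n * l) d R b := Or.inr ((Nat.mul_le_mul_left _ h1).trans hb)
    exact (hV b hab.2.1 h2 a hab.symm).2 ⟨haH, hb⟩
  · exact (hV a ha (Or.inl ⟨haH, hhigh⟩) b hab).1 ⟨haH, hb⟩

-- The parameter r may be far longer than n. The first instruction replaces it by min(r, n), at a
-- cost in terms of `β'`; from then on all lengths are bounded by `β`, which need not depend on r.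
-- Only the two randomizations contribute to the failure probability.
open Classical in
lemma pr_preprocess {β β' K r : ℕ} {ρ m : ℕ → ℕ} (hn2 : 2 ≤ n) (hK : 0 < K)
    (hB' : Bdd n β' ρ m) (hβ : K.size + 6 * n.size + 2 ≤ β)
    (h0 : ρ 0 = n) (h1 : ρ 1 = r) (hρ : ∀ x, 2 ≤ x → ρ x = 0) (hm : ∀ a, m a = 0) :
    Pr L (preprocessCmd K) ρ m
      ((((n + 1) ^ 3 + 2 * n + 1 : ℕ) : ℝ≥0∞) * ENNReal.ofReal (Real.exp (-(K * n.size : ℕ))))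
      (fun ρ' m' b => ∃ d, IsLeastHigh L d ∧ Bdd n β ρ' m' ∧ Output L K (min r n) d m' ∧
        b ≤ unitCost β' + 50 * unitCost β * (n + 1) +
          20 * unitCost β * (n * (min r n * (K * n.size)) + 1) + 7 * unitCost β *
          ∑ v ∈ Finset.range n with
            Scanned L (n * (K * n.size)) d (fun i => m' (8 * i + 1)) v, L.degAt v) := by
  have hn : 0 < n := by omega
  have hs0 : 0 < n.size := Nat.size_pos.2 hn
  set l := K * n.size with hl
  have hlpos : 0 < l := Nat.mul_pos hK hs0
  set r' := min r n with hr'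
  set T := r' * l with hT
  set e := ENNReal.ofReal (Real.exp (-(l : ℕ))) with he
  have hε : (((n + 1) ^ 3 + 2 * n + 1 : ℕ) : ℝ≥0∞) * e =
      0 + (0 + ((2 * n + 1 : ℕ) * e + (0 + (0 + (((n + 1) ^ 3 : ℕ) * e + 0))))) := by
    push_cast; ring
  rw [hε]
  unfold preprocessCmd
  have ev : (Exp.var 1 - (Exp.var 1 - Exp.var 0)).eval L ρ m = r' := by
    simp only [Exp.eval_sub, Exp.eval_var, h0, h1, hr']; omega
  have hr'n : r' ≤ n := min_le_right _ _
  refine Pr.seq (Q' := fun ρ' m' b => ρ' = Function.update ρ 1 r' ∧ m = m' ∧ b = unitCost β')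
    (Tr.pr (Tr.asg hB' (by norm_num) (by decide) (by rw [ev]; exact ⟨rfl, rfl, rfl⟩))) ?_
  rintro _ _ _ ⟨rfl, rfl, rfl⟩
  have hB : Bdd n β (Function.update ρ 1 r') m := by
    refine ⟨by omega, by omega, fun x _ => ?_, fun a => by rw [hm]; simp⟩
    rcases (by omega : x = 0 ∨ x = 1 ∨ 2 ≤ x) with rfl | rfl | hx
    · simp only [ne_eq, zero_ne_one, not_false_eq_true, Function.update_of_ne, h0]; omega
    · rw [Function.update_self]; have := Nat.size_le_size hr'n; omega
    · rw [Function.update_of_ne (by omega), hρ x hx]; simp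
  refine Pr.seq (Tr.pr (tr_setup hB hβ (by simp [h0]) (by simp) hr'n (by simp [hρ]) hm)) ?_
  rintro ρ0 m0 b0 ⟨hb0, hB0, d, hd, hE0, hM0⟩
  have hdpos := hd.pos hn
  refine Pr.seq (pr_randomize (ε := (2 * n + 1 : ℕ) * e) (by norm_num) (by norm_num) hB0
    (P := GoodRanks L l d) fun p hp => ?_) ?_
  · rw [hE0.h0] at hp
    exact prob_goodRanks hn (hp.congr hM0.one) hlpos hdpos
  rintro ρ1 m1 b1 ⟨hb1, hB1, hρ1, -, hF1, hR⟩
  have hE1 := hE0.congr hρ1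
  rw [hE0.h0] at hb1
  refine Pr.seq (Tr.pr (tr_scan hB1 hE1 (by omega) hn2)) ?_
  rw [← hl]
  rintro ρ2 m2 b2 ⟨hb2, hB2, hE2, hF2, hV⟩
  refine Pr.seq (Tr.pr (tr_fillDegrees hB2 hE2)) ?_
  rw [← hl, ← hT, hE2.h8, ← hl, ← hT]
  rintro ρ3 m3 b3 ⟨hb3, hB3, hρ3, hD3, hF3⟩
  have hE3 := hE2.congr hρ3
  refine Pr.seq (pr_randomize (ε := ((n + 1) ^ 3 : ℕ) * e) (by norm_num) (by norm_num) hB3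
    (P := GoodSamples L r' l (fun v => m3 (8 * v + 3))) fun p hp => ?_) ?_
  · rw [hE3.h8, ← hl] at hp
    exact prob_goodSamples (hp.congr hD3) _
  rintro ρ4 m4 b4 ⟨hb4, hB4, hρ4, hS4, hF4, hG4⟩
  have hE4 := hE3.congr hρ4
  rw [hE3.h8, ← hl, ← hT] at hb4 hS4 hF4
  have f43 : ∀ i, m4 (8 * i + 3) = m2 (8 * i + 3) := fun i => by
    rw [hF4 _ (by omega), hF3 _ (by omega)]
  have f31 : ∀ i, m3 (8 * i + 3) = m4 (8 * i + 3) := fun i => (hF4 _ (by omega)).symm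
  have f41 : ∀ i, m4 (8 * i + 1) = m1 (8 * i + 1) := fun i => by
    rw [hF4 _ (by omega), hF3 _ (by omega), hF2.frame _ (by omega)]
  have sound2 := hF2.sound (fun v => Or.inl (by
    show m1 (8 * v + 3) = 0
    rw [hF1 _ (by omega)]; exact hM0.three v))
  refine Tr.pr ((tr_fillTable hB4 hE4 (by omega) (fun x => ?_) (fun i hi hci => ?_)).mono ?_)
  · rw [hF4 _ (by omega), hF3 _ (by omega), hF2.frame _ (by omega), hF1 _ (by omega)]
    exact hM0.four x
  · rw [hE4.h8, ← hl, ← hT] at hi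
    rw [← hl, ← hT] at hci ⊢
    -- A draw is either below its bound or 0; in the second case a vertex with a center is heavy, so
    -- position 0 of its list exists.
    rcases hS4 i hi with h | h
    · rwa [hD3 i hi] at h
    · rw [h]
      rw [f43] at hci
      rcases sound2 (i / T) with h' | ⟨w, -, -, hw⟩
      · exact absurd h' hci
      · exact hw.1.pos hn
  rintro ρ5 m5 b5 ⟨hb5, hB5, hF5, hT5, hc5⟩
  rw [hE4.h8, ← hl, ← hT] at hb5 hc5
  have f53 : ∀ i, m5 (8 * i + 3) = m4 (8 * i + 3) := fun i => hF5 _ (by omega)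
  have f51 : (fun i => m5 (8 * i + 1)) = fun i => m1 (8 * i + 1) := by
    funext i; rw [hF5 _ (by omega), f41]
  have f53' : (fun i => m5 (8 * i + 3)) = fun i => m2 (8 * i + 3) := by
    funext i; rw [f53, f43]
  have f6 : ∀ v < n, m4 (8 * v + 6) = (L.degAt v).size := fun v hv => by
    rw [hF4 _ (by omega), hF3 _ (by omega), hF2.frame _ (by omega), hF1 _ (by omega)]
    exact hM0.six v hv
  refine ⟨d, hd, hB5, ⟨?_, ?_, ?_, ?_, ?_, hT5, ?_⟩, ?_⟩
  · rw [hF5 _ (by omega), hF4 _ (by omega), hF3 _ (by omega), hF2.frame _ (by omega),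
      hF1 _ (by omega)]
    exact hM0.five
  · intro v hv
    rw [hF5 _ (by omega), f6 v hv]
  · rw [f51]; exact hR
  · rw [f51, f53', ← hl]; exact sound2
  · intro v hv hvH
    rw [f53, f43]
    exact complete_of_visited (cen := fun i => m2 (8 * i + 3)) hd hR hV hv hvH
  · intro c c' k hc hcn hc' hcn' hk hz
    by_contra hlt
    rw [not_le] at hlt
    have e3 : (fun v => m5 (8 * v + 3)) = fun v => m3 (8 * v + 3) := by
      funext i; rw [f53, f31]
    rw [e3] at hlt
    obtain ⟨i, hi, hi1, hi2, hi3⟩ := hG4 c hcn c' hcn' k hk hlt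
    rw [← hT] at hi hi1 hi2 hi3
    simp only [f31] at hi1 hi3
    have h5 := hc5 i hi (by rw [hi1]; exact hc) (by rw [hi3]; exact hc')
    apply h5
    have hiT : i / T < n := Nat.div_lt_of_lt_mul (by rwa [mul_comm])
    rw [pairIndex, hi1, hi3, f6 _ hiT, hi2]
    exact hz
  · rw [f51]
    have e1 : unitCost β ≤ unitCost β * (n + 1) := Nat.le_mul_of_pos_right _ (by omega)
    simp only [mul_assoc] at hb0 hb1 hb2 hb3 hb4 hb5 ⊢
    omega

/-! ### The spanner -/

/-- The pair `(u, v)` qualifies as an edge of the spanner. -/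
def Keep (n : ℕ) (m : ℕ → ℕ) (u v : ℕ) : Prop :=
  m (8 * u + 3) = 0 ∨ m (8 * u + 3) = v + 1 ∨ m (8 * pairIndex n m u v + 4) = 0 ∨
    m (8 * pairIndex n m u v + 4) = pairCode n u v

/-- The graph described by the memory contents `m`. -/
def spanner (G : SimpleGraph (Fin n)) (m : ℕ → ℕ) : SimpleGraph (Fin n) where
  Adj u v := G.Adj u v ∧ (Keep n m u v ∨ Keep n m v u)
  symm := ⟨fun _ _ h => ⟨h.1.symm, h.2.symm⟩⟩
  loopless := ⟨fun _ h => G.irrefl h.1⟩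

lemma eval_keepExp {u v : Exp} {ρ m : ℕ → ℕ} (h5 : m 5 = n) :
    (keepExp u v).eval L ρ m ≠ 0 ↔ Keep n m (u.eval L ρ m) (v.eval L ρ m) := by
  have hi : (fld 4 (tableIndex (.mem (fld 5 0) + 1) u v)).eval L ρ m =
      8 * pairIndex n m (u.eval L ρ m) (v.eval L ρ m) + 4 := by
    simp [tableIndex, pairIndex, h5]
  have hc : (codeExp (.mem (fld 5 0) + 1) u v).eval L ρ m =
      pairCode n (u.eval L ρ m) (v.eval L ρ m) := by
    simp [codeExp, pairCode, h5]
  simp only [keepExp, eqExp, Exp.eval_add, Exp.eval_sub, Exp.eval_ofNat, Exp.eval_mem, hi, hc]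
  simp only [eval_fld, Keep]
  omega

lemma eval_query {ρ m : ℕ → ℕ} (h5 : m 5 = n) {u v : Fin n} [Decidable ((spanner G m).Adj u v)]
    (h0 : ρ 0 = u) (h1 : ρ 1 = v) :
    (1 - (1 - Exp.adj (.var 0) (.var 1) * (keepExp (.var 0) (.var 1) +
      keepExp (.var 1) (.var 0))) : Exp).eval L ρ m = if (spanner G m).Adj u v then 1 else 0 := by
  classical
  have k1 := eval_keepExp (L := L) (u := .var 0) (v := .var 1) (ρ := ρ) h5
  have k2 := eval_keepExp (L := L) (u := .var 1) (v := .var 0) (ρ := ρ) h5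
  simp only [Exp.eval_var, h0, h1] at k1 k2
  have k3 : NAdj G u v ↔ G.Adj u v :=
    ⟨fun ⟨_, _, h⟩ => h, fun h => ⟨u.2, v.2, h⟩⟩
  simp only [Exp.eval_add, Exp.eval_sub, Exp.eval_mul, Exp.eval_ofNat, Exp.eval_adj, Exp.eval_var,
    h0, h1, adjAt_eq, k3, spanner]
  by_cases hG : G.Adj u v
  · by_cases hK : Keep n m u v ∨ Keep n m v u
    · have h3 : (keepExp (.var 0) (.var 1)).eval L ρ m +
          (keepExp (.var 1) (.var 0)).eval L ρ m ≠ 0 := by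
        rcases hK with h | h
        · have := k1.2 h; omega
        · have := k2.2 h; omega
      simp only [hG, hK, and_self, if_true, one_mul]
      omega
    · have h3 : (keepExp (.var 0) (.var 1)).eval L ρ m = 0 := by
        by_contra h; exact hK (Or.inl (k1.1 h))
      have h4 : (keepExp (.var 1) (.var 0)).eval L ρ m = 0 := by
        by_contra h; exact hK (Or.inr (k2.1 h))
      simp [hK, h3, h4]
  · simp [hG]

lemma isAdjacencyOracle_spanner {β : ℕ} {ρ m : ℕ → ℕ} (hB : Bdd n β ρ m) (h5 : m 5 = n) :
    IsAdjacencyOracle L queryCmd m (spanner G m) (unitCost β) := by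
  intro u v t ht
  have hr : ∀ x < 32, ((queryState m u v).regs x).size ≤ β := by
    intro x _
    simp only [queryState]
    split_ifs
    · exact (Nat.size_le_size u.2.le).trans hB.card
    · exact (Nat.size_le_size v.2.le).trans hB.card
    · simp
  obtain ⟨s', x1, a1, t1⟩ := exec_asg L (x := 0) (by norm_num)
    (by decide : (1 - (1 - Exp.adj (.var 0) (.var 1) * (keepExp (.var 0) (.var 1) +
      keepExp (.var 1) (.var 0))) : Exp).chk = true)
    (⟨fun _ _ => rfl, rfl⟩ : Agrees (queryState m u v) (queryState m u v).regs m)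
    ⟨hB.four, hB.card, hr, hB.mem⟩
  rw [queryCmd, x1, PMF.mem_support_pure_iff] at ht
  subst ht
  refine ⟨?_, ?_⟩
  · rw [a1.reg 0 (by norm_num), Function.update_self]
    classical exact eval_query h5 rfl rfl
  · have : (queryState m u v).time = 0 := rfl
    rw [this, zero_add] at t1
    exact_mod_cast t1

/-- Each edge of a shortest path is replaced by its detour. Positivity of `k` is what makes `k`
times infinity infinite for unreachable pairs. -/
lemma isSpanner_of_adj {V : Type*} {k : ℕ} {H G : SimpleGraph V} (hk : 0 < k)
    (hHG : H ≤ G) (h : ∀ u v, G.Adj u v → H.edist u v ≤ k) : IsSpanner k H G := by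
  refine ⟨hHG, fun s t => ?_⟩
  by_cases hst : G.Reachable s t
  · obtain ⟨p, hp⟩ := hst.exists_walk_length_eq_edist
    rw [← hp]
    clear hp hst
    induction p with
    | nil => simp
    | cons hadj p ih =>
      rw [SimpleGraph.Walk.length_cons]
      push_cast
      rw [mul_add, mul_one, add_comm]
      exact SimpleGraph.edist_triangle.trans (add_le_add (h _ _ hadj) ih)
  · rw [SimpleGraph.edist_eq_top_of_not_reachable hst]
    rw [ENat.mul_top (by exact_mod_cast hk.ne')]
    exact le_top

/-- Uniqueness of digits in base N + 1. Stored centers and levels are at most n, so cell indices and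
edge codes can be decoded. -/
lemma mul_succ_add_inj {N a b a' b' : ℕ} (hb : b ≤ N) (hb' : b' ≤ N)
    (h : a * (N + 1) + b = a' * (N + 1) + b') : a = a' ∧ b = b' := by
  have h1 := congrArg (· / (N + 1)) h
  simp only [mul_comm _ (N + 1), Nat.mul_add_div (Nat.succ_pos N),
    Nat.div_eq_of_lt (Nat.lt_succ_of_le hb), Nat.div_eq_of_lt (Nat.lt_succ_of_le hb'),
    add_zero] at h1
  subst h1
  exact ⟨rfl, by omega⟩

/-! ### The stretch of the spanner. -/

namespace Output

variable {K r d : ℕ} {m : ℕ → ℕ}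

lemma cen_le (h : Output L K r d m) (v : ℕ) : m (8 * v + 3) ≤ n := by
  rcases h.sound v with h0 | ⟨w, hw, hvw, -⟩
  · simp only at h0; omega
  · have := hvw.2.1
    simp only at hw; omega

lemma level_le (h : Output L K r d m) {v : ℕ} (hv : v < n) : m (8 * v + 6) ≤ n := by
  rw [h.six v hv]
  exact (size_le_self _).trans (degAt_le L v)

lemma pairIndex_inj (h : Output L K r d m) {u v u' v' : ℕ} (hu : u < n) (hu' : u' < n)
    (he : pairIndex n m u v = pairIndex n m u' v') :
    m (8 * u + 3) = m (8 * u' + 3) ∧ m (8 * v + 3) = m (8 * v' + 3) ∧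
      m (8 * u + 6) = m (8 * u' + 6) := by
  obtain ⟨h1, h2⟩ := mul_succ_add_inj (h.level_le hu) (h.level_le hu') he
  obtain ⟨h3, h4⟩ := mul_succ_add_inj (h.cen_le _) (h.cen_le _) h1
  exact ⟨h3, h4, h2⟩

lemma edist_center (h : Output L K r d m) {u : Fin n} {b : ℕ} (hb : m (8 * u + 3) = b + 1) :
    ∃ hbn : b < n, (spanner G m).edist u ⟨b, hbn⟩ = 1 := by
  rcases h.sound u with h0 | ⟨w, hw, hvw, -⟩
  · simp only at h0; omega
  · simp only at hw
    obtain rfl : w = b := by omega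
    refine ⟨hvw.2.1, SimpleGraph.edist_eq_one_iff_adj.2 ⟨hvw.2.2, Or.inl (Or.inr (Or.inl hb))⟩⟩

/-- If uv is not kept, both ends have centers and its cell holds an edge v'w' with the same pair of
centers. Edges to centers are kept, and so is v'w', since its cell holds its own code. No
probabilistic property of the output is used. -/
lemma isSpanner (h : Output L K r d m) : IsSpanner 5 (spanner G m) G := by
  refine isSpanner_of_adj (by norm_num) (fun u v huv => huv.1) fun u v huv => ?_
  by_cases hH : (spanner G m).Adj u v
  · rw [SimpleGraph.edist_eq_one_iff_adj.2 hH]; norm_num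
  · have hK : ¬ Keep n m u v ∧ ¬ Keep n m v u := by
      rw [← not_or]; exact fun hk => hH ⟨huv, hk⟩
    obtain ⟨h1, h2⟩ := hK
    unfold Keep at h1 h2
    push Not at h1 h2
    rcases h.table (pairIndex n m u v) with h0 | ⟨v', w', hadj, -, -, hidx, hcode⟩
    · exact absurd h0 h1.2.2.1
    · obtain ⟨hv', hw', hadj⟩ := hadj
      obtain ⟨e1, e2, -⟩ := h.pairIndex_inj u.2 hv' hidx
      obtain ⟨b, hb⟩ : ∃ b, m (8 * u + 3) = b + 1 := ⟨m (8 * u + 3) - 1, by have := h1.1; omega⟩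
      obtain ⟨b', hb'⟩ : ∃ b, m (8 * v + 3) = b + 1 := ⟨m (8 * v + 3) - 1, by have := h2.1; omega⟩
      obtain ⟨hbn, d1⟩ := h.edist_center hb
      obtain ⟨hbn', d2⟩ := h.edist_center hb'
      obtain ⟨_, d3⟩ := h.edist_center (u := ⟨v', hv'⟩) (e1.symm.trans hb)
      obtain ⟨_, d4⟩ := h.edist_center (u := ⟨w', hw'⟩) (e2.symm.trans hb')
      have d5 : (spanner G m).edist ⟨v', hv'⟩ ⟨w', hw'⟩ = 1 := by
        refine SimpleGraph.edist_eq_one_iff_adj.2 ⟨hadj, Or.inl (Or.inr (Or.inr (Or.inr ?_)))⟩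
        rw [← hidx]; exact hcode
      calc (spanner G m).edist u v
          ≤ (spanner G m).edist u ⟨b, hbn⟩ + ((spanner G m).edist ⟨b, hbn⟩ ⟨v', hv'⟩ +
            ((spanner G m).edist ⟨v', hv'⟩ ⟨w', hw'⟩ +
            ((spanner G m).edist ⟨w', hw'⟩ ⟨b', hbn'⟩ + (spanner G m).edist ⟨b', hbn'⟩ v))) := by
            refine SimpleGraph.edist_triangle.trans (add_le_add le_rfl ?_)
            refine SimpleGraph.edist_triangle.trans (add_le_add le_rfl ?_)
            refine SimpleGraph.edist_triangle.trans (add_le_add le_rfl ?_)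
            exact SimpleGraph.edist_triangle
        _ = 5 := by
            rw [SimpleGraph.edist_comm] at d2 d3
            rw [d1, d3, d5, d4, d2]
            norm_num

end Output

/-! ### The number of edges of the spanner -/

open Classical in
/-- The number of edges at vertices that are not heavy, counted from these vertices. -/
noncomputable def lightSum (L : AdjacencyList G) : ℕ :=
  ∑ u ∈ Finset.range n with ¬ Heavy L u, L.degAt u

open Classical in
/-- Pairs of adjacent vertices with a property. -/
noncomputable def adjPairs (G : SimpleGraph (Fin n)) (f : ℕ → ℕ → Prop) : Finset (ℕ × ℕ) :=
  (Finset.range n ×ˢ Finset.range n).filter (fun p => NAdj G p.1 p.2 ∧ f p.1 p.2)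

lemma mem_adjPairs {f : ℕ → ℕ → Prop} {p : ℕ × ℕ} :
    p ∈ adjPairs G f ↔ NAdj G p.1 p.2 ∧ f p.1 p.2 := by
  classical
  rw [adjPairs, Finset.mem_filter, Finset.mem_product, Finset.mem_range, Finset.mem_range]
  exact ⟨fun h => h.2, fun h => ⟨⟨h.1.1, h.1.2.1⟩, h⟩⟩

open Classical in
lemma card_adjPairs (f : ℕ → ℕ → Prop) :
    (adjPairs G f).card = ∑ u ∈ Finset.range n,
      ((Finset.range (L.degAt u)).filter (fun j => f u (L.nbrAt u j))).card := by
  rw [adjPairs, Finset.card_filter, Finset.sum_product]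
  refine Finset.sum_congr rfl fun u _ => ?_
  rw [← card_nAdj, Finset.card_filter]

lemma card_adjPairs_left (L : AdjacencyList G) :
    (adjPairs G (fun u _ => ¬ Heavy L u)).card = lightSum L := by
  classical
  rw [card_adjPairs (L := L), lightSum, Finset.sum_filter]
  refine Finset.sum_congr rfl fun u _ => ?_
  by_cases h : Heavy L u <;> simp [h]

lemma card_adjPairs_right (L : AdjacencyList G) :
    (adjPairs G (fun _ v => ¬ Heavy L v)).card = lightSum L := by
  rw [← card_adjPairs_left]
  refine Finset.card_bij (fun p _ => (p.2, p.1)) ?_ ?_ ?_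
  · intro p hp
    rw [mem_adjPairs] at hp ⊢
    exact ⟨hp.1.symm, hp.2⟩
  · rintro ⟨a, b⟩ _ ⟨a', b'⟩ _ h
    simp only [Prod.mk.injEq] at h ⊢
    exact ⟨h.2, h.1⟩
  · rintro ⟨a, b⟩ hp
    rw [mem_adjPairs] at hp
    exact ⟨(b, a), mem_adjPairs.2 ⟨hp.1.symm, hp.2⟩, rfl⟩

lemma card_adjPairs_center (cen : ℕ → ℕ) :
    (adjPairs G (fun u v => cen u = v + 1)).card ≤ n := by
  conv_rhs => rw [← Finset.card_range n]
  refine Finset.card_le_card_of_injOn (fun p => p.1) ?_ ?_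
  · intro p hp
    exact Finset.mem_coe.2 (Finset.mem_range.2 (mem_adjPairs.1 (Finset.mem_coe.1 hp)).1.1)
  · rintro ⟨a, b⟩ hp ⟨a', b'⟩ hp' h
    have h1 := (mem_adjPairs.1 (Finset.mem_coe.1 hp)).2
    have h2 := (mem_adjPairs.1 (Finset.mem_coe.1 hp')).2
    simp only at h h1 h2
    subst h
    simp only [Prod.mk.injEq, true_and]
    omega

open Classical in
lemma card_adjPairs_edgeCount (L : AdjacencyList G) (cen : ℕ → ℕ) (c k c' : ℕ) :
    (adjPairs G (fun u v => cen u = c ∧ (L.degAt u).size = k ∧ cen v = c')).card =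
      edgeCount L cen c k c' := by
  obtain ⟨f, hf⟩ : ∃ f : ℕ → ℕ → Prop,
    ∀ u v, f u v ↔ cen u = c ∧ (L.degAt u).size = k ∧ cen v = c' := ⟨_, fun _ _ => Iff.rfl⟩
  simp only [← hf]
  rw [card_adjPairs (L := L), edgeCount]
  refine Finset.sum_congr rfl fun u _ => ?_
  by_cases h : cen u = c ∧ (L.degAt u).size = k
  · rw [if_pos h]
    exact congrArg _ (Finset.filter_congr fun j _ => by rw [hf]; tauto)
  · rw [if_neg h, Finset.card_eq_zero, Finset.filter_eq_empty_iff]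
    intro j _ hj
    rw [hf] at hj
    exact h ⟨hj.1, hj.2.1⟩

/-- Level 0 is missing because a vertex with a neighbour has positive degree. -/
lemma card_adjPairs_sum_level (L : AdjacencyList G) (f : ℕ → ℕ → Prop) :
    (adjPairs G f).card =
      ∑ j ∈ Finset.range n.size,
        (adjPairs G (fun u v => (L.degAt u).size = j + 1 ∧ f u v)).card := by
  classical
  rw [Finset.card_eq_sum_card_fiberwise (f := fun p => (L.degAt p.1).size - 1)
    (t := Finset.range n.size)]
  · refine Finset.sum_congr rfl fun j _ => congrArg _ ?_
    ext p
    rw [Finset.mem_filter, mem_adjPairs, mem_adjPairs]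
    constructor
    · rintro ⟨⟨h1, h2⟩, h3⟩
      obtain ⟨i, hi, -⟩ := h1.exists_index (L := L)
      have : 0 < (L.degAt p.1).size := Nat.size_pos.2 (by omega)
      exact ⟨h1, by omega, h2⟩
    · rintro ⟨h1, h2, h3⟩
      exact ⟨⟨h1, h3⟩, by omega⟩
  · intro p hp
    have h1 := (mem_adjPairs.1 (Finset.mem_coe.1 hp)).1
    obtain ⟨i, hi, -⟩ := h1.exists_index (L := L)
    have h2 : 0 < (L.degAt p.1).size := Nat.size_pos.2 (by omega)
    have h3 : (L.degAt p.1).size ≤ n.size := Nat.size_le_size (degAt_le L _)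
    simp only [Finset.coe_range, Set.mem_Iio]
    omega

lemma pow_le_of_size_eq {a j : ℕ} (h : a.size = j + 1) : 2 ^ j ≤ a ∧ a < 2 ^ (j + 1) :=
  ⟨Nat.lt_size.1 (by omega), Nat.size_le.1 h.le⟩

/-! ### Counting the kept edges by level and by pair of centers. -/

namespace Output

variable {K r d : ℕ} {m : ℕ → ℕ}

open Classical in
/-- The centers of rank small enough to serve a vertex of degree `y`. -/
noncomputable def centers (n K : ℕ) (m : ℕ → ℕ) (y : ℕ) : Finset ℕ :=
  ((Finset.range n).filter (fun b => m (8 * b + 1) * y ≤ n * (K * n.size))).image Nat.succ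

lemma card_centers (h : Output L K r d m) {y : ℕ} (h1 : 1 ≤ y) (h2 : y ≤ n) :
    (centers n K m y).card * y ≤ 5 * (n * (K * n.size)) := by
  classical
  refine (Nat.mul_le_mul_right _ Finset.card_image_le).trans ?_
  convert h.ranks.few y h1 h2

lemma mem_centers (h : Output L K r d m) {u y : ℕ} (hu : m (8 * u + 3) ≠ 0) (hy : y ≤ L.degAt u) :
    m (8 * u + 3) ∈ centers n K m y := by
  classical
  rcases h.sound u with h0 | ⟨w, hw, hvw, -, hq⟩
  · exact absurd h0 hu
  · simp only at hw hq
    rw [hw]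
    refine Finset.mem_image_of_mem _ (Finset.mem_filter.2 ⟨Finset.mem_range.2 hvw.2.1, ?_⟩)
    exact (Nat.mul_le_mul_left _ hy).trans hq

lemma heavy_of_center (h : Output L K r d m) {u : ℕ} (hu : m (8 * u + 3) ≠ 0) : Heavy L u := by
  rcases h.sound u with h0 | ⟨w, hw, hvw, hh, -⟩
  · exact absurd h0 hu
  · exact hh

/-- The number of centers counted at one level. -/
lemma card_centers_mul (h : Output L K r d m) {j y : ℕ} (hj : 2 ^ j ≤ n) (h1 : 1 ≤ y)
    (h2 : y ≤ n) :
    2 ^ (j + 1) * ((centers n K m (2 ^ j)).card * (centers n K m y).card) * y ≤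
      50 * (n * (K * n.size)) ^ 2 := by
  have e1 := h.card_centers (Nat.one_le_two_pow (n := j)) hj
  have e2 := h.card_centers h1 h2
  calc _ = 2 * (((centers n K m (2 ^ j)).card * 2 ^ j) * ((centers n K m y).card * y)) := by ring
    _ ≤ 2 * ((5 * (n * (K * n.size))) * (5 * (n * (K * n.size)))) := by gcongr
    _ = _ := by ring

/-- All pairs counted here share one cell. If there is any such pair, then the cell is empty, and
the sampling guarantee bounds the number of edges that it represents. -/
lemma fiber_mul_le (h : Output L K r d m) {j c c' : ℕ} :
    ((adjPairs G (fun u v => (L.degAt u).size = j + 1 ∧ (m (8 * u + 3) ≠ 0 ∧ m (8 * v + 3) ≠ 0 ∧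
      m (8 * pairIndex n m u v + 4) = 0))).filter
        (fun p => (m (8 * p.1 + 3), m (8 * p.2 + 3)) = (c, c'))).card * r ≤ 2 ^ (j + 1) := by
  classical
  rcases Finset.eq_empty_or_nonempty ((adjPairs G (fun u v => (L.degAt u).size = j + 1 ∧
      (m (8 * u + 3) ≠ 0 ∧ m (8 * v + 3) ≠ 0 ∧ m (8 * pairIndex n m u v + 4) = 0))).filter
        (fun p => (m (8 * p.1 + 3), m (8 * p.2 + 3)) = (c, c'))) with h0 | ⟨⟨u, v⟩, hp⟩
  · rw [h0]; simp
  · rw [Finset.mem_filter, mem_adjPairs] at hp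
    obtain ⟨⟨hadj, hsz, hu, hv, ht⟩, hc⟩ := hp
    simp only [Prod.mk.injEq] at hc hadj hsz hu hv ht
    obtain ⟨hc, hc'⟩ := hc
    have h6 := h.six u hadj.1
    rw [pairIndex, h6, hsz, hc, hc'] at ht
    have hk : j + 1 ≤ n := by
      rw [← hsz]; exact (size_le_self _).trans (degAt_le L u)
    have hd := h.dense c c' (j + 1) (by rw [← hc]; exact hu) (by rw [← hc]; exact h.cen_le _)
      (by rw [← hc']; exact hv) (by rw [← hc']; exact h.cen_le _) hk ht
    refine (Nat.mul_le_mul_right _ ?_).trans hd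
    rw [← card_adjPairs_edgeCount]
    refine Finset.card_le_card fun p hp => ?_
    rw [Finset.mem_filter, mem_adjPairs] at hp
    rw [mem_adjPairs]
    simp only [Prod.mk.injEq] at hp
    exact ⟨hp.1.1, hp.2.1, hp.1.2.1, hp.2.2⟩

/-- At level j + 1 the first center serves a degree of at least 2^j and the second a heavy degree,
at least y. The factor 2^{j+1} / r of an empty cell cancels the 2^j in the number of first centers,
so every level contributes the same bound. -/
lemma card_sparse (h : Output L K r d m) {y : ℕ} (h1 : 1 ≤ y) (h2 : y ≤ n)
    (hy : ∀ v < n, Heavy L v → y ≤ L.degAt v) :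
    r * y * (adjPairs G (fun u v => m (8 * u + 3) ≠ 0 ∧ m (8 * v + 3) ≠ 0 ∧
      m (8 * pairIndex n m u v + 4) = 0)).card ≤ n.size * (50 * (n * (K * n.size)) ^ 2) := by
  classical
  rw [card_adjPairs_sum_level L, Finset.mul_sum]
  conv_rhs => rw [← Finset.card_range n.size, ← smul_eq_mul, ← Finset.sum_const]
  refine Finset.sum_le_sum fun j _ => ?_
  rw [Finset.card_range]
  rcases Finset.eq_empty_or_nonempty (adjPairs G (fun u v => (L.degAt u).size = j + 1 ∧
      (m (8 * u + 3) ≠ 0 ∧ m (8 * v + 3) ≠ 0 ∧ m (8 * pairIndex n m u v + 4) = 0)))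
    with h0 | ⟨q, hq⟩
  · rw [h0]; simp
  have hj : 2 ^ j ≤ n :=
    (pow_le_of_size_eq (mem_adjPairs.1 hq).2.1).1.trans (degAt_le L _)
  rw [Finset.card_eq_sum_card_fiberwise (f := fun p => (m (8 * p.1 + 3), m (8 * p.2 + 3)))
    (t := centers n K m (2 ^ j) ×ˢ centers n K m y)]
  · calc _ = (∑ b ∈ centers n K m (2 ^ j) ×ˢ centers n K m y, _ * r) * y := by
          rw [← Finset.sum_mul]; ring
      _ ≤ (∑ b ∈ centers n K m (2 ^ j) ×ˢ centers n K m y, 2 ^ (j + 1)) * y := by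
          gcongr with b
          exact h.fiber_mul_le
      _ = 2 ^ (j + 1) * ((centers n K m (2 ^ j)).card * (centers n K m y).card) * y := by
          rw [Finset.sum_const, Finset.card_product, smul_eq_mul]; ring
      _ ≤ _ := h.card_centers_mul hj h1 h2
  · intro p hp
    obtain ⟨hadj, hsz, hu, hv, -⟩ := mem_adjPairs.1 (Finset.mem_coe.1 hp)
    exact Finset.mem_coe.2 (Finset.mem_product.2 ⟨h.mem_centers hu (pow_le_of_size_eq hsz).1,
      h.mem_centers hv (hy _ hadj.2.1 (h.heavy_of_center hv))⟩)

/-- A cell holds one code, so on one level a kept pair is determined by its two centers. -/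
lemma card_dense (h : Output L K r d m) {y : ℕ} (h1 : 1 ≤ y) (h2 : y ≤ n)
    (hy : ∀ v < n, Heavy L v → y ≤ L.degAt v) :
    y ^ 2 * (adjPairs G (fun u v => m (8 * u + 3) ≠ 0 ∧ m (8 * v + 3) ≠ 0 ∧
      m (8 * pairIndex n m u v + 4) = pairCode n u v)).card ≤
        n.size * (50 * (n * (K * n.size)) ^ 2) := by
  classical
  rw [card_adjPairs_sum_level L, Finset.mul_sum]
  conv_rhs => rw [← Finset.card_range n.size, ← smul_eq_mul, ← Finset.sum_const]
  refine Finset.sum_le_sum fun j _ => ?_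
  rw [Finset.card_range]
  rcases Finset.eq_empty_or_nonempty (adjPairs G (fun u v => (L.degAt u).size = j + 1 ∧
      (m (8 * u + 3) ≠ 0 ∧ m (8 * v + 3) ≠ 0 ∧
        m (8 * pairIndex n m u v + 4) = pairCode n u v))) with h0 | ⟨q, hq⟩
  · rw [h0]; simp
  obtain ⟨hadj, hsz, hu, -, -⟩ := mem_adjPairs.1 hq
  have hj : 2 ^ j ≤ n := (pow_le_of_size_eq hsz).1.trans (degAt_le L _)
  -- A nonempty level contains a heavy vertex, so y is at most 2^{j+1}; one factor y is traded for
  -- 2^{j+1} to reuse the count of centers.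
  have hyj : y ≤ 2 ^ (j + 1) :=
    (hy _ hadj.1 (h.heavy_of_center hu)).trans (pow_le_of_size_eq hsz).2.le
  have hcard : (adjPairs G (fun u v => (L.degAt u).size = j + 1 ∧ (m (8 * u + 3) ≠ 0 ∧
      m (8 * v + 3) ≠ 0 ∧ m (8 * pairIndex n m u v + 4) = pairCode n u v))).card ≤
      (centers n K m (2 ^ j)).card * (centers n K m y).card := by
    rw [← Finset.card_product]
    refine Finset.card_le_card_of_injOn (fun p => (m (8 * p.1 + 3), m (8 * p.2 + 3))) ?_ ?_
    · intro p hp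
      obtain ⟨hadj, hsz, hu, hv, -⟩ := mem_adjPairs.1 (Finset.mem_coe.1 hp)
      exact Finset.mem_coe.2 (Finset.mem_product.2 ⟨h.mem_centers hu (pow_le_of_size_eq hsz).1,
        h.mem_centers hv (hy _ hadj.2.1 (h.heavy_of_center hv))⟩)
    · rintro ⟨u, v⟩ hp ⟨u', v'⟩ hp' he
      obtain ⟨hadj, hsz, -, -, hc⟩ := mem_adjPairs.1 (Finset.mem_coe.1 hp)
      obtain ⟨hadj', hsz', -, -, hc'⟩ := mem_adjPairs.1 (Finset.mem_coe.1 hp')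
      simp only [Prod.mk.injEq] at he hadj hsz hc hadj' hsz' hc' ⊢
      have hi : pairIndex n m u v = pairIndex n m u' v' := by
        rw [pairIndex, pairIndex, he.1, he.2, h.six u hadj.1, h.six u' hadj'.1, hsz, hsz']
      rw [hi, hc'] at hc
      unfold pairCode at hc
      obtain ⟨e1, e2⟩ := mul_succ_add_inj (N := n) (a := u') (b := v') (a' := u) (b' := v)
        hadj'.2.1.le hadj.2.1.le (by omega)
      exact ⟨e1.symm, e2.symm⟩
  calc _ ≤ y ^ 2 * ((centers n K m (2 ^ j)).card * (centers n K m y).card) :=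
        Nat.mul_le_mul_left _ hcard
    _ = y * ((centers n K m (2 ^ j)).card * (centers n K m y).card) * y := by ring
    _ ≤ 2 ^ (j + 1) * ((centers n K m (2 ^ j)).card * (centers n K m y).card) * y := by gcongr
    _ ≤ _ := h.card_centers_mul hj h1 h2

lemma ncard_edgeSet_le (f : ℕ → ℕ → Prop) {H : SimpleGraph (Fin n)}
    (h : ∀ u v, H.Adj u v → G.Adj u v ∧ (f u v ∨ f v u)) :
    H.edgeSet.ncard ≤ (adjPairs G f).card := by
  classical
  rcases Nat.eq_zero_or_pos n with rfl | hn
  · have : H.edgeSet = ∅ := by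
      ext e
      induction e using Sym2.ind with
      | _ u v => exact u.elim0
    simp [this]
  let g : ℕ × ℕ → Sym2 (Fin n) := fun p =>
    s(⟨p.1 % n, Nat.mod_lt _ hn⟩, ⟨p.2 % n, Nat.mod_lt _ hn⟩)
  have hsub : H.edgeSet ⊆ ((adjPairs G f).image g : Finset (Sym2 (Fin n))) := by
    intro e he
    induction e using Sym2.ind with
    | _ u v =>
      rw [SimpleGraph.mem_edgeSet] at he
      rw [Finset.mem_coe, Finset.mem_image]
      obtain ⟨h1, h2 | h2⟩ := h u v he
      · refine ⟨(u, v), mem_adjPairs.2 ⟨⟨u.2, v.2, h1⟩, h2⟩, ?_⟩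
        simp [g, Nat.mod_eq_of_lt u.2, Nat.mod_eq_of_lt v.2]
      · refine ⟨(v, u), mem_adjPairs.2 ⟨⟨v.2, u.2, h1.symm⟩, h2⟩, ?_⟩
        simp [g, Nat.mod_eq_of_lt u.2, Nat.mod_eq_of_lt v.2, Sym2.eq_swap]
  refine (Set.ncard_le_ncard hsub (Finset.finite_toSet _)).trans ?_
  rw [Set.ncard_coe_finset]
  exact Finset.card_image_le

/-- A pair with an end that lacks a center has a light end, on the left or on the right, whence
twice the light sum. Edges to centers number at most n, one for each vertex; `a` counts the
remaining pairs with an empty cell and `b` those that own their cell. -/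
lemma ncard_spanner_le (h : Output L K r d m) {y : ℕ} (h1 : 1 ≤ y) (h2 : y ≤ n)
    (hy : ∀ v < n, Heavy L v → y ≤ L.degAt v) :
    ∃ a b : ℕ, (spanner G m).edgeSet.ncard ≤ 2 * lightSum L + n + a + b ∧
      r * y * a ≤ n.size * (50 * (n * (K * n.size)) ^ 2) ∧
      y ^ 2 * b ≤ n.size * (50 * (n * (K * n.size)) ^ 2) := by
  classical
  refine ⟨_, _, ?_, h.card_sparse h1 h2 hy, h.card_dense h1 h2 hy⟩
  refine (ncard_edgeSet_le (G := G) (Keep n m) fun u v h => h).trans ?_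
  have hsub : adjPairs G (Keep n m) ⊆ adjPairs G (fun u _ => ¬ Heavy L u) ∪
      adjPairs G (fun _ v => ¬ Heavy L v) ∪ adjPairs G (fun u v => m (8 * u + 3) = v + 1) ∪
      adjPairs G (fun u v => m (8 * u + 3) ≠ 0 ∧ m (8 * v + 3) ≠ 0 ∧
        m (8 * pairIndex n m u v + 4) = 0) ∪
      adjPairs G (fun u v => m (8 * u + 3) ≠ 0 ∧ m (8 * v + 3) ≠ 0 ∧
        m (8 * pairIndex n m u v + 4) = pairCode n u v) := by
    intro p hp
    simp only [Finset.mem_union, mem_adjPairs] at hp ⊢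
    obtain ⟨hadj, hK⟩ := hp
    by_cases hu : m (8 * p.1 + 3) = 0
    · exact Or.inl (Or.inl (Or.inl (Or.inl ⟨hadj, fun hh => h.complete _ hadj.1 hh hu⟩)))
    by_cases hv : m (8 * p.2 + 3) = 0
    · exact Or.inl (Or.inl (Or.inl (Or.inr ⟨hadj, fun hh => h.complete _ hadj.2.1 hh hv⟩)))
    rcases hK with hK | hK | hK | hK
    · exact absurd hK hu
    · exact Or.inl (Or.inl (Or.inr ⟨hadj, hK⟩))
    · exact Or.inl (Or.inr ⟨hadj, hu, hv, hK⟩)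
    · exact Or.inr ⟨hadj, hu, hv, hK⟩
  refine (Finset.card_le_card hsub).trans ?_
  refine (Finset.card_union_le _ _).trans (Nat.add_le_add_right ?_ _)
  refine (Finset.card_union_le _ _).trans (Nat.add_le_add_right ?_ _)
  refine (Finset.card_union_le _ _).trans (Nat.add_le_add ?_ (card_adjPairs_center _))
  refine (Finset.card_union_le _ _).trans ?_
  rw [card_adjPairs_left L, card_adjPairs_right L]
  omega

end Output

/-! ### Bounds in terms of the average and the minimum degree -/

lemma degAt_eq_degree (L : AdjacencyList G) (v : Fin n) [Fintype (G.neighborSet v)] :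
    L.degAt v = G.degree v := by
  classical
  have h : G.neighborFinset v = (L.nbrs v).toFinset := by
    ext w
    rw [SimpleGraph.mem_neighborFinset, List.mem_toFinset, L.mem_iff]
  rw [← SimpleGraph.card_neighborFinset_eq_degree, h, List.toFinset_card_of_nodup (L.nodup v)]
  simp [AdjacencyList.degAt, v.2]

open Classical in
lemma degSum_eq (L : AdjacencyList G) (hn : 0 < n) : (degSum L : ℝ) = n * avgDegree G := by
  have hnR : (n : ℝ) ≠ 0 := by exact_mod_cast hn.ne'
  rw [avgDegree, mul_div_cancel₀ _ hnR, degSum, Finset.sum_range]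
  push_cast
  exact Finset.sum_congr rfl fun v _ => congrArg _ (degAt_eq_degree L v)

lemma avgDegree_nonneg : 0 ≤ avgDegree G := by
  unfold avgDegree; positivity

lemma avgDegree_le (L : AdjacencyList G) (hn : 0 < n) : avgDegree G ≤ n := by
  have hnR : (0 : ℝ) < n := by exact_mod_cast hn
  have h1 := degSum_eq L hn
  have h2 : (degSum L : ℝ) ≤ n * n := by exact_mod_cast degSum_le L
  rw [h1] at h2
  exact le_of_mul_le_mul_left h2 hnR

lemma rpow_third_pow (n : ℕ) : ((n : ℝ) ^ (1 / 3 : ℝ)) ^ 3 = n := by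
  rw [← Real.rpow_natCast, ← Real.rpow_mul (Nat.cast_nonneg n)]
  norm_num

lemma one_le_degreeFloor (hn : 0 < n) : 1 ≤ degreeFloor G := by
  refine le_trans ?_ (le_max_right _ _)
  exact Real.one_le_rpow (by exact_mod_cast hn) (by norm_num)

lemma minDegree_le_degAt (L : AdjacencyList G) [DecidableRel G.Adj] {v : ℕ} (hv : v < n) :
    G.minDegree ≤ L.degAt v := by
  rw [show L.degAt v = L.degAt ((⟨v, hv⟩ : Fin n) : ℕ) from rfl, degAt_eq_degree]
  exact G.minDegree_le_degree _

open Classical in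
lemma degreeFloor_le (L : AdjacencyList G) (hn : 0 < n) : degreeFloor G ≤ n := by
  refine max_le ?_ ?_
  · exact_mod_cast (minDegree_le_degAt L hn).trans (degAt_le L 0)
  · refine (Real.rpow_le_rpow_of_exponent_le (by exact_mod_cast hn)
      (by norm_num : (1 / 3 : ℝ) ≤ 1)).trans (by rw [Real.rpow_one])

open Classical in
lemma Heavy.degreeFloor_le {v : ℕ} (hv : v < n) (h : Heavy L v) :
    degreeFloor G ≤ L.degAt v := by
  refine max_le (by exact_mod_cast minDegree_le_degAt L hv) ?_
  refine le_of_pow_le_pow_left₀ (by norm_num : (3 : ℕ) ≠ 0) (by positivity) ?_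
  rw [rpow_third_pow]
  unfold Heavy at h
  have : (n : ℝ) ≤ L.degAt v * L.degAt v * L.degAt v := by exact_mod_cast h
  linarith [this, pow_succ (L.degAt v : ℝ) 2, sq (L.degAt v : ℝ)]

/-- If a light vertex exists, the minimum degree is at most n^{1/3}, so δ = n^{1/3} and the light
sum is at most n · n^{1/3} = n² / δ². Otherwise the sum is empty. -/
lemma lightSum_mul_le (L : AdjacencyList G) (hn : 0 < n) :
    (lightSum L : ℝ) * degreeFloor G ^ 2 ≤ (n : ℝ) ^ 2 := by
  classical
  by_cases hex : ∃ v < n, ¬ Heavy L v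
  · obtain ⟨v, hv, hl⟩ := hex
    have hx : (0 : ℝ) ≤ (n : ℝ) ^ (1 / 3 : ℝ) := by positivity
    have hlt : ∀ u, ¬ Heavy L u → (L.degAt u : ℝ) ≤ (n : ℝ) ^ (1 / 3 : ℝ) := by
      intro u hu
      unfold Heavy at hu
      have h1 : (L.degAt u * L.degAt u * L.degAt u : ℝ) ≤ n := by exact_mod_cast (not_le.1 hu).le
      refine le_of_pow_le_pow_left₀ (by norm_num : (3 : ℕ) ≠ 0) hx ?_
      rw [rpow_third_pow]
      linarith [pow_succ (L.degAt u : ℝ) 2, sq (L.degAt u : ℝ)]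
    have hδ : degreeFloor G = (n : ℝ) ^ (1 / 3 : ℝ) :=
      max_eq_right (le_trans (by exact_mod_cast minDegree_le_degAt L hv) (hlt v hl))
    have hsum : (lightSum L : ℝ) ≤ n * (n : ℝ) ^ (1 / 3 : ℝ) := by
      rw [lightSum]
      push_cast
      refine (Finset.sum_le_card_nsmul _ _ _ fun u hu => hlt u (Finset.mem_filter.1 hu).2).trans ?_
      rw [nsmul_eq_mul]
      refine mul_le_mul_of_nonneg_right ?_ hx
      exact_mod_cast (Finset.card_filter_le _ _).trans_eq (Finset.card_range n)
    rw [hδ]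
    calc _ ≤ n * (n : ℝ) ^ (1 / 3 : ℝ) * ((n : ℝ) ^ (1 / 3 : ℝ)) ^ 2 := by gcongr
      _ = n * ((n : ℝ) ^ (1 / 3 : ℝ)) ^ 3 := by ring
      _ = _ := by rw [rpow_third_pow]; ring
  · push Not at hex
    have : lightSum L = 0 := by
      rw [lightSum]
      refine Finset.sum_eq_zero fun u hu => ?_
      rw [Finset.mem_filter, Finset.mem_range] at hu
      exact absurd (hex u hu.1) hu.2
    rw [this]
    simp only [Nat.cast_zero, zero_mul]
    positivity

/-! ### Edge count and scanning time in terms of D and δ. -/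

/-- The number of edges of the spanner. -/
lemma Output.ncard_spanner_le_real {K r d : ℕ} {m : ℕ → ℕ} (hn : 0 < n) (hK : 0 < K) (hr : 1 ≤ r)
    (h : Output L K (min r n) d m) :
    ((spanner G m).edgeSet.ncard : ℝ) ≤ 100 * K ^ 2 * n.size ^ 3 *
      ((n : ℝ) ^ 2 / (r * degreeFloor G) + (n : ℝ) ^ 2 / degreeFloor G ^ 2 + n) := by
  have hδ1 : 1 ≤ degreeFloor G := one_le_degreeFloor hn
  have hδ0 : 0 < degreeFloor G := by linarith
  have hy : ∀ v < n, Heavy L v → ⌈degreeFloor G⌉₊ ≤ L.degAt v :=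
    fun v hv hh => Nat.ceil_le.2 (hh.degreeFloor_le hv)
  -- Degrees are integers, so heavy degrees are at least δ rounded up.
  obtain ⟨a, b, hab, ha, hb⟩ := h.ncard_spanner_le (Nat.one_le_ceil_iff.2 hδ0)
    (Nat.ceil_le.2 (degreeFloor_le L hn)) hy
  have hδy : degreeFloor G ≤ (⌈degreeFloor G⌉₊ : ℝ) := Nat.le_ceil _
  generalize ⌈degreeFloor G⌉₊ = y at *
  have hlight := lightSum_mul_le L hn
  generalize degreeFloor G = δ at *
  have hnR : (0 : ℝ) < n := by exact_mod_cast hn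
  have hrR : (1 : ℝ) ≤ r := by exact_mod_cast hr
  have hKR : (1 : ℝ) ≤ K := by exact_mod_cast hK
  have hSR : (1 : ℝ) ≤ n.size := by exact_mod_cast Nat.size_pos.2 hn
  have haR : ((min r n : ℕ) : ℝ) * y * a ≤ n.size * (50 * (n * (K * n.size)) ^ 2) := by
    exact_mod_cast ha
  have hbR : (y : ℝ) ^ 2 * b ≤ n.size * (50 * (n * (K * n.size)) ^ 2) := by exact_mod_cast hb
  have habR : ((spanner G m).edgeSet.ncard : ℝ) ≤ 2 * lightSum L + n + a + b := by
    exact_mod_cast hab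
  generalize (n.size : ℝ) = S at *
  generalize (lightSum L : ℝ) = l at *
  have hM : 1 ≤ (K : ℝ) ^ 2 * S ^ 3 :=
    one_le_mul_of_one_le_of_one_le (one_le_pow₀ hKR) (one_le_pow₀ hSR)
  obtain ⟨M, hMdef⟩ : ∃ M, M = (K : ℝ) ^ 2 * S ^ 3 := ⟨_, rfl⟩
  rw [← hMdef] at hM
  have hl : l ≤ (n : ℝ) ^ 2 / δ ^ 2 := (le_div_iff₀ (by positivity)).2 hlight
  have hb' : (b : ℝ) ≤ 50 * M * ((n : ℝ) ^ 2 / δ ^ 2) := by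
    rw [← mul_div_assoc, le_div_iff₀ (by positivity)]
    calc (b : ℝ) * δ ^ 2 ≤ b * (y : ℝ) ^ 2 := by gcongr
      _ = (y : ℝ) ^ 2 * b := by ring
      _ ≤ _ := hbR
      _ = _ := by rw [hMdef]; ring
  -- The program works with min(r, n). When r exceeds n the estimate becomes n² / (nδ) ≤ n, which
  -- the additive term n absorbs.
  have ha' : (a : ℝ) ≤ 50 * M * ((n : ℝ) ^ 2 / (r * δ) + n) := by
    have hcase : (a : ℝ) * (((min r n : ℕ) : ℝ) * δ) ≤ 50 * M * (n : ℝ) ^ 2 := by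
      calc (a : ℝ) * (((min r n : ℕ) : ℝ) * δ) ≤ a * (((min r n : ℕ) : ℝ) * y) := by gcongr
        _ = ((min r n : ℕ) : ℝ) * y * a := by ring
        _ ≤ _ := haR
        _ = _ := by rw [hMdef]; ring
    have hq : 0 ≤ (n : ℝ) ^ 2 / (r * δ) := by positivity
    rcases le_total r n with hrn | hrn
    · rw [min_eq_left hrn] at hcase
      have h1 : (a : ℝ) ≤ 50 * M * (n : ℝ) ^ 2 / (r * δ) :=
        (le_div_iff₀ (by positivity)).2 hcase
      rw [mul_div_assoc] at h1
      refine h1.trans ?_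
      gcongr
      linarith
    · rw [min_eq_right hrn] at hcase
      have h1 : (a : ℝ) * n ≤ 50 * M * n * n := by
        calc (a : ℝ) * n ≤ a * (n * δ) := by
              gcongr; nlinarith
          _ ≤ _ := hcase
          _ = _ := by ring
      have h2 := le_of_mul_le_mul_right h1 hnR
      refine h2.trans ?_
      gcongr
      linarith
  have q1 : 0 ≤ (n : ℝ) ^ 2 / (r * δ) := by positivity
  have q2 : 0 ≤ (n : ℝ) ^ 2 / δ ^ 2 := by positivity
  generalize (n : ℝ) ^ 2 / (r * δ) = x at *
  generalize (n : ℝ) ^ 2 / δ ^ 2 = z at *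
  have e1 : z ≤ M * z := le_mul_of_one_le_left q2 hM
  have e2 : (n : ℝ) ≤ M * n := le_mul_of_one_le_left hnR.le hM
  have e3 : 0 ≤ M * x := by positivity
  calc _ ≤ 2 * z + n + 50 * M * (x + n) + 50 * M * z := by linarith
    _ ≤ 100 * M * (x + z + n) := by nlinarith
    _ = _ := by rw [hMdef]; ring

-- Low heavy vertices have degree between δ and √D, hence at most √D ≤ D/δ. For vertices of small
-- rank the expected total degree is about lnD / d, and d ≥ max(δ, √D) turns D / d into the minimum.
open Classical in
lemma sum_scanned_le {l d : ℕ} {R : ℕ → ℕ} (hn : 0 < n) (hl : 0 < l) (hd : IsLeastHigh L d)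
    (hR : GoodRanks L l d R) :
    ((∑ v ∈ Finset.range n with Scanned L (n * l) d R v, L.degAt v : ℕ) : ℝ) ≤
      3 * l * (n * min (avgDegree G / degreeFloor G) (Real.sqrt (avgDegree G))) + 5 * (n * l) := by
  have hnR : (0 : ℝ) < n := by exact_mod_cast hn
  have hlR : (1 : ℝ) ≤ l := by exact_mod_cast hl
  have hdpos : 0 < d := hd.pos hn
  have hdR : (0 : ℝ) < d := by exact_mod_cast hdpos
  have hδ1 : 1 ≤ degreeFloor G := one_le_degreeFloor hn
  have hM := degSum_eq L hn
  have hD0 : 0 ≤ avgDegree G := avgDegree_nonneg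
  have hMn : (degSum L : ℝ) ≤ n * n := by exact_mod_cast degSum_le L
  have hsq := Real.mul_self_sqrt hD0
  have hs0 := Real.sqrt_nonneg (avgDegree G)
  have hsplit : ∑ v ∈ Finset.range n with Scanned L (n * l) d R v, L.degAt v ≤
      (∑ v ∈ Finset.range n with Heavy L v ∧ ¬ High L v, L.degAt v) +
        ∑ v ∈ Finset.range n with R v * d ≤ n * l, L.degAt v := by
    rw [← Finset.sum_union_inter, ← Finset.filter_or]
    refine le_trans (le_of_eq ?_) (Nat.le_add_right _ _)
    exact Finset.sum_congr (Finset.filter_congr fun v _ => Iff.rfl) fun _ _ => rfl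
  have hwork := hR.work
  -- The default d = n, when no vertex is heavy and high, is harmless: the degree sum is at most n²,
  -- so the work is O(nl).
  have hdle : d = n ∨ (degreeFloor G ≤ d ∧ Real.sqrt (avgDegree G) ≤ d) := by
    rcases hd.2 with h | ⟨v, hv, hh, hg, rfl⟩
    · exact Or.inl h
    · refine Or.inr ⟨hh.degreeFloor_le hv, Real.sqrt_le_left (Nat.cast_nonneg _) |>.2 ?_⟩
      have h1 : (degSum L : ℝ) ≤ L.degAt v * L.degAt v * n := by
        unfold High at hg; exact_mod_cast hg
      rw [hM, mul_comm] at h1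
      rw [sq]
      exact le_of_mul_le_mul_right h1 hnR
  have hX1 : ((∑ v ∈ Finset.range n with Heavy L v ∧ ¬ High L v, L.degAt v : ℕ) : ℝ) ≤
      n * min (avgDegree G / degreeFloor G) (Real.sqrt (avgDegree G)) := by
    have key : ∀ v < n, Heavy L v → ¬ High L v → (L.degAt v : ℝ) ≤
        min (avgDegree G / degreeFloor G) (Real.sqrt (avgDegree G)) := by
      intro v hv hh hg
      have h1 := hh.degreeFloor_le hv
      have h2 : (L.degAt v : ℝ) ≤ Real.sqrt (avgDegree G) := by
        refine Real.le_sqrt_of_sq_le ?_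
        have h3 : (L.degAt v * L.degAt v * n : ℝ) ≤ degSum L := by
          unfold High at hg; exact_mod_cast (not_le.1 hg).le
        rw [hM, mul_comm (n : ℝ)] at h3
        rw [sq]
        exact le_of_mul_le_mul_right h3 hnR
      refine le_min ?_ h2
      rw [le_div_iff₀ (by linarith), ← hsq]
      exact mul_le_mul h2 (h1.trans h2) (by linarith) hs0
    push_cast
    have hmin : 0 ≤ min (avgDegree G / degreeFloor G) (Real.sqrt (avgDegree G)) :=
      le_min (div_nonneg hD0 (by linarith)) hs0
    refine (Finset.sum_le_card_nsmul _ _ _ fun u hu => ?_).trans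
      (?_ : _ • (min (avgDegree G / degreeFloor G) (Real.sqrt (avgDegree G))) ≤ _)
    · rw [Finset.mem_filter, Finset.mem_range] at hu
      exact key u hu.1 hu.2.1 hu.2.2
    · rw [nsmul_eq_mul]
      refine mul_le_mul_of_nonneg_right ?_ hmin
      exact_mod_cast (Finset.card_filter_le _ _).trans_eq (Finset.card_range n)
  have hX2 : ((∑ v ∈ Finset.range n with R v * d ≤ n * l, L.degAt v : ℕ) : ℝ) ≤
      2 * l * (n * min (avgDegree G / degreeFloor G) (Real.sqrt (avgDegree G))) +
        5 * (n * l) := by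
    have hw : ((∑ v ∈ Finset.range n with R v * d ≤ n * l, L.degAt v : ℕ) : ℝ) * d ≤
        2 * l * degSum L + 3 * (n * l * d) := by exact_mod_cast hwork
    generalize ((∑ v ∈ Finset.range n with R v * d ≤ n * l, L.degAt v : ℕ) : ℝ) = X at *
    have hmin : 0 ≤ min (avgDegree G / degreeFloor G) (Real.sqrt (avgDegree G)) :=
      le_min (div_nonneg hD0 (by linarith)) hs0
    refine le_of_mul_le_mul_right (hw.trans ?_) hdR
    rcases hdle with h | ⟨h1, h2⟩
    · have : 2 * l * (degSum L : ℝ) ≤ 2 * l * (n * n) := by gcongr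
      have hp : 0 ≤ 2 * (l : ℝ) * (n * min (avgDegree G / degreeFloor G)
        (Real.sqrt (avgDegree G))) * d := by positivity
      rw [h] at hp ⊢
      nlinarith
    · have hDd : avgDegree G ≤
          min (avgDegree G / degreeFloor G) (Real.sqrt (avgDegree G)) * d := by
        rw [min_mul_of_nonneg _ _ hdR.le]
        refine le_min ?_ ?_
        · rw [div_mul_eq_mul_div, le_div_iff₀ (by linarith)]
          gcongr
        · conv_lhs => rw [← hsq]
          gcongr
      rw [hM]
      have h3 : 2 * (l : ℝ) * (n * avgDegree G) ≤ 2 * l * (n *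
          (min (avgDegree G / degreeFloor G) (Real.sqrt (avgDegree G)) * d)) := by gcongr
      have h4 : 0 ≤ (n : ℝ) * l * d := by positivity
      nlinarith
  have hsplitR : ((∑ v ∈ Finset.range n with Scanned L (n * l) d R v, L.degAt v : ℕ) : ℝ) ≤
      ((∑ v ∈ Finset.range n with Heavy L v ∧ ¬ High L v, L.degAt v : ℕ) : ℝ) +
        ((∑ v ∈ Finset.range n with R v * d ≤ n * l, L.degAt v : ℕ) : ℝ) := by
    exact_mod_cast hsplit
  have hmin : 0 ≤ n * min (avgDegree G / degreeFloor G) (Real.sqrt (avgDegree G)) :=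
    mul_nonneg hnR.le (le_min (div_nonneg hD0 (by linarith)) hs0)
  generalize (n : ℝ) * min (avgDegree G / degreeFloor G) (Real.sqrt (avgDegree G)) = W at *
  have : W ≤ l * W := le_mul_of_one_le_left hmin hlR
  linarith

/-! ### The main theorem -/

/-- The expression does not probe the adjacency list. -/
def Exp.listFree : Exp → Bool
  | .var _ | .lit _ => true
  | .bin _ e f | .adj e f => e.listFree && f.listFree
  | .mem e => e.listFree
  | .deg _ | .nbr _ _ => false

lemma Exp.isQuery_comp : ∀ (e : Exp) (x : ℕ), e.listFree = true → (e.comp x).IsQuery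
  | .var _, _, _ | .lit _, _, _ => trivial
  | .bin _ e f, x, h | .adj e f, x, h =>
    have h' := (Bool.and_eq_true _ _).mp h
    ⟨e.isQuery_comp x h'.1, f.isQuery_comp _ h'.2, trivial⟩
  | .mem e, x, h => ⟨e.isQuery_comp x h, trivial⟩

lemma queryCmd_isQuery : queryCmd.IsQuery :=
  ⟨Exp.isQuery_comp _ _ (by decide), trivial⟩

/-- The algorithm with success parameter `K`. -/
noncomputable def oracleAlgorithm (K : ℕ) : OracleAlgorithm :=
  ⟨preprocessCmd K, queryCmd, queryCmd_isQuery⟩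

/-! ### Binary lengths versus logarithms, and the final constants. -/

lemma log_le_size (n : ℕ) (hn : 0 < n) : Real.log n ≤ n.size := by
  rw [Real.log_le_iff_le_exp (by exact_mod_cast hn)]
  have h1 : (n : ℝ) ≤ 2 ^ n.size := by exact_mod_cast (Nat.lt_size_self n).le
  refine h1.trans ?_
  rw [← Real.exp_one_pow]
  exact pow_le_pow_left₀ (by norm_num) (by linarith [Real.add_one_le_exp 1]) _

lemma size_le_log (hn : 2 ≤ n) : (n.size : ℝ) ≤ 3 * Real.log n := by
  have hn0 : (0 : ℝ) < n := by exact_mod_cast (by omega : 0 < n)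
  obtain ⟨j, hj⟩ : ∃ j, n.size = j + 1 :=
    ⟨n.size - 1, by have := Nat.size_pos.2 (by omega : 0 < n); omega⟩
  have h1 : (2 : ℝ) ^ j ≤ n := by exact_mod_cast (pow_le_of_size_eq hj).1
  have h2 : j * Real.log 2 ≤ Real.log n := by
    rw [← Real.log_pow]
    exact Real.log_le_log (by positivity) h1
  have h3 : Real.log 2 ≤ Real.log n :=
    Real.log_le_log (by norm_num) (by exact_mod_cast hn)
  have h4 := Real.log_two_gt_d9
  have h5 : (0 : ℝ) ≤ j := Nat.cast_nonneg _
  rw [hj]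
  push_cast
  nlinarith

/-- The number of bad events is at most n^7 for n ≥ 2, and each has probability at most n^{-K}; this
explains the 7. -/
lemma failure_le {c : ℝ} {K : ℕ} (hn : 2 ≤ n) (hK : ⌈c⌉₊ + 7 ≤ K) :
    ((((n + 1) ^ 3 + 2 * n + 1 : ℕ) : ℝ≥0∞) * ENNReal.ofReal (Real.exp (-(K * n.size : ℕ)))) ≤
      ENNReal.ofReal (1 / (n : ℝ) ^ c) := by
  have hn0 : (0 : ℝ) < n := by exact_mod_cast (by omega : 0 < n)
  have hn1 : (1 : ℝ) ≤ n := by exact_mod_cast (by omega : 1 ≤ n)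
  have hn2 : (2 : ℝ) ≤ n := by exact_mod_cast hn
  rw [← ENNReal.ofReal_natCast, ← ENNReal.ofReal_mul (Nat.cast_nonneg _)]
  refine ENNReal.ofReal_le_ofReal ?_
  have h1 : (((n + 1) ^ 3 + 2 * n + 1 : ℕ) : ℝ) ≤ (n : ℝ) ^ 7 := by
    have e1 : (n + 1 : ℝ) ≤ (n : ℝ) ^ 2 := by nlinarith
    have e2 : (n + 1 : ℝ) ^ 3 ≤ (n : ℝ) ^ 6 := by
      calc (n + 1 : ℝ) ^ 3 ≤ ((n : ℝ) ^ 2) ^ 3 := by gcongr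
        _ = _ := by ring
    have e3 : (2 * n + 1 : ℝ) ≤ (n : ℝ) ^ 6 := by
      calc (2 * n + 1 : ℝ) ≤ (n : ℝ) ^ 2 * n := by nlinarith
        _ = (n : ℝ) ^ 3 := by ring
        _ ≤ _ := pow_le_pow_right₀ hn1 (by norm_num)
    push_cast
    calc ((n : ℝ) + 1) ^ 3 + 2 * n + 1 ≤ 2 * (n : ℝ) ^ 6 := by linarith
      _ ≤ n * (n : ℝ) ^ 6 := by gcongr
      _ = _ := by ring
  have h2 : Real.exp (-(K * n.size : ℕ)) ≤ (n : ℝ) ^ (-(K : ℝ)) := by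
    rw [Real.rpow_def_of_pos hn0]
    refine Real.exp_le_exp.2 ?_
    push_cast
    have := mul_le_mul_of_nonneg_left (log_le_size n (by omega)) (Nat.cast_nonneg (α := ℝ) K)
    linarith
  calc _ ≤ (n : ℝ) ^ 7 * (n : ℝ) ^ (-(K : ℝ)) := by gcongr
    _ = (n : ℝ) ^ (7 - (K : ℝ)) := by
      rw [← Real.rpow_natCast, ← Real.rpow_add hn0]; norm_num [sub_eq_add_neg]
    _ ≤ (n : ℝ) ^ (-c) := by
      refine Real.rpow_le_rpow_of_exponent_le hn1 ?_
      have e1 := Nat.le_ceil c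
      have e2 : ((⌈c⌉₊ : ℝ) + 7) ≤ K := by exact_mod_cast hK
      linarith
    _ = _ := by rw [Real.rpow_neg hn0.le, one_div]

lemma unitCost_mul_le {K r : ℕ} (hn : 2 ≤ n) (hK : 0 < K) (hr : 1 ≤ r) {μ X : ℝ} (hμ : 0 ≤ μ)
    (hX : X ≤ 3 * (K * n.size : ℕ) * (n * μ) + 5 * (n * (K * n.size : ℕ))) :
    (unitCost (r.size + n.size + 4) : ℝ) + 50 * unitCost ((K.size + 8) * n.size) * (n + 1) +
      20 * unitCost ((K.size + 8) * n.size) * (n * ((min r n : ℕ) * (K * n.size)) + 1) +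
      7 * unitCost ((K.size + 8) * n.size) * X ≤
    20000000 * K ^ 2 * n.size ^ 2 * (n * μ + n * r) := by
  have hnR : (2 : ℝ) ≤ n := by exact_mod_cast hn
  have hKR : (1 : ℝ) ≤ K := by exact_mod_cast hK
  have hrR : (1 : ℝ) ≤ r := by exact_mod_cast hr
  have hSR : (1 : ℝ) ≤ n.size := by exact_mod_cast Nat.size_pos.2 (by omega : 0 < n)
  have hk0 : (0 : ℝ) ≤ K.size := Nat.cast_nonneg _
  have hKs : (K.size : ℝ) ≤ K := by exact_mod_cast size_le_self K
  have hrs : (r.size : ℝ) ≤ r := by exact_mod_cast size_le_self r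
  have hmr : ((min r n : ℕ) : ℝ) ≤ r := by exact_mod_cast min_le_left _ _
  rw [unitCost_eq, unitCost_eq]
  push_cast at hX hmr ⊢
  generalize (min (r : ℝ) n) = r' at *
  generalize (n.size : ℝ) = S at *
  generalize (K.size : ℝ) = k at *
  generalize (r.size : ℝ) = s at *
  obtain ⟨W, hW⟩ : ∃ W, W = n * μ + n * r := ⟨_, rfl⟩
  obtain ⟨P, hP⟩ : ∃ P, P = K * S := ⟨_, rfl⟩
  have hP1 : 1 ≤ P := by rw [hP]; exact one_le_mul_of_one_le_of_one_le hKR hSR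
  have hSP : S ≤ P := by rw [hP]; exact le_mul_of_one_le_left (by linarith) hKR
  have hnr : (n : ℝ) * r ≤ W := by rw [hW]; nlinarith
  have hnμ : (n : ℝ) * μ ≤ W := by rw [hW]; nlinarith
  have hn' : (n : ℝ) ≤ W := le_trans (by nlinarith) hnr
  have hr' : (r : ℝ) ≤ W := le_trans (by nlinarith) hnr
  have hW1 : 1 ≤ W := by linarith
  have hPW : W ≤ P * W := le_mul_of_one_le_left (by linarith) hP1
  have hPP : P * W ≤ P ^ 2 * W := by
    rw [sq, mul_assoc]; exact le_mul_of_one_le_left (by nlinarith) hP1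
  have hu : 10000 * ((k + 8) * S) ≤ 90000 * P := by
    rw [hP]; nlinarith
  have hbr : 50 * ((n : ℝ) + 1) + 20 * (n * (r' * (K * S)) + 1) + 7 * X ≤ 196 * (P * W) := by
    have e1 : (n : ℝ) * (r' * (K * S)) ≤ P * W := by
      rw [← hP]
      calc (n : ℝ) * (r' * P) ≤ n * (r * P) := by gcongr
        _ = P * (n * r) := by ring
        _ ≤ _ := by gcongr
    have e2 : X ≤ 8 * (P * W) := by
      rw [← hP] at hX
      have f1 : P * (n * μ) ≤ P * W := by gcongr
      have f2 : P * n ≤ P * W := by gcongr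
      linarith
    linarith
  -- The bit length of the original r is at most r, so reading it is paid for by the term nr.
  have hstart : 10000 * (s + S + 4) ≤ 60000 * (P ^ 2 * W) := by
    have : S ≤ P * W := hSP.trans (le_mul_of_one_le_right (by linarith) hW1)
    linarith
  calc _ = 10000 * (s + S + 4) + 10000 * ((k + 8) * S) *
        (50 * ((n : ℝ) + 1) + 20 * (n * (r' * (K * S)) + 1) + 7 * X) := by ring
    _ ≤ 60000 * (P ^ 2 * W) + 10000 * ((k + 8) * S) * (196 * (P * W)) := by
      gcongr
    _ ≤ 60000 * (P ^ 2 * W) + 90000 * P * (196 * (P * W)) := by gcongr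
    _ ≤ 20000000 * (P ^ 2 * W) := by nlinarith
    _ = _ := by rw [hP, hW]; ring

lemma le_spannerProb {c : ℝ} {K r : ℕ} (hn : 2 ≤ n) (hK : ⌈c⌉₊ + 7 ≤ K) (hr : 1 ≤ r)
    (L : AdjacencyList G) :
    ENNReal.ofReal (1 - 1 / (n : ℝ) ^ c) ≤
      (oracleAlgorithm K).spannerProb L r 5
        (20000000 * K ^ 2 * n.size ^ 2 *
          (n * min (avgDegree G / degreeFloor G) (Real.sqrt (avgDegree G)) + n * r))
        (90000 * K * n.size)
        (100 * K ^ 2 * n.size ^ 3 *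
          ((n : ℝ) ^ 2 / (r * degreeFloor G) + (n : ℝ) ^ 2 / degreeFloor G ^ 2 + n)) := by
  classical
  have hn0 : 0 < n := by omega
  have hK0 : 0 < K := by omega
  have hs2 : 2 ≤ n.size := Nat.lt_size.2 (by simpa using hn)
  obtain ⟨s, hs⟩ : ∃ s, s = startState n r := ⟨_, rfl⟩
  have hB : Bdd n (r.size + n.size + 4) s.regs s.mem := by
    rw [hs]
    refine ⟨by omega, by omega, fun x _ => ?_, fun a => ?_⟩
    · simp only [startState]
      split_ifs
      · omega
      · omega
      · simp
    · simp [startState]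
  have hβ : K.size + 6 * n.size + 2 ≤ (K.size + 8) * n.size := by nlinarith
  have hpr := pr_preprocess (L := L) (r := r) hn hK0 hB hβ (by rw [hs]; rfl) (by rw [hs]; rfl)
    (fun x hx => by
      rw [hs]; simp only [startState]; rw [if_neg (by omega), if_neg (by omega)])
    (fun a => by rw [hs]; rfl) s ⟨fun _ _ => rfl, rfl⟩
  have hbad := hpr.trans (failure_le hn hK)
  have hpow : (0 : ℝ) ≤ 1 / (n : ℝ) ^ c := by positivity
  rw [ENNReal.ofReal_sub _ hpow, ENNReal.ofReal_one]
  refine (tsub_le_tsub_left hbad _).trans (tsub_le_iff_right.2 ?_)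
  rw [OracleAlgorithm.spannerProb, ← hs]
  refine le_trans ?_ (MeasureTheory.measure_union_le _ _)
  -- The success event and the failure of the postcondition together cover all outcomes.
  refine ((PMF.toOuterMeasure_apply_eq_one_iff _ _).2 fun t _ => ?_).ge
  rw [Set.mem_union]
  refine or_iff_not_imp_right.2 fun hP => ?_
  rw [Set.mem_ofPred_eq, not_not] at hP
  obtain ⟨ρ', k, -, htime, d, hd, hB', hO, hk⟩ := hP
  have hs0 : s.time = 0 := by rw [hs]; rfl
  rw [hs0, zero_add] at htime
  rw [Set.mem_ofPred_eq]
  refine ⟨?_, spanner G t.mem, hO.isSpanner, hO.ncard_spanner_le_real hn0 hK0 hr, ?_⟩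
  · have hD0 : 0 ≤ avgDegree G := avgDegree_nonneg
    have hδ1 : 1 ≤ degreeFloor G := one_le_degreeFloor hn0
    have hμ : 0 ≤ min (avgDegree G / degreeFloor G) (Real.sqrt (avgDegree G)) :=
      le_min (div_nonneg hD0 (by linarith)) (Real.sqrt_nonneg _)
    refine le_trans ?_ (unitCost_mul_le hn hK0 hr hμ
      (sum_scanned_le hn0 (Nat.mul_pos hK0 (by omega)) hd hO.ranks))
    exact_mod_cast htime.trans hk
  · have hU : (unitCost ((K.size + 8) * n.size) : ℝ) ≤ 90000 * K * n.size := by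
      rw [unitCost_eq]
      have h1 : K.size + 8 ≤ 9 * K := by have := size_le_self K; omega
      have h2 : 10000 * ((K.size + 8) * n.size) ≤ 90000 * K * n.size := by nlinarith
      exact_mod_cast h2
    intro u v t' ht'
    obtain ⟨h1, h2⟩ := isAdjacencyOracle_spanner hB' hO.five u v t' ht'
    exact ⟨h1, h2.trans hU⟩

lemma spannerProb_mono (A : OracleAlgorithm) (L : AdjacencyList G) (r k : ℕ)
    {T T' B B' M M' : ℝ} (hT : T ≤ T') (hB : B ≤ B') (hM : M ≤ M') :
    A.spannerProb L r k T B M ≤ A.spannerProb L r k T' B' M' := by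
  refine MeasureTheory.measure_mono ?_
  rintro s ⟨h1, H, h2, h3, h4⟩
  exact ⟨h1.trans hT, H, h2, h3.trans hM, fun u v t ht =>
    ⟨(h4 u v t ht).1, (h4 u v t ht).2.trans hB⟩⟩

/-- Both r and δ are at least n^{1/3}, so both quotients are at most n² / n^{2/3}. For the time, √D
≤ √n, and r is at most 2n^{1/3} ≤ 2√n. -/
lemma ceil_rpow_third_bounds (hn : 2 ≤ n) (G : SimpleGraph (Fin n)) (L : AdjacencyList G) :
    n * min (avgDegree G / degreeFloor G) (Real.sqrt (avgDegree G)) +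
        n * (⌈(n : ℝ) ^ (1 / 3 : ℝ)⌉₊ : ℝ) ≤ 3 * (n : ℝ) ^ (3 / 2 : ℝ) ∧
      (n : ℝ) ^ 2 / (⌈(n : ℝ) ^ (1 / 3 : ℝ)⌉₊ * degreeFloor G) +
        (n : ℝ) ^ 2 / degreeFloor G ^ 2 + n ≤ 3 * (n : ℝ) ^ (4 / 3 : ℝ) := by
  have hn0 : (0 : ℝ) < n := by exact_mod_cast (by omega : 0 < n)
  have hn1 : (1 : ℝ) ≤ n := by exact_mod_cast (by omega : 1 ≤ n)
  have hδ : (n : ℝ) ^ (1 / 3 : ℝ) ≤ degreeFloor G := le_max_right _ _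
  have hx3 := rpow_third_pow n
  have hx1 : 1 ≤ (n : ℝ) ^ (1 / 3 : ℝ) := Real.one_le_rpow hn1 (by norm_num)
  have hr1 : (n : ℝ) ^ (1 / 3 : ℝ) ≤ ⌈(n : ℝ) ^ (1 / 3 : ℝ)⌉₊ := Nat.le_ceil _
  have hr2 : (⌈(n : ℝ) ^ (1 / 3 : ℝ)⌉₊ : ℝ) ≤ 2 * (n : ℝ) ^ (1 / 3 : ℝ) := by
    have := Nat.ceil_lt_add_one (by linarith : (0 : ℝ) ≤ (n : ℝ) ^ (1 / 3 : ℝ))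
    linarith
  have h32 : (n : ℝ) ^ (3 / 2 : ℝ) = n * Real.sqrt n := by
    rw [Real.sqrt_eq_rpow, ← Real.rpow_one_add' hn0.le (by norm_num)]; norm_num
  have h43 : (n : ℝ) ^ (4 / 3 : ℝ) = n * (n : ℝ) ^ (1 / 3 : ℝ) := by
    rw [← Real.rpow_one_add' hn0.le (by norm_num)]; norm_num
  have hxs : (n : ℝ) ^ (1 / 3 : ℝ) ≤ Real.sqrt n := by
    rw [Real.sqrt_eq_rpow]
    exact Real.rpow_le_rpow_of_exponent_le hn1 (by norm_num)
  rw [h32, h43]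
  generalize (⌈(n : ℝ) ^ (1 / 3 : ℝ)⌉₊ : ℝ) = r at *
  generalize (n : ℝ) ^ (1 / 3 : ℝ) = x at *
  constructor
  · have h1 : min (avgDegree G / degreeFloor G) (Real.sqrt (avgDegree G)) ≤ Real.sqrt n :=
      (min_le_right _ _).trans (Real.sqrt_le_sqrt (avgDegree_le L (by omega)))
    have h2 := mul_le_mul_of_nonneg_left h1 hn0.le
    have h3 := mul_le_mul_of_nonneg_left (hr2.trans (by linarith : 2 * x ≤ 2 * Real.sqrt n)) hn0.le
    linarith
  · have hx0 : 0 < x := by linarith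
    have hr0 : 0 ≤ r := by linarith
    have e : (n : ℝ) ^ 2 / x ^ 2 = n * x := by
      rw [div_eq_iff (by positivity)]
      nth_rewrite 1 [sq, ← hx3]
      ring
    have h1 : (n : ℝ) ^ 2 / (r * degreeFloor G) ≤ (n : ℝ) ^ 2 / x ^ 2 := by
      rw [sq x]; gcongr
    have h2 : (n : ℝ) ^ 2 / degreeFloor G ^ 2 ≤ (n : ℝ) ^ 2 / x ^ 2 := by gcongr
    have h3 : (n : ℝ) ≤ n * x := le_mul_of_one_le_right hn0.le hx1
    rw [e] at h1 h2
    linarith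

/-- The bounds of `le_spannerProb` in terms of the logarithm. -/
lemma le_spannerProb_log {c : ℝ} {K r : ℕ} (hn : 2 ≤ n) (hK : ⌈c⌉₊ + 7 ≤ K) (hr : 1 ≤ r)
    (L : AdjacencyList G) :
    ENNReal.ofReal (1 - 1 / (n : ℝ) ^ c) ≤
      (oracleAlgorithm K).spannerProb L r 5
        (540000000 * K ^ 2 * Real.log n ^ 3 *
          (n * min (avgDegree G / degreeFloor G) (Real.sqrt (avgDegree G)) + n * r))
        (540000000 * K ^ 2 * Real.log n ^ 3)
        (540000000 * K ^ 2 * Real.log n ^ 3 *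
          ((n : ℝ) ^ 2 / (r * degreeFloor G) + (n : ℝ) ^ 2 / degreeFloor G ^ 2 + n)) := by
  have hn0 : 0 < n := by omega
  have hD0 : 0 ≤ avgDegree G := avgDegree_nonneg
  have hδ1 : 1 ≤ degreeFloor G := one_le_degreeFloor hn0
  have hμ : 0 ≤ min (avgDegree G / degreeFloor G) (Real.sqrt (avgDegree G)) :=
    le_min (div_nonneg hD0 (by linarith)) (Real.sqrt_nonneg _)
  have hδ0 : 0 ≤ degreeFloor G := by linarith
  have hKR : (1 : ℝ) ≤ K := by exact_mod_cast (by omega : 1 ≤ K)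
  have hS1 : (1 : ℝ) ≤ n.size := by exact_mod_cast Nat.size_pos.2 hn0
  have hSl := size_le_log hn
  have hS3 : (n.size : ℝ) ^ 3 ≤ 27 * Real.log n ^ 3 := by
    calc (n.size : ℝ) ^ 3 ≤ (3 * Real.log n) ^ 3 := by gcongr
      _ = _ := by ring
  have hS2 : (n.size : ℝ) ^ 2 ≤ n.size ^ 3 := pow_le_pow_right₀ hS1 (by norm_num)
  have hS : (n.size : ℝ) ≤ n.size ^ 3 := le_self_pow₀ hS1 (by norm_num)
  have hKK : (K : ℝ) ≤ K ^ 2 := le_self_pow₀ hKR (by norm_num)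
  have key : 20000000 * (K : ℝ) ^ 2 * n.size ^ 3 ≤ 540000000 * K ^ 2 * Real.log n ^ 3 := by
    calc 20000000 * (K : ℝ) ^ 2 * n.size ^ 3 ≤ 20000000 * (K : ℝ) ^ 2 * (27 * Real.log n ^ 3) := by
          gcongr
      _ = _ := by ring
  refine (le_spannerProb hn hK hr L).trans (spannerProb_mono _ _ _ _ ?_ ?_ ?_)
  · refine mul_le_mul_of_nonneg_right (le_trans ?_ key) (by positivity)
    gcongr
  · refine le_trans ?_ key
    gcongr
    norm_num
  · refine mul_le_mul_of_nonneg_right (le_trans ?_ key) (by positivity)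
    gcongr
    norm_num

end SpannerOracle

theorem mainTheorem5 :
    ∀ c : ℝ, 0 < c →
      ∃ (A : OracleAlgorithm) (C : ℝ) (k : ℕ), 0 < C ∧
        (∀ (n : ℕ), 2 ≤ n → ∀ (G : SimpleGraph (Fin n)) (L : AdjacencyList G) (r : ℕ), 1 ≤ r →
          ENNReal.ofReal (1 - 1 / (n : ℝ) ^ c) ≤
            A.spannerProb L r 5
              (C * Real.log n ^ k *
                (n * min (avgDegree G / degreeFloor G) (Real.sqrt (avgDegree G)) + n * r))
              (C * Real.log n ^ k)
              (C * Real.log n ^ k *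
                ((n : ℝ) ^ 2 / (r * degreeFloor G) + (n : ℝ) ^ 2 / degreeFloor G ^ 2 + n))) ∧
        (∀ (n : ℕ), 2 ≤ n → ∀ (G : SimpleGraph (Fin n)) (L : AdjacencyList G),
          ENNReal.ofReal (1 - 1 / (n : ℝ) ^ c) ≤
            A.spannerProb L ⌈(n : ℝ) ^ (1 / 3 : ℝ)⌉₊ 5
              (C * Real.log n ^ k * (n : ℝ) ^ (3 / 2 : ℝ))
              (C * Real.log n ^ k)
              (C * Real.log n ^ k * (n : ℝ) ^ (4 / 3 : ℝ))) := by
  intro c _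
  obtain ⟨K, hK⟩ : ∃ K, K = ⌈c⌉₊ + 7 := ⟨_, rfl⟩
  have hKR : (0 : ℝ) < K := by exact_mod_cast (by omega : 0 < K)
  have hlog : ∀ n : ℕ, 2 ≤ n → 0 ≤ 540000000 * (K : ℝ) ^ 2 * Real.log n ^ 3 := fun n hn => by
    have := Real.log_natCast_nonneg n
    positivity
  -- The factor 3 is needed only for the choice of r as the cube root. The exponent 3 comes from the
  -- edge count: l² and the number of levels.
  refine ⟨SpannerOracle.oracleAlgorithm K, 3 * (540000000 * K ^ 2), 3, by positivity,
    fun n hn G L r hr => ?_, fun n hn G L => ?_⟩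
  · have h0 := hlog n hn
    have hδ1 : 1 ≤ degreeFloor G := SpannerOracle.one_le_degreeFloor (by omega)
    have hμ : 0 ≤ min (avgDegree G / degreeFloor G) (Real.sqrt (avgDegree G)) :=
      le_min (div_nonneg SpannerOracle.avgDegree_nonneg (by linarith)) (Real.sqrt_nonneg _)
    have hδ0 : 0 ≤ degreeFloor G := by linarith
    have hle : 540000000 * (K : ℝ) ^ 2 * Real.log n ^ 3 ≤
        3 * (540000000 * K ^ 2) * Real.log n ^ 3 := by linarith
    refine (SpannerOracle.le_spannerProb_log hn hK.ge hr L).trans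
      (SpannerOracle.spannerProb_mono _ _ _ _ ?_ hle ?_)
    · exact mul_le_mul_of_nonneg_right hle (by positivity)
    · exact mul_le_mul_of_nonneg_right hle (by positivity)
  · have h0 := hlog n hn
    obtain ⟨h1, h2⟩ := SpannerOracle.ceil_rpow_third_bounds hn G L
    have hr : 1 ≤ ⌈(n : ℝ) ^ (1 / 3 : ℝ)⌉₊ :=
      Nat.one_le_ceil_iff.2 (Real.rpow_pos_of_pos (by exact_mod_cast (by omega : 0 < n)) _)
    refine (SpannerOracle.le_spannerProb_log hn hK.ge hr L).trans
      (SpannerOracle.spannerProb_mono _ _ _ _ ?_ ?_ ?_)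
    · refine (mul_le_mul_of_nonneg_left h1 h0).trans (le_of_eq (by ring))
    · linarith
    · refine (mul_le_mul_of_nonneg_left h2 h0).trans (le_of_eq (by ring))
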